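/- Let $\bar{\mathfrak g}$ be a simple finite-dimensional complex Lie algebra with simple roots numbered $1,\dots,r$, Cartan matrix $(a_{\alpha\beta})$, $a_{\alpha\beta}=\langle\beta,\alpha^\vee\rangle$, and positive integers $d_\alpha$ such that $(d_\alpha a_{\alpha\beta})$ is symmetric. Let $q\in\mathbb C^\times$ and put $q_\alpha=q^{d_\alpha}$, $(\alpha,\beta)=d_\alpha a_{\alpha\beta}$, so $q^{(\alpha,\beta)}=q_\alpha^{a_{\alpha\beta}}$. *The algebra $U_q\mathfrak n_+$.* It is the unital associative $\mathbb C$-algebra with generators $e_\alpha[n]$ ($1\le\alpha\le r$, $n\in\mathbb Z$) and, for $e_\alpha(z)=\sum_{n}e_\alpha[n]z^{-n}$, the relations $$(q^{(\alpha,\beta)}z-w)\,e_\alpha(z)e_\beta(w)=(z-q^{(\alpha,\beta)}w)\,e_\beta(w)e_\alpha(z)$$ for all $\alpha,\beta$, and, for $\alpha\ne\beta$ and $N=1-a_{\alpha\beta}$, $$\sum_{p=0}^{N}(-1)^p\begin{bmatrix}N\\p\end{bmatrix}_{q_\alpha}\operatorname{Sym}_{z_1,\dots,z_N}\bigl(e_\alpha(z_1)\cdots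 e_\alpha(z_p)\,e_\beta(w)\,e_\alpha(z_{p+1})\cdots e_\alpha(z_N)\bigr)=0,$$ where the Gaussian binomial coefficients are those built from $[n]_q=\frac{q^n-q^{-n}}{q-q^{-1}}$, regarded as Laurent polynomials in $q$. *The spaces $\overline{Sh}$ and $Sh$.* For $\mathbf n=(n_1,\dots,n_r)\in\mathbb N^r$ take variables $z^{(\alpha)}_i$ ($1\le\alpha\le r$, $1\le i\le n_\alpha$), totally ordered as $z^{(1)}_1,z^{(1)}_2,\dots,z^{(r)}_{n_r}$; the variable $z^{(\alpha)}_i$ has color $\alpha$. Let $\overline{Sh}_{\mathbf n}$ be the space of rational functions (identified with their expansions in $\mathbb C((z^{(1)}_1))((z^{(1)}_2))\cdots((z^{(r)}_{n_r}))$) of the form $$f=\frac{\prod_\alpha\prod_{i<j}(z^{(\alpha)}_i-z^{(\alpha)}_j)}{\prod_{\alpha\le\beta}\ \prod_{i,j;\ i<j\text{ if }\alpha=\beta}(z^{(\alpha)}_i-q^{(\alpha,\beta)}z^{(\beta)}_j)}\;A(z^{(\alpha)}_i),\qquad(\ast)$$ where $A$ is a Laurent polynomial symmetric in the variables $z^{(\alpha)}_1,\dots,z^{(\alpha)}_{n_\alpha}$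 for each $\alpha$. Let $Sh_{\mathbf n}\subset\overline{Sh}_{\mathbf n}$ consist of those $f$ for which moreover, for all $\alpha\ne\beta$, all pairwise distinct $i_1,\dots,i_{1-a_{\alpha\beta}}\in\{1,\dots,n_\alpha\}$ and all $j\in\{1,\dots,n_\beta\}$, $A$ vanishes at every point with nonzero coordinates such that $$z^{(\alpha)}_{i_1}=q_\alpha^{2}z^{(\alpha)}_{i_2}=\cdots=q_\alpha^{-2a_{\alpha\beta}}z^{(\alpha)}_{i_{1-a_{\alpha\beta}}}=q_\alpha^{-a_{\alpha\beta}}z^{(\beta)}_j .$$ Put $\overline{Sh}=\bigoplus_{\mathbf n\in\mathbb N^r}\overline{Sh}_{\mathbf n}$ and $Sh=\bigoplus_{\mathbf n\in\mathbb N^r}Sh_{\mathbf n}$. *The product.* For $f\in\overline{Sh}_{\mathbf n}$, $g\in\overline{Sh}_{\mathbf m}$, with $N=\sum_\alpha n_\alpha$, $M=\sum_\alpha m_\alpha$, let $z_1,\dots,z_{N+M}$ be the variables of degree $\mathbf n+\mathbf m$ in their total order, $\alpha(i)$ the color of $z_i$, and set $$(f*g)(z_1,\dots,z_{N+M})=\sum_{\sigma}\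 \prod_{i<j,\ \sigma^{-1}(i)>\sigma^{-1}(j)}\frac{q^{(\alpha(i),\alpha(j))}z_i-z_j}{z_i-q^{(\alpha(i),\alpha(j))}z_j}\ f(z_{\sigma(1)},\dots,z_{\sigma(N)})\,g(z_{\sigma(N+1)},\dots,z_{\sigma(N+M)}),$$ where $\sigma$ runs over the permutations of $\{1,\dots,N+M\}$ that are increasing on $\{1,\dots,N\}$ and on $\{N+1,\dots,N+M\}$ and that substitute for each variable of $f$ and of $g$ a variable of the same color. **Theorem.** The product $*$ makes $\overline{Sh}$ a unital associative algebra, with unit $1\in\overline{Sh}_{0}$, and there exists a morphism of unital algebras $$\pi:U_q\mathfrak n_+\to\overline{Sh},\qquad \pi(e_\alpha[n])=(z^{(\alpha)}_1)^n\in\overline{Sh}_{\delta_\alpha}\quad(1\le\alpha\le r,\ n\in\mathbb Z),$$ where $(\delta_\alpha)_\beta=\delta_{\alpha\beta}$. If $\bar{\mathfrak g}$ is not of type $G_2$, then $\pi(U_q\mathfrak n_+)\subset Sh$. -/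

import Mathlib

noncomputable section

open scoped Classical

namespace DrinfeldShuffle

/-! Conventions. The simple roots are numbered by `Fin r`. Throughout, `a` is the Cartan matrix
(Kac's convention: `a α β = ⟨β, α^∨⟩`) and `d` the vector of symmetrizing factors, so that
`(α, β) = d α * a α β` is symmetric. -/

variable {r : ℕ}

/-- `q_α = q ^ d_α`. -/
def qRoot (q : ℂ) (d : Fin r → ℕ) (α : Fin r) : ℂ := q ^ d α

/-- `q ^ (α, β) = q_α ^ a_{αβ}`. -/
def qPair (q : ℂ) (d : Fin r → ℕ) (a : Matrix (Fin r) (Fin r) ℤ) (α β : Fin r) : ℂ :=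
  qRoot q d α ^ a α β

/-- The Gaussian binomial coefficient `[n]! / ([p]! [n-p]!)`, for `[n] = (q^n - q^{-n})/(q - q^{-1})`,
as a Laurent polynomial in `q` (computed by Pascal's rule) evaluated at `q`. -/
def qBinom (q : ℂ) : ℕ → ℕ → ℂ
  | _, 0 => 1
  | 0, _ + 1 => 0
  | n + 1, p + 1 =>
      q ^ (p + 1) * qBinom q n (p + 1) + (q⁻¹) ^ (n - p) * qBinom q n p

/-! ### The algebra `U_q n_+` -/

/-- The free generator `e_α[n]`. -/
def freeE (α : Fin r) (n : ℤ) : FreeAlgebra ℂ (Fin r × ℤ) := FreeAlgebra.ι ℂ (α, n)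

/-- The coefficient of `z_1^{-n_1} ⋯ z_N^{-n_N} w^{-m}`, `N = 1 - a_{αβ}`, in the left-hand side of the
quantum Serre relation
`∑_p (-1)^p [N choose p]_{q_α} Sym_z (e_α(z_1) ⋯ e_α(z_p) e_β(w) e_α(z_{p+1}) ⋯ e_α(z_N)) = 0`. -/
def serreElt (q : ℂ) (d : Fin r → ℕ) (a : Matrix (Fin r) (Fin r) ℤ) (α β : Fin r)
    (n : Fin (1 - a α β).toNat → ℤ) (m : ℤ) : FreeAlgebra ℂ (Fin r × ℤ) :=
  ∑ p ∈ Finset.range ((1 - a α β).toNat + 1),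
    ((-1) ^ p * qBinom (qRoot q d α) (1 - a α β).toNat p) •
      ∑ σ : Equiv.Perm (Fin (1 - a α β).toNat),
        ((List.ofFn fun i => freeE α (n (σ i))).take p).prod * freeE β m *
          ((List.ofFn fun i => freeE α (n (σ i))).drop p).prod

/-- The defining relations of `U_q n_+`, mode by mode: the vertex relations
`(q^{(α,β)} z - w) e_α(z) e_β(w) = (z - q^{(α,β)} w) e_β(w) e_α(z)` (coefficient of `z^{-k} w^{-l}`,
where `e_α(z) = ∑ e_α[n] z^{-n}`) and the quantum Serre relations. -/
inductive Rel (q : ℂ) (d : Fin r → ℕ) (a : Matrix (Fin r) (Fin r) ℤ) :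
    FreeAlgebra ℂ (Fin r × ℤ) → FreeAlgebra ℂ (Fin r × ℤ) → Prop
  | vertex (α β : Fin r) (k l : ℤ) :
      Rel q d a
        (qPair q d a α β • (freeE α (k + 1) * freeE β l) - freeE α k * freeE β (l + 1))
        (freeE β l * freeE α (k + 1) - qPair q d a α β • (freeE β (l + 1) * freeE α k))
  | serre (α β : Fin r) (h : α ≠ β) (n : Fin (1 - a α β).toNat → ℤ) (m : ℤ) :
      Rel q d a (serreElt q d a α β n m) 0

/-- The algebra `U_q n_+`, by generators and relations. -/
abbrev UqNPos (q : ℂ) (d : Fin r → ℕ) (a : Matrix (Fin r) (Fin r) ℤ) : Type :=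
  RingQuot (Rel q d a)

/-- The generator `e_α[n]` of `U_q n_+`. -/
def eGen (q : ℂ) (d : Fin r → ℕ) (a : Matrix (Fin r) (Fin r) ℤ) (α : Fin r) (n : ℤ) :
    UqNPos q d a :=
  RingQuot.mkAlgHom ℂ (Rel q d a) (freeE α n)

/-! ### Variables, rational functions, Laurent polynomials -/

/-- The variables `z^{(α)}_i`, `1 ≤ i ≤ n_α` (numbered from `0` here). -/
abbrev Vars (n : Fin r → ℕ) : Type := (α : Fin r) × Fin (n α)

/-- The total order `z^{(1)}_1, z^{(1)}_2, …, z^{(r)}_{n_r}` of the variables: strict precedence. -/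
def Before {n : Fin r → ℕ} (u v : Vars n) : Prop :=
  u.1 < v.1 ∨ (u.1 = v.1 ∧ u.2.val < v.2.val)

/-- Rational functions in the variables `z^{(α)}_i`. -/
def RatFn (n : Fin r → ℕ) : Type := FractionRing (MvPolynomial (Vars n) ℂ)

instance (n : Fin r → ℕ) : Field (RatFn n) :=
  inferInstanceAs (Field (FractionRing (MvPolynomial (Vars n) ℂ)))

instance (n : Fin r → ℕ) : Algebra (MvPolynomial (Vars n) ℂ) (RatFn n) :=
  inferInstanceAs (Algebra (MvPolynomial (Vars n) ℂ) (FractionRing (MvPolynomial (Vars n) ℂ)))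

instance (n : Fin r → ℕ) : IsFractionRing (MvPolynomial (Vars n) ℂ) (RatFn n) :=
  inferInstanceAs (IsFractionRing (MvPolynomial (Vars n) ℂ)
    (FractionRing (MvPolynomial (Vars n) ℂ)))

instance (n : Fin r → ℕ) : Algebra ℂ (RatFn n) :=
  ((algebraMap (MvPolynomial (Vars n) ℂ) (RatFn n)).comp MvPolynomial.C).toAlgebra

instance (n : Fin r → ℕ) : IsScalarTower ℂ (MvPolynomial (Vars n) ℂ) (RatFn n) :=
  IsScalarTower.of_algebraMap_eq fun _ => rfl

/-- The variable `z_v` as a rational function. -/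
def zv {n : Fin r → ℕ} (v : Vars n) : RatFn n := algebraMap _ _ (MvPolynomial.X v : MvPolynomial (Vars n) ℂ)

/-- Substitution of variables along an injective map. -/
def subst {n k : Fin r → ℕ} (φ : Vars n → Vars k) (hφ : Function.Injective φ) : RatFn n →ₐ[ℂ] RatFn k :=
  IsFractionRing.liftAlgHom
    (g := (IsScalarTower.toAlgHom ℂ (MvPolynomial (Vars k) ℂ) (RatFn k)).comp (MvPolynomial.rename φ))
    ((IsFractionRing.injective (MvPolynomial (Vars k) ℂ) (RatFn k)).comp
      (MvPolynomial.rename_injective φ hφ))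

/-- Laurent polynomials in the variables `z^{(α)}_i`: finitely supported families of complex
coefficients indexed by the exponents. -/
abbrev Laurent (n : Fin r → ℕ) : Type := (Vars n → ℤ) →₀ ℂ

/-- The value of a Laurent polynomial at a point `z` with nonzero coordinates in a field over `ℂ`. -/
def laurentEval {n : Fin r → ℕ} {K : Type} [Field K] [Algebra ℂ K] (z : Vars n → K) :
    Laurent n →ₗ[ℂ] K :=
  Finsupp.linearCombination ℂ fun m => ∏ v, z v ^ m v

/-- Laurent polynomials that are symmetric in each group of variables `z^{(α)}_1, …, z^{(α)}_{n_α}`. -/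
def symLaurent (n : Fin r → ℕ) : Submodule ℂ (Laurent n) where
  carrier := {A | ∀ τ : Equiv.Perm (Vars n), (∀ v, (τ v).1 = v.1) → ∀ m, A (m ∘ τ) = A m}
  add_mem' := fun hA hB τ hτ m => by simp [hA τ hτ m, hB τ hτ m]
  zero_mem' := fun _ _ _ => rfl
  smul_mem' := fun c A hA τ hτ m => by simp [hA τ hτ m]

/-- The symmetric Laurent polynomials with `A = 0` whenever
`z^{(α)}_{i_1} = q_α^2 z^{(α)}_{i_2} = ⋯ = q_α^{-2a} z^{(α)}_{i_{1-a}} = q_α^{-a} z^{(β)}_j`, where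
`a = a_{αβ}`, `α ≠ β` and the `i_k` are pairwise distinct. -/
def vanLaurent (q : ℂ) (d : Fin r → ℕ) (a : Matrix (Fin r) (Fin r) ℤ) (n : Fin r → ℕ) :
    Submodule ℂ (Laurent n) where
  carrier := {A | A ∈ symLaurent n ∧
    ∀ (α β : Fin r), α ≠ β → ∀ (i : Fin (1 - a α β).toNat ↪ Fin (n α)) (j : Fin (n β))
      (z : Vars n → ℂ), (∀ v, z v ≠ 0) →
      (∀ k, qRoot q d α ^ (2 * k.val) * z ⟨α, i k⟩ = qRoot q d α ^ (-a α β) * z ⟨β, j⟩) →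
      laurentEval z A = 0}
  add_mem' := fun hA hB => ⟨add_mem hA.1 hB.1, fun α β h i j z hz hk => by
    rw [map_add, hA.2 α β h i j z hz hk, hB.2 α β h i j z hz hk, add_zero]⟩
  zero_mem' := ⟨zero_mem _, fun _ _ _ _ _ _ _ _ => map_zero _⟩
  smul_mem' := fun c A hA => ⟨Submodule.smul_mem _ c hA.1, fun α β h i j z hz hk => by
    rw [map_smul, hA.2 α β h i j z hz hk, smul_zero]⟩

/-! ### The spaces `Sh̄` and `Sh` -/

/-- The fixed factor
`∏_α ∏_{i<j} (z^{(α)}_i - z^{(α)}_j) / ∏_{α ≤ β} ∏_{i, j; i<j if α=β} (z^{(α)}_i - q^{(α,β)} z^{(β)}_j)`. -/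
def canFactor (q : ℂ) (d : Fin r → ℕ) (a : Matrix (Fin r) (Fin r) ℤ) (n : Fin r → ℕ) : RatFn n :=
  (∏ p : Vars n × Vars n with Before p.1 p.2 ∧ p.1.1 = p.2.1, (zv p.1 - zv p.2)) /
    ∏ p : Vars n × Vars n with Before p.1 p.2,
      (zv p.1 - qPair q d a p.1.1 p.2.1 • zv p.2)

/-- The linear map `A ↦ canFactor * A` from Laurent polynomials to rational functions. -/
def canForm (q : ℂ) (d : Fin r → ℕ) (a : Matrix (Fin r) (Fin r) ℤ) (n : Fin r → ℕ) :
    Laurent n →ₗ[ℂ] RatFn n :=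
  (LinearMap.mulLeft ℂ (canFactor q d a n)).comp (laurentEval zv)

/-- The graded component `Sh̄_n`. -/
def shBarDeg (q : ℂ) (d : Fin r → ℕ) (a : Matrix (Fin r) (Fin r) ℤ) (n : Fin r → ℕ) :
    Submodule ℂ (RatFn n) :=
  (symLaurent n).map (canForm q d a n)

/-- The graded component `Sh_n`. -/
def shDeg (q : ℂ) (d : Fin r → ℕ) (a : Matrix (Fin r) (Fin r) ℤ) (n : Fin r → ℕ) :
    Submodule ℂ (RatFn n) :=
  (vanLaurent q d a n).map (canForm q d a n)

/-- The direct sum of a family of subspaces `W n` of `RatFn n`, `n ∈ ℕ^r`, as the space of finitely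
supported families. -/
def directSum (W : ∀ n : Fin r → ℕ, Submodule ℂ (RatFn n)) : Submodule ℂ (∀ n : Fin r → ℕ, RatFn n) where
  carrier := {F | {n | F n ≠ 0}.Finite ∧ ∀ n, F n ∈ W n}
  add_mem' := fun {F G} hF hG => ⟨(hF.1.union hG.1).subset fun n hn => by
    by_contra h
    simp only [Set.mem_union, Set.mem_ofPred_eq, not_or, not_not] at h
    exact hn (by simp [h.1, h.2]), fun n => add_mem (hF.2 n) (hG.2 n)⟩
  zero_mem' := ⟨by simp, fun n => zero_mem _⟩
  smul_mem' := fun c F hF => ⟨hF.1.subset fun n hn h => hn (by simp [h]),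
    fun n => Submodule.smul_mem _ c (hF.2 n)⟩

/-- `Sh̄ = ⨁_n Sh̄_n`. -/
def ShBar (q : ℂ) (d : Fin r → ℕ) (a : Matrix (Fin r) (Fin r) ℤ) :
    Submodule ℂ (∀ n : Fin r → ℕ, RatFn n) :=
  directSum (shBarDeg q d a)

/-- `Sh = ⨁_n Sh_n`. -/
def Sh (q : ℂ) (d : Fin r → ℕ) (a : Matrix (Fin r) (Fin r) ℤ) :
    Submodule ℂ (∀ n : Fin r → ℕ, RatFn n) :=
  directSum (shDeg q d a)

/-! ### The shuffle product -/

/-- The set of shuffles: bijections from the disjoint union of the variables of `f` and of `g` onto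
the variables of the product that preserve colors and are increasing on the variables of `f` and on
those of `g`. There are none unless `k = n + m`. -/
def shuffles (n m k : Fin r → ℕ) : Finset (Vars n ⊕ Vars m ≃ Vars k) :=
  {σ | (∀ u, (σ (Sum.inl u)).1 = u.1) ∧ (∀ v, (σ (Sum.inr v)).1 = v.1) ∧
    (∀ u u', Before u u' → Before (σ (Sum.inl u)) (σ (Sum.inl u'))) ∧
    (∀ v v', Before v v' → Before (σ (Sum.inr v)) (σ (Sum.inr v')))}

/-- The product of `(q^{(α(i),α(j))} z_i - z_j) / (z_i - q^{(α(i),α(j))} z_j)` over the pairs of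
variables `z_i` before `z_j` that are inverted by the shuffle, that is, `z_i` is a variable of `g` and
`z_j` a variable of `f`. -/
def shFactor (q : ℂ) (d : Fin r → ℕ) (a : Matrix (Fin r) (Fin r) ℤ) {n m k : Fin r → ℕ}
    (σ : Vars n ⊕ Vars m ≃ Vars k) : RatFn k :=
  ∏ p : Vars n × Vars m with Before (σ (Sum.inr p.2)) (σ (Sum.inl p.1)),
    (qPair q d a p.2.1 p.1.1 • zv (σ (Sum.inr p.2)) - zv (σ (Sum.inl p.1))) /
      (zv (σ (Sum.inr p.2)) - qPair q d a p.2.1 p.1.1 • zv (σ (Sum.inl p.1)))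

/-- The shuffle product of `f` (in degree `n`) and `g` (in degree `m`), in degree `k = n + m`. -/
def shuffle (q : ℂ) (d : Fin r → ℕ) (a : Matrix (Fin r) (Fin r) ℤ) {n m : Fin r → ℕ}
    (k : Fin r → ℕ) (f : RatFn n) (g : RatFn m) : RatFn k :=
  ∑ σ ∈ shuffles n m k, shFactor q d a σ *
    subst (fun u => σ (Sum.inl u)) (σ.injective.comp Sum.inl_injective) f *
    subst (fun v => σ (Sum.inr v)) (σ.injective.comp Sum.inr_injective) g

/-- The shuffle product on families, `(F * G)_k = ∑_{n + m = k} F_n * G_m`. -/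
def shMul (q : ℂ) (d : Fin r → ℕ) (a : Matrix (Fin r) (Fin r) ℤ) :
    (∀ n : Fin r → ℕ, RatFn n) →ₗ[ℂ] (∀ n : Fin r → ℕ, RatFn n) →ₗ[ℂ] (∀ n : Fin r → ℕ, RatFn n) :=
  LinearMap.mk₂ ℂ (fun F G k => ∑ n ∈ Finset.Iic k, shuffle q d a k (F n) (G (k - n)))
    (fun F F' G => by
      funext k; simp [shuffle, mul_add, add_mul, Finset.sum_add_distrib])
    (fun c F G => by
      funext k
      simp only [shuffle, Pi.smul_apply, Finset.smul_sum]
      refine Finset.sum_congr rfl fun n _ => Finset.sum_congr rfl fun σ _ => ?_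
      rw [map_smul]; simp only [mul_smul_comm, smul_mul_assoc])
    (fun F G G' => by
      funext k; simp [shuffle, mul_add, Finset.sum_add_distrib])
    (fun c F G => by
      funext k
      simp only [shuffle, Pi.smul_apply, Finset.smul_sum]
      refine Finset.sum_congr rfl fun n _ => Finset.sum_congr rfl fun σ _ => ?_
      rw [map_smul]; simp only [mul_smul_comm])

/-- The unit: the constant `1` in degree `0`. -/
def shOne : ∀ n : Fin r → ℕ, RatFn n := Pi.single 0 1

/-- The element `(z^{(α)})^n` of degree `δ_α`. -/
def shGen (α : Fin r) (n : ℤ) : ∀ n : Fin r → ℕ, RatFn n :=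
  Pi.single (Pi.single α 1) (zv ⟨α, ⟨0, by simp⟩⟩ ^ n)

end DrinfeldShuffle

end

noncomputable section

open scoped Classical

namespace DrinfeldShuffle

variable {r : ℕ}

/-! ### Rational functions and substitutions -/

section RationalFunctions

variable {n m k : Fin r → ℕ}

/-! Everything becomes transparent once the fixed factor `canFactor` is divided out. For a variable
`u` of the first argument and `v` of the second, the shuffle factor combined with the fixed factors
leaves `weight`, which depends on the colors and on which argument owns each variable, but not on
their positions (`shFactor_mul_canFactor`). The shuffle product thus turns into an average `star`
over all color-preserving bijections (`sum_shuffles`, `shuffle_canFactor_mul`). Associativity then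
holds because both bracketings equal the same symmetrized triple product (`star_star_left`,
`star_star_right`). The product stays in `ShBar` because its only new poles are simple ones along
differences of same-colored variables, and a symmetric function cannot have such poles
(`mem_laurentAlg_of_isSym`).

A product of generators is a single symmetrized sum `wordSum` (`starMul_wordSum`, `val_prod_ofFn`).
The vertex relations are then an identity between `weight Q u v` and `weight Q v u`. In the Serre
relations the monomial factors out of each bijection, and what remains is a Hall-Littlewood
symmetrization identity (`sum_hlProd_serre`). It is proved by Pascal's rule and induction on the
length of a block: the symmetrizer lets a factor `X (l + 1)` be replaced by `θ * X l`, so the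
alternating sum collapses to a scalar product with a zero factor. No quantum integer is inverted, so
roots of unity are allowed.

For the image in `Sh`, let `b = q_α` and `N = -a_{αβ}`. At a point of the wheel condition every
ordering of the chosen variables contains a pair whose weight vanishes: either `β` precedes the
first `α`-variable, or the last `α`-variable precedes `β`, or some `α`-variable precedes the next
one in the chain (`laurentEval_wordSum_eq_zero`). The denominators of the weights may also vanish
when same-colored values coincide. So only a set `S` of variables with distinct same-colored values
is specialized at first. If `b ^ (2 * N) = 1`, two variables suffice for `S`; otherwise the whole
chain has distinct values, provided `N ≤ 2`. This is where type `G_2` is excluded. -/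

lemma algebraMap_ratFn_injective :
    Function.Injective (algebraMap (MvPolynomial (Vars n) ℂ) (RatFn n)) :=
  IsFractionRing.injective _ _

instance : CharZero (RatFn n) := 
  charZero_of_injective_algebraMap (algebraMap ℂ (RatFn n)).injective

lemma algebraMap_C_ratFn (c : ℂ) :
    algebraMap (MvPolynomial (Vars n) ℂ) (RatFn n) (MvPolynomial.C c) = algebraMap ℂ (RatFn n) c :=
  rfl

lemma zv_sub_smul (u v : Vars n) (c : ℂ) :
    zv u - c • zv v = algebraMap (MvPolynomial (Vars n) ℂ) (RatFn n)
      (MvPolynomial.X u - MvPolynomial.C c * MvPolynomial.X v) := by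
  rw [map_sub, map_mul, algebraMap_C_ratFn, Algebra.smul_def]; rfl

lemma zv_sub (u v : Vars n) :
    zv u - zv v = algebraMap (MvPolynomial (Vars n) ℂ) (RatFn n)
      (MvPolynomial.X u - MvPolynomial.X v) := by
  rw [map_sub]; rfl

lemma zv_ne_zero (v : Vars n) : (zv v : RatFn n) ≠ 0 := by
  rw [zv, Ne, FaithfulSMul.algebraMap_eq_zero_iff]
  exact MvPolynomial.X_ne_zero v

lemma zv_sub_smul_ne_zero {u v : Vars n} (h : u ≠ v) (c : ℂ) : zv u - c • zv v ≠ 0 := by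
  rw [zv_sub_smul, Ne, FaithfulSMul.algebraMap_eq_zero_iff]
  intro h0
  have := congrArg (MvPolynomial.eval (Pi.single u (1 : ℂ))) h0
  simp [h.symm] at this

lemma zv_sub_ne_zero {u v : Vars n} (h : u ≠ v) : zv u - zv v ≠ 0 := by
  simpa using zv_sub_smul_ne_zero h 1

lemma subst_algebraMap (φ : Vars n → Vars k) (hφ : Function.Injective φ)
    (p : MvPolynomial (Vars n) ℂ) :
    subst φ hφ (algebraMap _ _ p) = algebraMap _ (RatFn k) (MvPolynomial.rename φ p) := by
  have hg : Function.Injective ((IsScalarTower.toAlgHom ℂ (MvPolynomial (Vars k) ℂ) (RatFn k)).comp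
      (MvPolynomial.rename φ)) :=
    (IsFractionRing.injective (MvPolynomial (Vars k) ℂ) (RatFn k)).comp
      (MvPolynomial.rename_injective φ hφ)
  exact IsFractionRing.lift_algebraMap (K := RatFn n) (g := (((IsScalarTower.toAlgHom ℂ
    (MvPolynomial (Vars k) ℂ) (RatFn k)).comp (MvPolynomial.rename φ) : _ →ₐ[ℂ] RatFn k) :
    MvPolynomial (Vars n) ℂ →+* RatFn k)) hg p

@[simp] lemma subst_zv (φ : Vars n → Vars k) (hφ : Function.Injective φ) (v : Vars n) :
    subst φ hφ (zv v) = zv (φ v) := by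
  rw [zv, subst_algebraMap, MvPolynomial.rename_X]; rfl

@[simp] lemma subst_smul (φ : Vars n → Vars k) (hφ : Function.Injective φ) (c : ℂ) (f : RatFn n) :
    subst φ hφ (c • f) = c • subst φ hφ f :=
  (subst φ hφ).map_smul_of_tower c f

lemma ratFn_algHom_ext {K : Type*} [Field K] [Algebra ℂ K] {F G : RatFn n →ₐ[ℂ] K}
    (h : ∀ v, F (zv v) = G (zv v)) : F = G := by
  have h1 : F.comp (IsScalarTower.toAlgHom ℂ (MvPolynomial (Vars n) ℂ) (RatFn n)) =
      G.comp (IsScalarTower.toAlgHom ℂ (MvPolynomial (Vars n) ℂ) (RatFn n)) :=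
    MvPolynomial.algHom_ext fun v => h v
  ext f
  obtain ⟨p, s, -, rfl⟩ := IsFractionRing.div_surjective (A := MvPolynomial (Vars n) ℂ) f
  rw [map_div₀, map_div₀]
  exact congrArg₂ _ (DFunLike.congr_fun h1 p) (DFunLike.congr_fun h1 s)

lemma subst_subst (φ : Vars n → Vars m) (hφ : Function.Injective φ) (ψ : Vars m → Vars k)
    (hψ : Function.Injective ψ) (f : RatFn n) :
    subst ψ hψ (subst φ hφ f) = subst (ψ ∘ φ) (hψ.comp hφ) f :=
  DFunLike.congr_fun (ratFn_algHom_ext (F := (subst ψ hψ).comp (subst φ hφ)) fun v => by simp) f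

end RationalFunctions

/-! ### The order of the variables -/

section Order

variable {n m k : Fin r → ℕ}

lemma not_before_self (u : Vars n) : ¬ Before u u := by
  simp [Before]

lemma Before.ne {u v : Vars n} (h : Before u v) : u ≠ v := fun e => not_before_self v (e ▸ h)

lemma Before.trans {u v w : Vars n} (h : Before u v) (h' : Before v w) : Before u w := by
  unfold Before at *
  grind

lemma Before.asymm {u v : Vars n} (h : Before u v) : ¬ Before v u :=
  fun h' => not_before_self u (h.trans h')

lemma before_or_before {u v : Vars n} (h : u ≠ v) : Before u v ∨ Before v u := by
  obtain ⟨α, i⟩ := u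
  obtain ⟨β, j⟩ := v
  unfold Before
  rcases lt_trichotomy α β with h1 | h1 | h1
  · exact Or.inl (Or.inl h1)
  · subst h1
    rcases lt_trichotomy i j with h2 | h2 | h2
    · exact Or.inl (Or.inr ⟨rfl, h2⟩)
    · exact absurd (by rw [h2]) h
    · exact Or.inr (Or.inr ⟨rfl, h2⟩)
  · exact Or.inr (Or.inl h1)

lemma not_before_iff {u v : Vars n} (h : u ≠ v) : ¬ Before u v ↔ Before v u :=
  ⟨fun h' => (before_or_before h).resolve_left h', fun h' => h'.asymm⟩

/-- A color-preserving permutation of the variables that respects their order is the identity. -/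
lemma perm_eq_refl_of_before (s : Equiv.Perm (Vars n)) (hc : ∀ v, (s v).1 = v.1)
    (hs : ∀ u v, Before u v → Before (s u) (s v)) : s = Equiv.refl _ := by
  have key : ∀ α, ∀ i : Fin (n α), (s ⟨α, i⟩).2.val = i.val := by
    intro α
    have hex : ∀ i, ∃ j : Fin (n α), s ⟨α, i⟩ = ⟨α, j⟩ := fun i => by
      have : ∀ (w : Vars n), w.1 = α → ∃ j : Fin (n α), w = ⟨α, j⟩ := by
        rintro ⟨β, j⟩ rfl
        exact ⟨j, rfl⟩
      exact this _ (hc ⟨α, i⟩)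
    choose f hf using hex
    have hmono : StrictMono f := fun i j hij => by
      have := hs ⟨α, i⟩ ⟨α, j⟩ (Or.inr ⟨rfl, hij⟩)
      rw [hf, hf] at this
      simpa [Before] using this
    -- A strictly monotone map is determined by its range, and an injective self-map of a finite set
    -- is onto.
    have : f = id := by
      refine (StrictMono.range_inj hmono strictMono_id).1 ?_
      rw [Set.range_id, Set.range_eq_univ]
      exact Finite.surjective_of_injective hmono.injective
    intro i
    rw [hf, this]; rfl
  ext1 ⟨α, i⟩
  have h1 := hc ⟨α, i⟩
  have h2 := key α i
  generalize s ⟨α, i⟩ = w at h1 h2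
  obtain ⟨β, j⟩ := w
  obtain rfl : β = α := h1
  exact congrArg (Sigma.mk β) (Fin.ext h2)

/-- A color-preserving injection becomes increasing after a color-preserving permutation. -/
lemma exists_sorting (φ : Vars n → Vars k) (hφ : Function.Injective φ)
    (hc : ∀ v, (φ v).1 = v.1) :
    ∃ s : Equiv.Perm (Vars n), (∀ v, (s v).1 = v.1) ∧
      ∀ u v, Before u v → Before (φ (s u)) (φ (s v)) := by
  let f : ∀ α, Fin (n α) → ℕ := fun α i => (φ ⟨α, i⟩).2.val
  have hf : ∀ α, Function.Injective (f α) := fun α i j hij => by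
    have : φ ⟨α, i⟩ = φ ⟨α, j⟩ := by
      have h1 := hc ⟨α, i⟩
      have h2 := hc ⟨α, j⟩
      have h3 : (φ ⟨α, i⟩).2.val = (φ ⟨α, j⟩).2.val := hij
      generalize φ ⟨α, i⟩ = u at h1 h3
      generalize φ ⟨α, j⟩ = v at h2 h3
      obtain ⟨a, i'⟩ := u
      obtain ⟨b, j'⟩ := v
      obtain rfl : a = α := h1
      obtain rfl : b = a := h2
      exact congrArg (Sigma.mk b) (Fin.ext h3)
    simpa using hφ this
  refine ⟨Equiv.sigmaCongrRight fun α => Tuple.sort (f α), fun v => rfl, ?_⟩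
  rintro ⟨α, i⟩ ⟨β, j⟩ (h | ⟨h, h'⟩)
  · refine Or.inl ?_
    rw [hc, hc]
    exact h
  · obtain rfl : α = β := h
    refine Or.inr ⟨by rw [hc, hc]; rfl, ?_⟩
    have := ((Tuple.monotone_sort (f α)).strictMono_of_injective
      ((hf α).comp (Tuple.sort (f α)).injective)) h'
    exact this

end Order

/-! ### Color-preserving bijections -/

/-- Color-preserving bijections between two colored types. -/
abbrev ColorEquiv {X Y : Type*} (c : X → Fin r) (c' : Y → Fin r) : Type _ :=
  {σ : X ≃ Y // ∀ x, c' (σ x) = c x}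

instance {X Y : Type*} [Finite X] [Finite Y] (c : X → Fin r) (c' : Y → Fin r) :
    Fintype (ColorEquiv c c') := Fintype.ofFinite _

/-- The color of a variable. -/
abbrev color (n : Fin r → ℕ) : Vars n → Fin r := Sigma.fst

/-- The color of an element of the disjoint union of two sets of variables. -/
abbrev color₂ (n m : Fin r → ℕ) : Vars n ⊕ Vars m → Fin r := Sum.elim (color n) (color m)

namespace ColorEquiv

variable {X Y Z X' Y' : Type*} {c : X → Fin r} {c' : Y → Fin r} {c'' : Z → Fin r}
  {b : X' → Fin r} {b' : Y' → Fin r}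

/-- The identity. -/
def refl (c : X → Fin r) : ColorEquiv c c := ⟨Equiv.refl X, fun _ => rfl⟩

/-- The inverse bijection. -/
def symm (σ : ColorEquiv c c') : ColorEquiv c' c :=
  ⟨σ.1.symm, fun y => by rw [← σ.2, Equiv.apply_symm_apply]⟩

/-- Composition of bijections. -/
def trans (σ : ColorEquiv c c') (τ : ColorEquiv c' c'') : ColorEquiv c c'' :=
  ⟨σ.1.trans τ.1, fun x => by rw [Equiv.trans_apply, τ.2, σ.2]⟩

/-- Disjoint union of bijections. -/
def sumCongr (σ : ColorEquiv c c') (τ : ColorEquiv b b') :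
    ColorEquiv (Sum.elim c b) (Sum.elim c' b') :=
  ⟨Equiv.sumCongr σ.1 τ.1, by
    rintro (x | x)
    · exact σ.2 x
    · exact τ.2 x⟩

@[simp] lemma coe_refl : (refl c).1 = Equiv.refl X := rfl

@[simp] lemma coe_symm (σ : ColorEquiv c c') : σ.symm.1 = σ.1.symm := rfl

@[simp] lemma coe_trans (σ : ColorEquiv c c') (τ : ColorEquiv c' c'') :
    (σ.trans τ).1 = σ.1.trans τ.1 := rfl

@[simp] lemma coe_sumCongr (σ : ColorEquiv c c') (τ : ColorEquiv b b') :
    (σ.sumCongr τ).1 = Equiv.sumCongr σ.1 τ.1 := rfl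

/-- Composition with a fixed bijection is a bijection. -/
def compEquiv (τ : ColorEquiv c c') (c'' : Z → Fin r) : ColorEquiv c' c'' ≃ ColorEquiv c c'' where
  toFun σ := τ.trans σ
  invFun ρ := τ.symm.trans ρ
  left_inv σ := Subtype.ext (Equiv.ext fun x => by simp)
  right_inv σ := Subtype.ext (Equiv.ext fun x => by simp)

lemma sum_trans [Finite X] [Finite Y] [Finite Z] {M : Type*} [AddCommMonoid M]
    (τ : ColorEquiv c c') (G : ColorEquiv c c'' → M) :
    ∑ σ : ColorEquiv c' c'', G (τ.trans σ) = ∑ ρ : ColorEquiv c c'', G ρ :=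
  Fintype.sum_equiv (τ.compEquiv c'') _ _ fun _ => rfl

lemma card_eq [Finite X] [Finite Y] [Finite Z] (τ : ColorEquiv c c') (c'' : Z → Fin r) :
    Fintype.card (ColorEquiv c' c'') = Fintype.card (ColorEquiv c c'') :=
  Fintype.card_congr (τ.compEquiv c'')

/-- Post-composition with a fixed bijection is a bijection. -/
def postEquiv (c : X → Fin r) (τ : ColorEquiv c' c'') : ColorEquiv c c' ≃ ColorEquiv c c'' where
  toFun σ := σ.trans τ
  invFun ρ := ρ.trans τ.symm
  left_inv σ := Subtype.ext (Equiv.ext fun x => by simp)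
  right_inv σ := Subtype.ext (Equiv.ext fun x => by simp)

/-- The variables of degree `n + m` are those of degree `n` and those of degree `m`. -/
def addEquiv (n m : Fin r → ℕ) : ColorEquiv (color₂ n m) (color (n + m)) :=
  ⟨(Equiv.sigmaSumDistrib (fun α => Fin (n α)) fun α => Fin (m α)).symm.trans
    (Equiv.sigmaCongrRight fun α => (finSumFinEquiv : Fin (n α) ⊕ Fin (m α) ≃ Fin (n α + m α))), by
      rintro (x | x) <;> rfl⟩

end ColorEquiv

open ColorEquiv

/-- The number of color-preserving permutations of the variables of degree `n`, in `ℂ`. -/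
def autCard (n : Fin r → ℕ) : ℂ := Fintype.card (ColorEquiv (color n) (color n))

lemma autCard_ne_zero (n : Fin r → ℕ) : autCard n ≠ 0 := by
  have : Nonempty (ColorEquiv (color n) (color n)) := ⟨ColorEquiv.refl _⟩
  exact Nat.cast_ne_zero.2 Fintype.card_ne_zero

lemma card_colorEquiv {X : Type*} [Finite X] {c : X → Fin r} {n : Fin r → ℕ}
    (τ : ColorEquiv c (color n)) : (Fintype.card (ColorEquiv c (color n)) : ℂ) = autCard n :=
  congrArg Nat.cast (τ.card_eq (color n)).symm

/-! ### Weights -/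

section Weights

variable {n m k : Fin r → ℕ} (Q : Fin r → Fin r → ℂ)

/-- The factor that the shuffle product attaches to a variable `u` of the first factor and a
variable `v` of the second one, once the fixed factors are removed. -/
def weight (u v : Vars k) : RatFn k :=
  if u.1 = v.1 then (zv u - Q u.1 v.1 • zv v) / (zv u - zv v)
  else if u.1 < v.1 then zv u - Q u.1 v.1 • zv v
  else Q u.1 v.1 • zv v - zv u

/-- The contribution of a pair of variables to the fixed factor. -/
def pairFactor (u v : Vars k) : RatFn k :=
  (if u.1 = v.1 then zv u - zv v else 1) / (zv u - Q u.1 v.1 • zv v)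

lemma pairFactor_ne_zero {u v : Vars k} (h : u ≠ v) : pairFactor Q u v ≠ 0 := by
  unfold pairFactor
  refine div_ne_zero ?_ (zv_sub_smul_ne_zero h _)
  split_ifs
  · exact zv_sub_ne_zero h
  · exact one_ne_zero

lemma subst_weight (φ : Vars n → Vars k) (hφ : Function.Injective φ)
    (hc : ∀ v, (φ v).1 = v.1) (u v : Vars n) :
    subst φ hφ (weight Q u v) = weight Q (φ u) (φ v) := by
  unfold weight
  simp only [hc]
  split_ifs <;> simp

lemma subst_pairFactor (φ : Vars n → Vars k) (hφ : Function.Injective φ)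
    (hc : ∀ v, (φ v).1 = v.1) (u v : Vars n) :
    subst φ hφ (pairFactor Q u v) = pairFactor Q (φ u) (φ v) := by
  unfold pairFactor
  simp only [hc]
  split_ifs <;> simp

lemma canFactor_eq (q : ℂ) (d : Fin r → ℕ) (a : Matrix (Fin r) (Fin r) ℤ) (n : Fin r → ℕ) :
    canFactor q d a n =
      ∏ p : Vars n × Vars n with Before p.1 p.2, pairFactor (qPair q d a) p.1 p.2 := by
  unfold canFactor pairFactor
  rw [Finset.prod_div_distrib, ← Finset.prod_filter, Finset.filter_filter]

lemma canFactor_ne_zero (q : ℂ) (d : Fin r → ℕ) (a : Matrix (Fin r) (Fin r) ℤ) (n : Fin r → ℕ) :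
    canFactor q d a n ≠ 0 := by
  rw [canFactor_eq]
  exact Finset.prod_ne_zero_iff.2 fun p hp => pairFactor_ne_zero _ (Finset.mem_filter.1 hp).2.ne

/-- A product over the pairs of variables, split along a shuffle. -/
lemma prod_before_of_shuffle {M : Type*} [CommMonoid M] {σ : Vars n ⊕ Vars m ≃ Vars k}
    (hσ : σ ∈ shuffles n m k) (F : Vars k → Vars k → M) :
    ∏ p : Vars k × Vars k with Before p.1 p.2, F p.1 p.2 =
      (∏ p : Vars n × Vars n with Before p.1 p.2, F (σ (Sum.inl p.1)) (σ (Sum.inl p.2))) *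
      (∏ p : Vars m × Vars m with Before p.1 p.2, F (σ (Sum.inr p.1)) (σ (Sum.inr p.2))) *
      ∏ p : Vars n × Vars m, if Before (σ (Sum.inr p.2)) (σ (Sum.inl p.1)) then
        F (σ (Sum.inr p.2)) (σ (Sum.inl p.1)) else F (σ (Sum.inl p.1)) (σ (Sum.inr p.2)) := by
  obtain ⟨-, -, h3, h4⟩ : (∀ u, (σ (Sum.inl u)).1 = u.1) ∧ (∀ v, (σ (Sum.inr v)).1 = v.1) ∧
    (∀ u u', Before u u' → Before (σ (Sum.inl u)) (σ (Sum.inl u'))) ∧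
    (∀ v v', Before v v' → Before (σ (Sum.inr v)) (σ (Sum.inr v'))) := by
    simpa [shuffles] using hσ
  have h3' : ∀ u u', Before (σ (Sum.inl u)) (σ (Sum.inl u')) ↔ Before u u' := fun u u' =>
    ⟨fun h => by
      have hne : u ≠ u' := fun e => not_before_self _ (e ▸ h)
      exact (before_or_before hne).resolve_right fun h' => h.asymm (h3 _ _ h'), h3 u u'⟩
  have h4' : ∀ u u', Before (σ (Sum.inr u)) (σ (Sum.inr u')) ↔ Before u u' := fun u u' =>
    ⟨fun h => by
      have hne : u ≠ u' := fun e => not_before_self _ (e ▸ h)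
      exact (before_or_before hne).resolve_right fun h' => h.asymm (h4 _ _ h'), h4 u u'⟩
  -- Exactly one of the two orders holds for a mixed pair, so the alternative becomes a product of
  -- two conditional factors, matching the two mixed blocks of the double product over `Vars k`.
  have h5 : ∀ (p : Vars n × Vars m), (if Before (σ (Sum.inr p.2)) (σ (Sum.inl p.1)) then
        F (σ (Sum.inr p.2)) (σ (Sum.inl p.1)) else F (σ (Sum.inl p.1)) (σ (Sum.inr p.2))) =
      (if Before (σ (Sum.inl p.1)) (σ (Sum.inr p.2)) then
        F (σ (Sum.inl p.1)) (σ (Sum.inr p.2)) else 1) *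
      (if Before (σ (Sum.inr p.2)) (σ (Sum.inl p.1)) then
        F (σ (Sum.inr p.2)) (σ (Sum.inl p.1)) else 1) := fun p => by
    have hne : σ (Sum.inr p.2) ≠ σ (Sum.inl p.1) := fun e => by simpa using σ.injective e
    rcases before_or_before hne with h | h
    · simp [h, h.asymm]
    · simp [h, h.asymm]
  rw [Finset.prod_congr rfl fun p _ => h5 p]
  simp only [Finset.prod_filter, Fintype.prod_prod_type, ← Equiv.prod_comp σ,
    Fintype.prod_sum_type, h3', h4', Finset.prod_mul_distrib]
  rw [Finset.prod_comm (s := (Finset.univ : Finset (Vars m))) (t := (Finset.univ : Finset (Vars n)))]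
  ac_rfl

/-- Pairs inside one argument contribute the same factor on both sides. For a mixed pair of equal
color, reversing the order changes the sign of both numerator and denominator of the weight, so the
inverted and non-inverted cases agree; for different colors the order of the variables is the order
of the colors. -/
lemma shFactor_mul_canFactor {q : ℂ} {d : Fin r → ℕ} {a : Matrix (Fin r) (Fin r) ℤ}
    (hQ : ∀ α β, qPair q d a α β = qPair q d a β α) {σ : Vars n ⊕ Vars m ≃ Vars k}
    (hσ : σ ∈ shuffles n m k) (hl : Function.Injective fun u => σ (Sum.inl u))
    (hr : Function.Injective fun u => σ (Sum.inr u)) :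
    shFactor q d a σ * subst (fun u => σ (Sum.inl u)) hl (canFactor q d a n) *
        subst (fun u => σ (Sum.inr u)) hr (canFactor q d a m) =
      canFactor q d a k *
        ∏ p : Vars n × Vars m, weight (qPair q d a) (σ (Sum.inl p.1)) (σ (Sum.inr p.2)) := by
  obtain ⟨h1, h2, -, -⟩ : (∀ u, (σ (Sum.inl u)).1 = u.1) ∧ (∀ v, (σ (Sum.inr v)).1 = v.1) ∧
    (∀ u u', Before u u' → Before (σ (Sum.inl u)) (σ (Sum.inl u'))) ∧
    (∀ v v', Before v v' → Before (σ (Sum.inr v)) (σ (Sum.inr v'))) := by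
    simpa [shuffles] using hσ
  rw [canFactor_eq q d a k, prod_before_of_shuffle hσ, canFactor_eq, canFactor_eq, map_prod,
    map_prod]
  simp only [subst_pairFactor _ _ hl h1, subst_pairFactor _ _ hr h2]
  rw [mul_assoc (shFactor q d a σ), mul_comm (shFactor q d a σ), mul_assoc _ (∏ p, ite _ _ _),
    ← Finset.prod_mul_distrib]
  congr 1
  rw [shFactor, Finset.prod_filter]
  refine Finset.prod_congr rfl fun p _ => ?_
  rw [← h1 p.1, ← h2 p.2]
  have hne : σ (Sum.inr p.2) ≠ σ (Sum.inl p.1) := fun e => by simpa using σ.injective e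
  generalize σ (Sum.inr p.2) = v at hne ⊢
  generalize σ (Sum.inl p.1) = u at hne ⊢
  have e1 := zv_sub_ne_zero hne
  have e2 := zv_sub_ne_zero hne.symm
  have e3 := zv_sub_smul_ne_zero hne (qPair q d a v.1 u.1)
  have e4 := zv_sub_smul_ne_zero hne.symm (qPair q d a u.1 v.1)
  unfold pairFactor weight
  by_cases hb : Before v u
  · simp only [hb, if_true, hQ u.1 v.1]
    by_cases hc : v.1 = u.1
    · simp only [hc, if_true]
      rw [hc] at e3
      field_simp
      ring
    · have : ¬ u.1 < v.1 := by
        rcases hb with hb | hb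
        · exact hb.not_gt
        · exact absurd hb.1 hc
      simp only [hc, Ne.symm hc, if_false, this]
      field_simp
  · simp only [hb, if_false]
    have hb' := (not_before_iff hne).1 hb
    by_cases hc : v.1 = u.1
    · simp only [hc, if_true]
      rw [hc] at e4
      field_simp
    · have : u.1 < v.1 := by
        rcases hb' with hb | hb
        · exact hb
        · exact absurd hb.1.symm hc
      simp only [Ne.symm hc, if_false, this, if_true]
      field_simp

end Weights

/-! ### The symmetrized product -/

section Star

variable {n m k : Fin r → ℕ} (Q : Fin r → Fin r → ℂ)

/-- Substitution of variables along a bijection. -/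
abbrev permute (τ : ColorEquiv (color n) (color n)) : RatFn n →ₐ[ℂ] RatFn n :=
  subst τ.1 τ.1.injective

/-- The rational functions that are symmetric in each group of variables. -/
def IsSym (f : RatFn n) : Prop := ∀ τ : ColorEquiv (color n) (color n), permute τ f = f

/-- The substitution of the variables of the first factor. -/
abbrev substL {X : Type*} {c : X → Fin r} (σ : ColorEquiv (Sum.elim (color n) c) (color k)) :
    RatFn n →ₐ[ℂ] RatFn k :=
  subst (fun u => σ.1 (Sum.inl u)) (σ.1.injective.comp Sum.inl_injective)

/-- The substitution of the variables of the second factor. -/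
abbrev substR {X : Type*} {c : X → Fin r} (σ : ColorEquiv (Sum.elim c (color m)) (color k)) :
    RatFn m →ₐ[ℂ] RatFn k :=
  subst (fun u => σ.1 (Sum.inr u)) (σ.1.injective.comp Sum.inr_injective)

/-- The summand of the symmetrized product. -/
def starTerm (f : RatFn n) (g : RatFn m) (σ : ColorEquiv (color₂ n m) (color k)) : RatFn k :=
  (∏ p : Vars n × Vars m, weight Q (σ.1 (Sum.inl p.1)) (σ.1 (Sum.inr p.2))) *
    substL σ f * substR σ g

/-- The shuffle product with the fixed factors removed, written as a sum over all color-preserving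
bijections. -/
def star (k : Fin r → ℕ) (f : RatFn n) (g : RatFn m) : RatFn k :=
  (autCard n * autCard m)⁻¹ • ∑ σ : ColorEquiv (color₂ n m) (color k), starTerm Q f g σ

variable {Q}

/-- The weights run over all mixed pairs, and symmetric arguments absorb a permutation of their own
variables. -/
lemma starTerm_sumCongr {f : RatFn n} {g : RatFn m} (hf : IsSym f) (hg : IsSym g)
    (σ : ColorEquiv (color₂ n m) (color k)) (τ : ColorEquiv (color n) (color n))
    (τ' : ColorEquiv (color m) (color m)) :
    starTerm Q f g ((τ.sumCongr τ').trans σ) = starTerm Q f g σ := by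
  have h1 : substL ((τ.sumCongr τ').trans σ) f = substL σ f := by
    conv_rhs => rw [← hf τ]
    rw [subst_subst]
    rfl
  have h2 : substR ((τ.sumCongr τ').trans σ) g = substR σ g := by
    conv_rhs => rw [← hg τ']
    rw [subst_subst]
    rfl
  unfold starTerm
  rw [h1, h2]
  congr 2
  exact Fintype.prod_equiv (Equiv.prodCongr τ.1 τ'.1) _ _ fun p => rfl

/-! ### From shuffles to all color-preserving bijections. -/

/-- The composition of shuffles with permutations. -/
def shuffleComp (n m k : Fin r → ℕ) :
    {σ // σ ∈ shuffles n m k} × ColorEquiv (color n) (color n) × ColorEquiv (color m) (color m) →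
      ColorEquiv (color₂ n m) (color k) :=
  fun x => (x.2.1.sumCongr x.2.2).trans ⟨x.1.1, by
    have := x.1.2
    simp only [shuffles, Finset.mem_filter] at this
    rintro (u | u)
    · exact this.2.1 u
    · exact this.2.2.1 u⟩

lemma mem_shuffles {σ : Vars n ⊕ Vars m ≃ Vars k} : σ ∈ shuffles n m k ↔
    (∀ u, (σ (Sum.inl u)).1 = u.1) ∧ (∀ v, (σ (Sum.inr v)).1 = v.1) ∧
    (∀ u u', Before u u' → Before (σ (Sum.inl u)) (σ (Sum.inl u'))) ∧
    (∀ v v', Before v v' → Before (σ (Sum.inr v)) (σ (Sum.inr v'))) := by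
  simp [shuffles]

/-- If `s` reversed some pair, `ψ` would be increasing on the reversed pair and `φ` on the original
one, a contradiction; so `s` respects the order and must be trivial. -/
lemma eq_of_increasing {φ ψ : Vars n → Vars k} (s : ColorEquiv (color n) (color n))
    (h : ∀ u, φ u = ψ (s.1 u)) (hφ : ∀ u v, Before u v → Before (φ u) (φ v))
    (hψ : ∀ u v, Before u v → Before (ψ u) (ψ v)) : s.1 = Equiv.refl _ := by
  refine perm_eq_refl_of_before s.1 s.2 fun u v huv => ?_
  have h1 := hφ u v huv
  rw [h, h] at h1
  have hne : s.1 u ≠ s.1 v := fun e => huv.ne (s.1.injective e)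
  exact (before_or_before hne).resolve_right fun h' => h1.asymm (hψ _ _ h')

/-- Shuffles are the coset representatives obtained by sorting: sorting the images of each argument
gives existence, and the rigidity of increasing maps gives uniqueness. -/
lemma shuffleComp_bijective (n m k : Fin r → ℕ) : Function.Bijective (shuffleComp n m k) := by
  constructor
  · rintro ⟨⟨σ, hσ⟩, τ, τ'⟩ ⟨⟨σ₂, hσ₂⟩, τ₂, τ₂'⟩ h
    have hl : ∀ u, σ (Sum.inl (τ.1 u)) = σ₂ (Sum.inl (τ₂.1 u)) := fun u =>
      congrArg (fun ρ => ρ.1 (Sum.inl u)) h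
    have hr : ∀ u, σ (Sum.inr (τ'.1 u)) = σ₂ (Sum.inr (τ₂'.1 u)) := fun u =>
      congrArg (fun ρ => ρ.1 (Sum.inr u)) h
    rw [mem_shuffles] at hσ hσ₂
    have el := eq_of_increasing (φ := fun u => σ (Sum.inl u)) (ψ := fun u => σ₂ (Sum.inl u))
      (τ.symm.trans τ₂) (fun u => by simpa using hl (τ.1.symm u))
      hσ.2.2.1 hσ₂.2.2.1
    have er := eq_of_increasing (φ := fun u => σ (Sum.inr u)) (ψ := fun u => σ₂ (Sum.inr u))
      (τ'.symm.trans τ₂') (fun u => by simpa using hr (τ'.1.symm u))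
      hσ.2.2.2 hσ₂.2.2.2
    have e1 : τ = τ₂ := Subtype.ext (Equiv.ext fun u => by
      simpa using (DFunLike.congr_fun el (τ.1 u)).symm)
    have e2 : τ' = τ₂' := Subtype.ext (Equiv.ext fun u => by
      simpa using (DFunLike.congr_fun er (τ'.1 u)).symm)
    subst e1 e2
    have e3 : σ = σ₂ := Equiv.ext fun x => by
      rcases x with u | u
      · simpa using hl (τ.1.symm u)
      · simpa using hr (τ'.1.symm u)
    subst e3
    rfl
  · intro ρ
    obtain ⟨s, hs, hs'⟩ := exists_sorting (fun u => ρ.1 (Sum.inl u))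
      (ρ.1.injective.comp Sum.inl_injective) fun u => ρ.2 (Sum.inl u)
    obtain ⟨t, ht, ht'⟩ := exists_sorting (fun u => ρ.1 (Sum.inr u))
      (ρ.1.injective.comp Sum.inr_injective) fun u => ρ.2 (Sum.inr u)
    let S : ColorEquiv (color n) (color n) := ⟨s, hs⟩
    let T : ColorEquiv (color m) (color m) := ⟨t, ht⟩
    refine ⟨⟨⟨((S.sumCongr T).trans ρ).1, mem_shuffles.2
      ⟨fun u => ((S.sumCongr T).trans ρ).2 (Sum.inl u),
        fun u => ((S.sumCongr T).trans ρ).2 (Sum.inr u), hs', ht'⟩⟩, S.symm, T.symm⟩, ?_⟩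
    refine Subtype.ext (Equiv.ext fun x => ?_)
    rcases x with u | u
    · simp [shuffleComp, S]
    · simp [shuffleComp, T]

/-- The sum over shuffles, as a sum over all color-preserving bijections. -/
lemma sum_shuffles {M : Type*} [AddCommGroup M] [Module ℂ M]
    (G : ColorEquiv (color₂ n m) (color k) → M)
    (hG : ∀ σ τ τ', G ((ColorEquiv.sumCongr τ τ').trans σ) = G σ) (G' : (Vars n ⊕ Vars m ≃ Vars k) → M)
    (hG' : ∀ σ, σ.1 ∈ shuffles n m k → G' σ.1 = G σ) :
    ∑ σ ∈ shuffles n m k, G' σ = (autCard n * autCard m)⁻¹ • ∑ σ, G σ := by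
  rw [← (Equiv.ofBijective _ (shuffleComp_bijective n m k)).sum_comp, Fintype.sum_prod_type]
  have h1 : ∀ x y, G (Equiv.ofBijective _ (shuffleComp_bijective n m k) (x, y)) = G' x.1 :=
    fun x y => by
      rw [Equiv.ofBijective_apply, shuffleComp, hG]
      exact (hG' ⟨x.1, _⟩ x.2).symm
  simp only [h1, Finset.sum_const, Finset.card_univ, Fintype.card_prod, ← Finset.smul_sum]
  rw [← Nat.cast_smul_eq_nsmul ℂ, Nat.cast_mul, smul_smul, ← autCard, ← autCard, inv_mul_cancel₀, one_smul,
    Finset.sum_coe_sort (shuffles n m k) G']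
  exact mul_ne_zero (autCard_ne_zero n) (autCard_ne_zero m)

/-- The bridge of the whole proof: conjugating by the fixed factors turns the shuffle product into
the order-free product `star`. -/
lemma shuffle_canFactor_mul {q : ℂ} {d : Fin r → ℕ} {a : Matrix (Fin r) (Fin r) ℤ}
    (hQ : ∀ α β, qPair q d a α β = qPair q d a β α) {f : RatFn n} {g : RatFn m}
    (hf : IsSym f) (hg : IsSym g) :
    shuffle q d a k (canFactor q d a n * f) (canFactor q d a m * g) =
      canFactor q d a k * star (qPair q d a) k f g := by
  unfold shuffle star
  rw [mul_smul_comm, Finset.mul_sum]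
  refine sum_shuffles _ (fun σ τ τ' => by rw [starTerm_sumCongr hf hg]) _ fun σ hσ => ?_
  rw [map_mul, map_mul]
  have := shFactor_mul_canFactor hQ hσ (σ.1.injective.comp Sum.inl_injective)
    (σ.1.injective.comp Sum.inr_injective)
  unfold starTerm
  linear_combination this * substL σ f * substR σ g

end Star

open ColorEquiv

/-! ### Laurent polynomials as rational functions -/

section LaurentPolynomials

variable {n m k : Fin r → ℕ}

@[simp] lemma laurentEval_single {K : Type} [Field K] [Algebra ℂ K] (z : Vars n → K)
    (e : Vars n → ℤ) (c : ℂ) :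
    laurentEval z (Finsupp.single e c) = c • ∏ v, z v ^ e v :=
  Finsupp.linearCombination_single ℂ c e

/-- The subalgebra of Laurent polynomials. -/
def laurentAlg (n : Fin r → ℕ) : Subalgebra ℂ (RatFn n) :=
  (Submodule.span ℂ (Set.range fun e : Vars n → ℤ => ∏ v, (zv v : RatFn n) ^ e v)).toSubalgebra
    (Submodule.subset_span ⟨0, by simp⟩)
    (fun x y hx hy => by
      have := Submodule.mul_mem_mul hx hy
      rw [Submodule.span_mul_span] at this
      refine Submodule.span_mono ?_ this
      rintro _ ⟨_, ⟨e, rfl⟩, _, ⟨e', rfl⟩, rfl⟩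
      exact ⟨e + e', by
        simp only [Pi.add_apply, zpow_add₀ (zv_ne_zero _), Finset.prod_mul_distrib]⟩)

lemma mem_laurentAlg {f : RatFn n} : f ∈ laurentAlg n ↔ ∃ A : Laurent n, laurentEval zv A = f := by
  have : f ∈ laurentAlg n ↔ f ∈ LinearMap.range (laurentEval (zv : Vars n → RatFn n)) := by
    rw [laurentEval, Finsupp.range_linearCombination]
    rfl
  rw [this]
  rfl

lemma monomial_mem_laurentAlg (e : Vars n → ℤ) :
    ∏ v, (zv v : RatFn n) ^ e v ∈ laurentAlg n :=
  mem_laurentAlg.2 ⟨Finsupp.single e 1, by simp⟩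

lemma zv_zpow_mem_laurentAlg (v : Vars n) (e : ℤ) : (zv v : RatFn n) ^ e ∈ laurentAlg n := by
  convert monomial_mem_laurentAlg (Pi.single v e)
  rw [Fintype.prod_eq_single v]
  · simp
  · intro w hw
    simp [hw]

lemma zv_mem_laurentAlg (v : Vars n) : (zv v : RatFn n) ∈ laurentAlg n := by
  simpa using zv_zpow_mem_laurentAlg v 1

lemma algebraMap_mem_laurentAlg (p : MvPolynomial (Vars n) ℂ) :
    algebraMap _ (RatFn n) p ∈ laurentAlg n := by
  induction p using MvPolynomial.induction_on with
  | C c => exact (laurentAlg n).algebraMap_mem c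
  | add p p' h h' => rw [map_add]; exact add_mem h h'
  | mul_X p v h => rw [map_mul]; exact mul_mem h (zv_mem_laurentAlg v)

lemma map_laurentEval {K L : Type} [Field K] [Algebra ℂ K] [Field L] [Algebra ℂ L] (F : K →ₐ[ℂ] L)
    (z : Vars n → K) (A : Laurent n) : F (laurentEval z A) = laurentEval (fun v => F (z v)) A := by
  induction A using Finsupp.induction_linear with
  | zero => simp
  | add A B hA hB => simp [hA, hB]
  | single e c => simp

lemma subst_mem_laurentAlg (φ : Vars n → Vars k) (hφ : Function.Injective φ) {f : RatFn n}
    (hf : f ∈ laurentAlg n) : subst φ hφ f ∈ laurentAlg k := by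
  obtain ⟨A, rfl⟩ := mem_laurentAlg.1 hf
  rw [map_laurentEval]
  induction A using Finsupp.induction_linear with
  | zero => simp
  | add A B hA hB =>
    rw [map_add]
    exact add_mem (hA (mem_laurentAlg.2 ⟨A, rfl⟩)) (hB (mem_laurentAlg.2 ⟨B, rfl⟩))
  | single e c =>
    rw [laurentEval_single]
    refine Subalgebra.smul_mem _ (Subalgebra.prod_mem _ fun v _ => ?_) _
    rw [subst_zv]
    exact zv_zpow_mem_laurentAlg _ _

/-- A Laurent polynomial becomes a polynomial after multiplication by a monomial. -/
lemma exists_clear_denominators (A : Laurent n) :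
    ∃ (M : ℕ) (p : MvPolynomial (Vars n) ℂ), ∀ (K : Type) [Field K] [Algebra ℂ K] (z : Vars n → K),
      (∀ v, z v ≠ 0) → MvPolynomial.aeval z p = (∏ v, z v) ^ M * laurentEval z A := by
  induction A using Finsupp.induction_linear with
  | zero => exact ⟨0, 0, fun K _ _ z hz => by simp⟩
  | add A B hA hB =>
    obtain ⟨M, p, hp⟩ := hA
    obtain ⟨M', p', hp'⟩ := hB
    refine ⟨M + M', (∏ v, MvPolynomial.X v) ^ M' * p + (∏ v, MvPolynomial.X v) ^ M * p',
      fun K _ _ z hz => ?_⟩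
    simp only [map_add, map_mul, map_pow, map_prod, MvPolynomial.aeval_X, hp K z hz, hp' K z hz]
    ring
  | single e c =>
    -- The sum of the absolute values of the exponents bounds each of them, so every shifted
    -- exponent is nonnegative and `toNat` loses nothing.
    refine ⟨∑ v, (e v).natAbs, MvPolynomial.C c *
      ∏ v, MvPolynomial.X v ^ ((∑ w, (e w).natAbs : ℕ) + e v).toNat, fun K _ _ z hz => ?_⟩
    simp only [map_mul, MvPolynomial.aeval_C, map_prod, map_pow, MvPolynomial.aeval_X,
      laurentEval_single, Algebra.smul_def]
    rw [mul_left_comm, ← Finset.prod_pow, ← Finset.prod_mul_distrib]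
    congr 1
    refine Finset.prod_congr rfl fun v _ => ?_
    have h1 : (e v).natAbs ≤ ∑ w, (e w).natAbs :=
      Finset.single_le_sum (f := fun w => (e w).natAbs) (fun _ _ => Nat.zero_le _)
        (Finset.mem_univ v)
    rw [← zpow_natCast, Int.toNat_of_nonneg (by omega), zpow_add₀ (hz v), zpow_natCast]

lemma aeval_zv (p : MvPolynomial (Vars n) ℂ) :
    MvPolynomial.aeval (zv : Vars n → RatFn n) p = algebraMap _ _ p := by
  have : MvPolynomial.aeval (zv : Vars n → RatFn n) =
      IsScalarTower.toAlgHom ℂ (MvPolynomial (Vars n) ℂ) (RatFn n) :=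
    MvPolynomial.algHom_ext fun v => by rw [MvPolynomial.aeval_X]; rfl
  exact DFunLike.congr_fun this p

/-- The action of permutations of the variables on Laurent polynomials. -/
def laurentPermute (τ : ColorEquiv (color n) (color n)) (A : Laurent n) : Laurent n :=
  Finsupp.equivMapDomain (Equiv.arrowCongr τ.1 (Equiv.refl ℤ)) A

lemma laurentEval_laurentPermute (τ : ColorEquiv (color n) (color n)) (A : Laurent n) :
    laurentEval zv (laurentPermute τ A) = permute τ (laurentEval zv A) := by
  rw [map_laurentEval]
  unfold laurentPermute laurentEval
  rw [Finsupp.linearCombination_equivMapDomain]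
  congr 2
  funext e
  simp only [Function.comp_apply, subst_zv]
  rw [← Equiv.prod_comp τ.1]
  simp

lemma isSym_laurentEval {A : Laurent n} (hA : A ∈ symLaurent n) :
    IsSym (laurentEval zv A) := fun τ => by
  rw [← laurentEval_laurentPermute]
  congr 1
  ext e
  exact hA τ.1 τ.2 e

/-- Any representative can be averaged over the color-preserving permutations without changing its
value, so injectivity of the evaluation is not needed. -/
lemma exists_symLaurent {f : RatFn n} (hf : f ∈ laurentAlg n) (hs : IsSym f) :
    ∃ A ∈ symLaurent n, laurentEval zv A = f := by
  obtain ⟨A, rfl⟩ := mem_laurentAlg.1 hf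
  refine ⟨(autCard n)⁻¹ • ∑ τ, laurentPermute τ A, ?_, ?_⟩
  · refine Submodule.smul_mem _ _ ?_
    intro ρ hρ e
    rw [Finsupp.finsetSum_apply, Finsupp.finsetSum_apply]
    exact Fintype.sum_equiv (postEquiv (color n) ⟨ρ, hρ⟩) _ _ fun τ => rfl
  · rw [map_smul, map_sum, Finset.sum_congr rfl fun τ _ => (laurentEval_laurentPermute τ A).trans (hs τ),
      Finset.sum_const, Finset.card_univ, ← Nat.cast_smul_eq_nsmul ℂ, smul_smul, ← autCard,
      inv_mul_cancel₀ (autCard_ne_zero n), one_smul]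

lemma mem_shBarDeg {q : ℂ} {d : Fin r → ℕ} {a : Matrix (Fin r) (Fin r) ℤ} {f : RatFn n} :
    f ∈ shBarDeg q d a n ↔ ∃ g ∈ laurentAlg n, IsSym g ∧ canFactor q d a n * g = f := by
  constructor
  · rintro ⟨A, hA, rfl⟩
    exact ⟨_, mem_laurentAlg.2 ⟨A, rfl⟩, isSym_laurentEval hA, rfl⟩
  · rintro ⟨g, hg, hs, rfl⟩
    obtain ⟨A, hA, rfl⟩ := exists_symLaurent hg hs
    exact ⟨A, hA, rfl⟩

end LaurentPolynomials

/-! ### Divisibility by Vandermonde products -/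

section Vandermonde

open MvPolynomial

variable {σ : Type*}

/-- A polynomial differs from its restriction to the diagonal `X v = X u` by a multiple of `X u - X
v`. -/
lemma X_sub_X_dvd_iff [DecidableEq σ] {u v : σ} (p : MvPolynomial σ ℂ) :
    (X u - X v : MvPolynomial σ ℂ) ∣ p ↔ rename (Function.update id v u) p = 0 := by
  constructor
  · rintro ⟨p, rfl⟩
    have : Function.update id v u u = u := by
      by_cases h : u = v
      · simp [h]
      · simp [h]
    simp [this]
  · have h : (X u - X v : MvPolynomial σ ℂ) ∣ p - rename (Function.update id v u) p := by
      induction p using MvPolynomial.induction_on with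
      | C c => simp
      | add p p' h h' =>
        rw [map_add, add_sub_add_comm]
        exact dvd_add h h'
      | mul_X p w h =>
        have e : p * X w - rename (Function.update id v u) (p * X w) =
            (p - rename (Function.update id v u) p) * X w +
              rename (Function.update id v u) p * (X w - X (Function.update id v u w)) := by
          simp only [map_mul, rename_X]
          ring
        rw [e]
        refine dvd_add (h.mul_right _) (Dvd.dvd.mul_left ?_ _)
        by_cases hw : w = v
        · subst hw
          simp only [Function.update_self]
          exact ⟨-1, by ring⟩
        · simp [hw]
    intro h0
    rwa [h0, sub_zero] at h

/-- Divisibility is the vanishing of a ring homomorphism into a domain. -/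
lemma prime_X_sub_X {u v : σ} (h : u ≠ v) : Prime (X u - X v : MvPolynomial σ ℂ) := by
  refine ⟨?_, ?_, fun p p' => ?_⟩
  · rw [sub_ne_zero]
    exact fun e => h (X_injective e)
  · intro hu
    have := (X_sub_X_dvd_iff (u := u) (v := v) (1 : MvPolynomial σ ℂ)).1 hu.dvd
    simp at this
  · rw [X_sub_X_dvd_iff, X_sub_X_dvd_iff, X_sub_X_dvd_iff, map_mul, mul_eq_zero]
    exact id

variable {k : Fin r → ℕ}

/-- The pairs of variables of the same color, in their order. -/
def orderedPairs (k : Fin r → ℕ) : Finset (Vars k × Vars k) :=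
  {p | Before p.1 p.2 ∧ p.1.1 = p.2.1}

/-- Merging two variables identifies no other pair; ordering the pairs excludes the same difference
up to sign. -/
lemma not_dvd_of_ne {p p' : Vars k × Vars k} (hp : p ∈ orderedPairs k) (hp' : p' ∈ orderedPairs k)
    (h : p ≠ p') : ¬ (X p.1 - X p.2 : MvPolynomial (Vars k) ℂ) ∣ X p'.1 - X p'.2 := by
  rw [X_sub_X_dvd_iff, map_sub, rename_X, rename_X, sub_eq_zero]
  intro e
  have e := X_injective e
  simp only [orderedPairs, Finset.mem_filter, Finset.mem_univ, true_and] at hp hp'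
  obtain ⟨u, v⟩ := p
  obtain ⟨u', v'⟩ := p'
  simp only [Function.update_apply, id] at e
  have h1 := hp.1.ne
  have h2 := hp'.1.ne
  split_ifs at e with e1 e2 e2
  · exact h2 (e1.trans e2.symm)
  · have := hp.1.asymm
    subst e e1
    exact this hp'.1
  · subst e e2
    exact h rfl
  · exact h2 e

/-- The product of the differences of variables of the same color. -/
def vandermonde (k : Fin r → ℕ) : MvPolynomial (Vars k) ℂ :=
  ∏ p ∈ orderedPairs k, (X p.1 - X p.2)

/-- The differences are primes that are pairwise relatively prime, so divisibility can be tested one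
factor at a time. -/
lemma vandermonde_dvd {P : MvPolynomial (Vars k) ℂ}
    (h : ∀ p ∈ orderedPairs k, (X p.1 - X p.2) ∣ P) : vandermonde k ∣ P := by
  refine Finset.prod_dvd_of_isRelPrime ?_ h
  intro p hp p' hp' hne
  exact ((prime_X_sub_X (Finset.mem_filter.1 hp).2.1.ne).irreducible.isRelPrime_iff_not_dvd).2
    (not_dvd_of_ne hp hp' hne)

/-- `P` is a Vandermonde product times a symmetric function, hence changes sign under the swap of
the two variables, and so vanishes on their diagonal. -/
lemma X_sub_X_dvd_of_isSym {P : MvPolynomial (Vars k) ℂ} {f : RatFn k} (hf : IsSym f)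
    (h : algebraMap _ _ P = algebraMap _ (RatFn k) (vandermonde k) * f)
    {p : Vars k × Vars k} (hp : p ∈ orderedPairs k) :
    (X p.1 - X p.2 : MvPolynomial (Vars k) ℂ) ∣ P := by
  obtain ⟨u, v⟩ := p
  have hp' := (Finset.mem_filter.1 hp).2
  simp only at hp' ⊢
  let τ : ColorEquiv (color k) (color k) := ⟨Equiv.swap u v, fun w => by
    by_cases h1 : w = u
    · subst h1; simp [hp'.2]
    by_cases h2 : w = v
    · subst h2; simp [hp'.2]
    rw [Equiv.swap_apply_of_ne_of_ne h1 h2]⟩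
  obtain ⟨W, hW⟩ : ∃ W, W = ∏ p ∈ (orderedPairs k).erase (u, v),
    (X p.1 - X p.2 : MvPolynomial (Vars k) ℂ) := ⟨_, rfl⟩
  have hV : vandermonde k = (X u - X v) * W := by
    rw [hW, vandermonde, Finset.mul_prod_erase _ (fun p : Vars k × Vars k =>
      (X p.1 - X p.2 : MvPolynomial (Vars k) ℂ)) hp]
  have h2 := congrArg (permute τ) h
  rw [map_mul, hf τ, subst_algebraMap, subst_algebraMap] at h2
  rw [hV] at h h2
  have hτ : rename τ.1 (X u - X v : MvPolynomial (Vars k) ℂ) = X v - X u := by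
    simp [τ]
  rw [map_mul (rename τ.1), hτ] at h2
  -- Antisymmetry in cross-multiplied form: only the factor `X u - X v` is known to change sign, so
  -- the remaining factors `W` are carried along.
  have h3 : P * rename τ.1 W = - (rename τ.1 P * W) := by
    apply algebraMap_ratFn_injective
    rw [map_neg, map_mul, map_mul, h, h2]
    simp only [map_mul, map_sub]
    ring
  -- On the diagonal the swap becomes invisible, so `h3` reads `2 * P * W = 0` there, and `W` does
  -- not vanish on the diagonal.
  have h4 := congrArg (rename (Function.update id v u)) h3
  have hφ : Function.update id v u ∘ τ.1 = Function.update id v u := by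
    funext w
    by_cases h1 : w = u
    · subst h1; simp [τ, hp'.1.ne]
    by_cases h2 : w = v
    · subst h2; simp [τ, hp'.1.ne]
    · simp [τ, Equiv.swap_apply_of_ne_of_ne h1 h2, h2]
  rw [map_neg, map_mul, map_mul, rename_rename, rename_rename, hφ, eq_neg_iff_add_eq_zero,
    ← two_mul, mul_eq_zero, mul_eq_zero] at h4
  rw [X_sub_X_dvd_iff]
  refine (h4.resolve_left two_ne_zero).resolve_right ?_
  intro e
  rw [hW, map_prod, Finset.prod_eq_zero_iff] at e
  obtain ⟨p'', hp'', e⟩ := e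
  rw [← X_sub_X_dvd_iff] at e
  rw [Finset.mem_erase] at hp''
  exact not_dvd_of_ne hp hp''.2 (Ne.symm hp''.1) e

/-- After multiplication by a symmetric monomial the problem is polynomial. The numerator is then
divisible by the full Vandermonde product, which cancels the apparent poles. -/
lemma mem_laurentAlg_of_isSym {f : RatFn k} (hf : IsSym f)
    (h : algebraMap _ (RatFn k) (vandermonde k) * f ∈ laurentAlg k) : f ∈ laurentAlg k := by
  obtain ⟨A, hA⟩ := mem_laurentAlg.1 h
  obtain ⟨M, P, hP⟩ := exists_clear_denominators A
  have hP := hP (RatFn k) zv zv_ne_zero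
  rw [aeval_zv, hA] at hP
  have hs : IsSym ((∏ v, (zv v : RatFn k)) ^ M * f) := fun τ => by
    rw [map_mul, map_pow, map_prod, hf τ]
    congr 2
    simp only [subst_zv]
    exact Equiv.prod_comp τ.1 zv
  obtain ⟨g, rfl⟩ := vandermonde_dvd fun p hp => X_sub_X_dvd_of_isSym hs (hP.trans (by ring)) hp
  have hV : algebraMap _ (RatFn k) (vandermonde k) ≠ 0 := by
    rw [Ne, FaithfulSMul.algebraMap_eq_zero_iff]
    exact Finset.prod_ne_zero_iff.2 fun p hp =>
      (prime_X_sub_X (Finset.mem_filter.1 hp).2.1.ne).ne_zero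
  have hm : (∏ v, (zv v : RatFn k)) ≠ 0 := Finset.prod_ne_zero_iff.2 fun v _ => zv_ne_zero v
  have e : f = (∏ v, (zv v : RatFn k) ^ (-M : ℤ)) * algebraMap _ _ g := by
    rw [map_mul, mul_left_comm] at hP
    have := mul_left_cancel₀ hV hP
    rw [this, Finset.prod_zpow, zpow_neg, zpow_natCast, ← mul_assoc,
      inv_mul_cancel₀ (pow_ne_zero _ hm), one_mul]
  rw [e]
  exact mul_mem (monomial_mem_laurentAlg fun _ => -M) (algebraMap_mem_laurentAlg g)

end Vandermonde

/-! ### Closure under the product -/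

section Closure

variable {n m k : Fin r → ℕ} {Q : Fin r → Fin r → ℂ}

lemma permute_starTerm (f : RatFn n) (g : RatFn m) (σ : ColorEquiv (color₂ n m) (color k))
    (τ : ColorEquiv (color k) (color k)) :
    permute τ (starTerm Q f g σ) = starTerm Q f g (σ.trans τ) := by
  unfold starTerm
  rw [map_mul, map_mul, map_prod, subst_subst, subst_subst]
  simp only [subst_weight Q τ.1 τ.1.injective τ.2]
  rfl

lemma isSym_star (f : RatFn n) (g : RatFn m) : IsSym (star Q k f g) := fun τ => by
  unfold star
  rw [subst_smul, map_sum]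
  simp only [permute_starTerm]
  congr 1
  exact (postEquiv _ τ).sum_comp (starTerm Q f g)

lemma smul_zv_mem_laurentAlg (c : ℂ) (v : Vars k) : c • (zv v : RatFn k) ∈ laurentAlg k :=
  Subalgebra.smul_mem _ (zv_mem_laurentAlg v) _

/-- The Vandermonde product splits along the shuffle, and its mixed factors cancel, up to sign, the
denominators of the weights. -/
lemma vandermonde_mul_starTerm_mem {f : RatFn n} {g : RatFn m} (hf : f ∈ laurentAlg n)
    (hg : g ∈ laurentAlg m) {σ : ColorEquiv (color₂ n m) (color k)} (hσ : σ.1 ∈ shuffles n m k) :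
    algebraMap _ (RatFn k) (vandermonde k) * starTerm Q f g σ ∈ laurentAlg k := by
  have hsub : ∀ u v : Vars k, (zv u - zv v : RatFn k) ∈ laurentAlg k := fun u v =>
    sub_mem (zv_mem_laurentAlg u) (zv_mem_laurentAlg v)
  have hV : algebraMap _ (RatFn k) (vandermonde k) =
      ∏ p : Vars k × Vars k with Before p.1 p.2, if p.1.1 = p.2.1 then zv p.1 - zv p.2 else 1 := by
    rw [vandermonde, map_prod, ← Finset.prod_filter, Finset.filter_filter]
    exact Finset.prod_congr rfl fun p _ => (zv_sub _ _).symm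
  rw [hV, prod_before_of_shuffle hσ fun u v => if u.1 = v.1 then (zv u - zv v : RatFn k) else 1]
  unfold starTerm
  rw [show ∀ x y z w f g : RatFn k, x * y * z * (w * f * g) = x * y * (z * w) * f * g from
    fun _ _ _ _ _ _ => by ring, ← Finset.prod_mul_distrib]
  have hite : ∀ u v : Vars k, (if u.1 = v.1 then zv u - zv v else 1 : RatFn k) ∈ laurentAlg k := by
    intro u v
    split_ifs
    · exact hsub u v
    · exact one_mem _
  refine mul_mem (mul_mem (mul_mem (mul_mem (prod_mem fun p _ => hite _ _)
    (prod_mem fun p _ => hite _ _)) (prod_mem fun p _ => ?_)) (subst_mem_laurentAlg _ _ hf))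
    (subst_mem_laurentAlg _ _ hg)
  have hne : σ.1 (Sum.inl p.1) ≠ σ.1 (Sum.inr p.2) := fun e => by simpa using σ.1.injective e
  generalize σ.1 (Sum.inl p.1) = u at *
  generalize σ.1 (Sum.inr p.2) = v at *
  have h1 := zv_sub_ne_zero hne
  unfold weight
  by_cases hc : u.1 = v.1
  · have hn : (zv u - Q u.1 v.1 • zv v : RatFn k) ∈ laurentAlg k :=
      sub_mem (zv_mem_laurentAlg u) (smul_zv_mem_laurentAlg _ v)
    simp only [hc, if_true] at hn ⊢
    split_ifs
    · convert neg_mem hn using 1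
      field_simp
      ring
    · convert hn using 1
      field_simp
  · simp only [hc, Ne.symm hc, if_false, ite_self, one_mul]
    split_ifs
    · exact sub_mem (zv_mem_laurentAlg u) (smul_zv_mem_laurentAlg _ v)
    · exact sub_mem (smul_zv_mem_laurentAlg _ v) (zv_mem_laurentAlg u)

lemma star_mem_laurentAlg {f : RatFn n} {g : RatFn m} (hf : f ∈ laurentAlg n)
    (hg : g ∈ laurentAlg m) (hfs : IsSym f) (hgs : IsSym g) : star Q k f g ∈ laurentAlg k := by
  refine mem_laurentAlg_of_isSym (isSym_star f g) ?_
  unfold star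
  rw [mul_smul_comm, Finset.mul_sum]
  refine Subalgebra.smul_mem _ (sum_mem fun ρ _ => ?_) _
  -- Pole cancellation was established for shuffles only; by symmetry of the arguments the summand
  -- of `ρ` equals that of its shuffle.
  obtain ⟨⟨σ, τ, τ'⟩, rfl⟩ := (shuffleComp_bijective n m k).2 ρ
  rw [shuffleComp, starTerm_sumCongr hfs hgs]
  exact vandermonde_mul_starTerm_mem hf hg σ.2

lemma shuffle_mem_shBarDeg {q : ℂ} {d : Fin r → ℕ} {a : Matrix (Fin r) (Fin r) ℤ}
    (hQ : ∀ α β, qPair q d a α β = qPair q d a β α) {f : RatFn n} {g : RatFn m}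
    (hf : f ∈ shBarDeg q d a n) (hg : g ∈ shBarDeg q d a m) :
    shuffle q d a k f g ∈ shBarDeg q d a k := by
  obtain ⟨f, hfl, hfs, rfl⟩ := mem_shBarDeg.1 hf
  obtain ⟨g, hgl, hgs, rfl⟩ := mem_shBarDeg.1 hg
  rw [shuffle_canFactor_mul hQ hfs hgs]
  exact mem_shBarDeg.2 ⟨_, star_mem_laurentAlg hfl hgl hfs hgs, isSym_star f g, rfl⟩

end Closure

/-! ### Associativity and unit -/

section Associativity

variable {n m l k p : Fin r → ℕ} {Q : Fin r → Fin r → ℂ}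

/-- The summand of a triple product. -/
def tripleTerm (Q : Fin r → Fin r → ℂ) (f : RatFn n) (g : RatFn m) (h : RatFn l)
    (ρ : ColorEquiv (Sum.elim (color₂ n m) (color l)) (color p)) : RatFn p :=
  (∏ u : Vars n, ∏ v : Vars m, weight Q (ρ.1 (Sum.inl (Sum.inl u))) (ρ.1 (Sum.inl (Sum.inr v)))) *
    (∏ u : Vars n, ∏ x : Vars l, weight Q (ρ.1 (Sum.inl (Sum.inl u))) (ρ.1 (Sum.inr x))) *
    (∏ v : Vars m, ∏ x : Vars l, weight Q (ρ.1 (Sum.inl (Sum.inr v))) (ρ.1 (Sum.inr x))) *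
    subst (fun u => ρ.1 (Sum.inl (Sum.inl u)))
      (ρ.1.injective.comp (Sum.inl_injective.comp Sum.inl_injective)) f *
    subst (fun u => ρ.1 (Sum.inl (Sum.inr u)))
      (ρ.1.injective.comp (Sum.inl_injective.comp Sum.inr_injective)) g *
    subst (fun u => ρ.1 (Sum.inr u)) (ρ.1.injective.comp Sum.inr_injective) h

/-- The symmetrized product of three factors. -/
def triple (Q : Fin r → Fin r → ℂ) (p : Fin r → ℕ) (f : RatFn n) (g : RatFn m) (h : RatFn l) :
    RatFn p :=
  (autCard n * autCard m * autCard l)⁻¹ • ∑ ρ, tripleTerm Q f g h ρ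

/-- Associativity of disjoint unions. -/
def sumAssoc {X Y Z : Type*} (c : X → Fin r) (c' : Y → Fin r) (c'' : Z → Fin r) :
    ColorEquiv (Sum.elim (Sum.elim c c') c'') (Sum.elim c (Sum.elim c' c'')) :=
  ⟨Equiv.sumAssoc X Y Z, by rintro ((x | x) | x) <;> rfl⟩

lemma substL_weight {X : Type*} {c : X → Fin r} (σ : ColorEquiv (Sum.elim (color n) c) (color k))
    (u v : Vars n) : substL σ (weight Q u v) = weight Q (σ.1 (Sum.inl u)) (σ.1 (Sum.inl v)) :=
  subst_weight Q _ _ (fun s => σ.2 (Sum.inl s)) u v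

lemma substR_weight {X : Type*} {c : X → Fin r} (σ : ColorEquiv (Sum.elim c (color m)) (color k))
    (u v : Vars m) : substR σ (weight Q u v) = weight Q (σ.1 (Sum.inr u)) (σ.1 (Sum.inr v)) :=
  subst_weight Q _ _ (fun s => σ.2 (Sum.inr s)) u v

/-- Weights are compatible with substitution, so the outer weights against the middle variables
split into those of the first and of the second argument. -/
lemma starTerm_starTerm_left (f : RatFn n) (g : RatFn m) (h : RatFn l)
    (τ : ColorEquiv (color₂ n m) (color k)) (σ : ColorEquiv (color₂ k l) (color p)) :
    starTerm Q (starTerm Q f g τ) h σ =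
      tripleTerm Q f g h ((τ.sumCongr (ColorEquiv.refl (color l))).trans σ) := by
  unfold tripleTerm
  rw [starTerm, starTerm, map_mul, map_mul, map_prod, subst_subst, subst_subst]
  simp only [substL_weight, Fintype.prod_prod_type]
  rw [← Equiv.prod_comp τ.1, Fintype.prod_sum_type]
  simp only [coe_trans, coe_sumCongr, Equiv.trans_apply, Equiv.sumCongr_apply, Sum.map_inl,
    Sum.map_inr, coe_refl, Equiv.refl_apply, Function.comp_def]
  ring

lemma starTerm_starTerm_right (f : RatFn n) (g : RatFn m) (h : RatFn l)
    (τ : ColorEquiv (color₂ m l) (color k)) (σ : ColorEquiv (color₂ n k) (color p)) :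
    starTerm Q f (starTerm Q g h τ) σ =
      tripleTerm Q f g h (((sumAssoc _ _ _).trans
        ((ColorEquiv.refl (color n)).sumCongr τ)).trans σ) := by
  unfold tripleTerm
  rw [starTerm, starTerm, map_mul, map_mul, map_prod, subst_subst, subst_subst]
  simp only [substR_weight, Fintype.prod_prod_type]
  simp only [← Equiv.prod_comp τ.1, Fintype.prod_sum_type, Finset.prod_mul_distrib]
  simp only [sumAssoc, coe_trans, coe_sumCongr, Equiv.trans_apply, Equiv.sumCongr_apply,
    Sum.map_inl, Sum.map_inr, coe_refl, Equiv.refl_apply, Function.comp_def,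
    Equiv.sumAssoc_apply_inl_inl, Equiv.sumAssoc_apply_inl_inr, Equiv.sumAssoc_apply_inr]
  ring

variable (Q k) in
/-- The symmetrized product as a bilinear map. -/
def starBilin (n m : Fin r → ℕ) : RatFn n →ₗ[ℂ] RatFn m →ₗ[ℂ] RatFn k :=
  LinearMap.mk₂ ℂ (star Q k)
    (fun f f' g => by
      simp only [star, starTerm, map_add, mul_add, add_mul, Finset.sum_add_distrib, smul_add])
    (fun c f g => by
      simp only [star, starTerm, subst_smul, mul_smul_comm, smul_mul_assoc, ← Finset.smul_sum]
      rw [smul_comm])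
    (fun f g g' => by
      simp only [star, starTerm, map_add, mul_add, Finset.sum_add_distrib, smul_add])
    (fun c f g => by
      simp only [star, starTerm, subst_smul, mul_smul_comm, ← Finset.smul_sum]
      rw [smul_comm])

lemma starTerm_smul_sum_left {ι : Type*} (s : Finset ι) (c : ℂ) (f : ι → RatFn n) (g : RatFn m)
    (σ : ColorEquiv (color₂ n m) (color k)) :
    starTerm Q (c • ∑ i ∈ s, f i) g σ = c • ∑ i ∈ s, starTerm Q (f i) g σ := by
  simp only [starTerm, subst_smul, map_sum, mul_smul_comm, smul_mul_assoc, Finset.mul_sum,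
    Finset.sum_mul]

lemma starTerm_smul_sum_right {ι : Type*} (s : Finset ι) (c : ℂ) (f : RatFn n) (g : ι → RatFn m)
    (σ : ColorEquiv (color₂ n m) (color k)) :
    starTerm Q f (c • ∑ i ∈ s, g i) σ = c • ∑ i ∈ s, starTerm Q f (g i) σ := by
  simp only [starTerm, subst_smul, map_sum, mul_smul_comm, Finset.mul_sum]

/-- For each inner bijection `τ`, composition makes the outer sum run once over all triple
bijections. The number of `τ` is `autCard k`, because `k = n + m`, and it cancels the extra
normalization. -/
lemma star_star_left (hk : k = n + m) (f : RatFn n) (g : RatFn m) (h : RatFn l) :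
    star Q p (star Q k f g) h = triple Q p f g h := by
  subst hk
  unfold triple
  rw [star, star]
  simp only [starTerm_smul_sum_left, starTerm_starTerm_left]
  rw [← Finset.smul_sum, Finset.sum_comm, Finset.sum_congr rfl fun τ _ =>
    sum_trans (ColorEquiv.sumCongr τ (ColorEquiv.refl (color l))) (tripleTerm Q f g h (p := p)),
    Finset.sum_const, Finset.card_univ, ← Nat.cast_smul_eq_nsmul ℂ,
    card_colorEquiv (addEquiv n m), smul_smul, smul_smul]
  congr 1
  have := autCard_ne_zero n
  have := autCard_ne_zero m
  have := autCard_ne_zero l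
  have := autCard_ne_zero (n + m)
  field_simp

lemma star_star_right (hk : k = m + l) (f : RatFn n) (g : RatFn m) (h : RatFn l) :
    star Q p f (star Q k g h) = triple Q p f g h := by
  subst hk
  unfold triple
  rw [star, star]
  simp only [starTerm_smul_sum_right, starTerm_starTerm_right]
  rw [← Finset.smul_sum, Finset.sum_comm, Finset.sum_congr rfl fun τ _ =>
    sum_trans ((sumAssoc _ _ _).trans (ColorEquiv.sumCongr (ColorEquiv.refl (color n)) τ))
      (tripleTerm Q f g h (p := p)),
    Finset.sum_const, Finset.card_univ, ← Nat.cast_smul_eq_nsmul ℂ,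
    card_colorEquiv (addEquiv m l), smul_smul, smul_smul]
  congr 1
  have := autCard_ne_zero n
  have := autCard_ne_zero m
  have := autCard_ne_zero l
  have := autCard_ne_zero (m + l)
  field_simp

instance : IsEmpty (Vars (0 : Fin r → ℕ)) := ⟨fun v => Fin.elim0 v.2⟩

/-- The variables of degree `0 + k`. -/
def zeroSum (k : Fin r → ℕ) : ColorEquiv (color k) (color₂ 0 k) :=
  ⟨(Equiv.emptySum _ _).symm, fun _ => rfl⟩

/-- The variables of degree `k + 0`. -/
def sumZero (k : Fin r → ℕ) : ColorEquiv (color k) (color₂ k 0) :=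
  ⟨(Equiv.sumEmpty _ _).symm, fun _ => rfl⟩

lemma autCard_zero : autCard (0 : Fin r → ℕ) = 1 := by
  have : Unique (ColorEquiv (color (0 : Fin r → ℕ)) (color 0)) :=
    ⟨⟨ColorEquiv.refl _⟩, fun σ => Subtype.ext (Equiv.ext fun v => isEmptyElim v)⟩
  rw [autCard, Fintype.card_eq_one_iff_nonempty_unique.2 ⟨this⟩, Nat.cast_one]

/-- There are no mixed pairs, and each of the `autCard k` summands is a permutation of the symmetric
function `g`. -/
lemma one_star {g : RatFn k} (hg : IsSym g) : star Q k (1 : RatFn (0 : Fin r → ℕ)) g = g := by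
  have h : ∀ σ : ColorEquiv (color₂ 0 k) (color k),
      starTerm Q (1 : RatFn (0 : Fin r → ℕ)) g σ = g := fun σ => by
    unfold starTerm
    rw [Fintype.prod_empty, map_one, one_mul, one_mul]
    exact hg ((zeroSum k).trans σ)
  unfold star
  simp only [h, Finset.sum_const, Finset.card_univ]
  rw [← Nat.cast_smul_eq_nsmul ℂ, card_colorEquiv (zeroSum k).symm, autCard_zero, one_mul, smul_smul,
    inv_mul_cancel₀ (autCard_ne_zero k), one_smul]

lemma star_one {g : RatFn k} (hg : IsSym g) : star Q k g (1 : RatFn (0 : Fin r → ℕ)) = g := by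
  have h : ∀ σ : ColorEquiv (color₂ k 0) (color k),
      starTerm Q g (1 : RatFn (0 : Fin r → ℕ)) σ = g := fun σ => by
    unfold starTerm
    rw [Fintype.prod_empty, map_one, one_mul, mul_one]
    exact hg ((sumZero k).trans σ)
  unfold star
  simp only [h, Finset.sum_const, Finset.card_univ]
  rw [← Nat.cast_smul_eq_nsmul ℂ, card_colorEquiv (sumZero k).symm, autCard_zero, mul_one, smul_smul,
    inv_mul_cancel₀ (autCard_ne_zero k), one_smul]

end Associativity

/-! ### Families of rational functions -/

section Families

variable {q : ℂ} {d : Fin r → ℕ} {a : Matrix (Fin r) (Fin r) ℤ} {Q : Fin r → Fin r → ℂ}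

/-- The product of families, with the fixed factors removed. -/
def starMul (Q : Fin r → Fin r → ℂ) (A B : ∀ n : Fin r → ℕ, RatFn n) : ∀ n : Fin r → ℕ, RatFn n :=
  fun k => ∑ n ∈ Finset.Iic k, star Q k (A n) (B (k - n))

/-- The multiplication of a family by the fixed factors. -/
def canMul (q : ℂ) (d : Fin r → ℕ) (a : Matrix (Fin r) (Fin r) ℤ) (A : ∀ n : Fin r → ℕ, RatFn n) :
    ∀ n : Fin r → ℕ, RatFn n :=
  fun n => canFactor q d a n * A n

lemma isSym_sum {k : Fin r → ℕ} {ι : Type*} (s : Finset ι) (f : ι → RatFn k)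
    (h : ∀ i ∈ s, IsSym (f i)) : IsSym (∑ i ∈ s, f i) := fun τ => by
  rw [map_sum]
  exact Finset.sum_congr rfl fun i hi => h i hi τ

lemma isSym_starMul (A B : ∀ n : Fin r → ℕ, RatFn n) (k : Fin r → ℕ) : IsSym (starMul Q A B k) :=
  isSym_sum _ _ fun _ _ => isSym_star _ _

lemma shMul_canMul (hQ : ∀ α β, qPair q d a α β = qPair q d a β α)
    {A B : ∀ n : Fin r → ℕ, RatFn n} (hA : ∀ n, IsSym (A n)) (hB : ∀ n, IsSym (B n)) :
    shMul q d a (canMul q d a A) (canMul q d a B) = canMul q d a (starMul (qPair q d a) A B) := by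
  funext k
  simp only [shMul, LinearMap.mk₂_apply, canMul, starMul, Finset.mul_sum]
  exact Finset.sum_congr rfl fun n _ => shuffle_canFactor_mul hQ (hA n) (hB _)

lemma starMul_assoc (A B D : ∀ n : Fin r → ℕ, RatFn n) :
    starMul Q (starMul Q A B) D = starMul Q A (starMul Q B D) := by
  funext p
  have h1 : starMul Q (starMul Q A B) D p = ∑ k ∈ Finset.Iic p, ∑ n ∈ Finset.Iic k,
      triple Q p (A n) (B (k - n)) (D (p - k)) := by
    refine Finset.sum_congr rfl fun k _ => ?_
    have := LinearMap.map_sum₂ (starBilin p Q k (p - k)) (Finset.Iic k)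
      (fun n => star Q k (A n) (B (k - n))) (D (p - k))
    refine this.trans (Finset.sum_congr rfl fun n hn => ?_)
    exact star_star_left (add_tsub_cancel_of_le (Finset.mem_Iic.1 hn)).symm _ _ _
  have h2 : starMul Q A (starMul Q B D) p = ∑ n ∈ Finset.Iic p, ∑ m ∈ Finset.Iic (p - n),
      triple Q p (A n) (B m) (D (p - n - m)) := by
    refine Finset.sum_congr rfl fun n _ => ?_
    refine (map_sum (starBilin p Q n (p - n) (A n)) _ _).trans (Finset.sum_congr rfl fun m hm => ?_)
    exact star_star_right (add_tsub_cancel_of_le (Finset.mem_Iic.1 hm)).symm _ _ _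
  rw [h1, h2, Finset.sum_sigma', Finset.sum_sigma']
  -- The partial degree `k` of the first two factors is exchanged for the degree `k - n` of the
  -- middle factor.
  refine Finset.sum_bij' (fun x _ => ⟨x.2, x.1 - x.2⟩) (fun x _ => ⟨x.1 + x.2, x.1⟩) ?_ ?_ ?_ ?_ ?_
  · rintro ⟨k, n⟩ h
    simp only [Finset.mem_sigma, Finset.mem_Iic] at h ⊢
    exact ⟨h.2.trans h.1, tsub_le_tsub_right h.1 n⟩
  · rintro ⟨n, m⟩ h
    simp only [Finset.mem_sigma, Finset.mem_Iic] at h ⊢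
    exact ⟨(add_le_add_right h.2 n).trans (add_tsub_cancel_of_le h.1).le, le_self_add⟩
  · rintro ⟨k, n⟩ h
    simp only [Finset.mem_sigma, Finset.mem_Iic] at h
    simp [add_tsub_cancel_of_le h.2]
  · rintro ⟨n, m⟩ h
    simp
  · rintro ⟨k, n⟩ h
    simp only [Finset.mem_sigma, Finset.mem_Iic] at h
    have : p - n - (k - n) = p - k := by
      rw [tsub_tsub, add_tsub_cancel_of_le h.2]
    exact congrArg (fun l => triple Q p (A n) (B (k - n)) (D l)) this.symm

lemma canFactor_zero : canFactor q d a 0 = 1 := by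
  rw [canFactor_eq]
  exact Finset.prod_eq_one fun p _ => isEmptyElim p.1

/-- The unit family. -/
abbrev oneFam : ∀ n : Fin r → ℕ, RatFn n := Pi.single 0 1

lemma canMul_oneFam : canMul q d a oneFam = shOne := by
  funext n
  unfold canMul oneFam shOne
  by_cases h : n = 0
  · subst h
    simp [canFactor_zero]
  · rw [Pi.single_eq_of_ne h, mul_zero]

lemma isSym_oneFam (n : Fin r → ℕ) : IsSym ((oneFam : ∀ n : Fin r → ℕ, RatFn n) n) := fun τ => by
  by_cases h : n = 0
  · subst h
    simp [oneFam]
  · simp [oneFam, h]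

lemma star_zero_left {n m k : Fin r → ℕ} (g : RatFn m) : star Q k (0 : RatFn n) g = 0 :=
  LinearMap.map_zero₂ (starBilin k Q n m) g

lemma star_zero_right {n m k : Fin r → ℕ} (f : RatFn n) : star Q k f (0 : RatFn m) = 0 :=
  map_zero (starBilin k Q n m f)

lemma oneFam_starMul {A : ∀ n : Fin r → ℕ, RatFn n} (hA : ∀ n, IsSym (A n)) :
    starMul Q oneFam A = A := by
  funext k
  unfold starMul
  rw [Finset.sum_eq_single 0]
  -- The degree `k - 0` equals `k` only propositionally and the type of `A` depends on it, so the
  -- degree is generalized first.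
  · have : ∀ m, m = k → star Q k ((oneFam : ∀ n : Fin r → ℕ, RatFn n) 0) (A m) = A k := by
      rintro m rfl
      rw [oneFam, Pi.single_eq_same]
      exact one_star (hA m)
    exact this _ (tsub_zero k)
  · intro n _ hn
    rw [oneFam, Pi.single_eq_of_ne hn, star_zero_left]
  · intro h
    exact absurd (Finset.mem_Iic.2 zero_le) h

lemma starMul_oneFam {A : ∀ n : Fin r → ℕ, RatFn n} (hA : ∀ n, IsSym (A n)) :
    starMul Q A oneFam = A := by
  funext k
  unfold starMul
  rw [Finset.sum_eq_single k]
  · have : ∀ m, m = 0 → star Q k (A k) ((oneFam : ∀ n : Fin r → ℕ, RatFn n) m) = A k := by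
      rintro m rfl
      rw [oneFam, Pi.single_eq_same]
      exact star_one (hA k)
    exact this _ (tsub_self k)
  · intro n hn hnk
    have : k - n ≠ 0 := fun h => hnk (le_antisymm (Finset.mem_Iic.1 hn) (tsub_eq_zero_iff_le.1 h))
    rw [oneFam, Pi.single_eq_of_ne this, star_zero_right]
  · intro h
    exact absurd (Finset.mem_Iic.2 le_rfl) h

lemma exists_canMul {F : ∀ n : Fin r → ℕ, RatFn n} (hF : F ∈ ShBar q d a) :
    ∃ A : ∀ n : Fin r → ℕ, RatFn n, (∀ n, A n ∈ laurentAlg n) ∧ (∀ n, IsSym (A n)) ∧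
      canMul q d a A = F := by
  choose A h1 h2 h3 using fun n => mem_shBarDeg.1 (hF.2 n)
  exact ⟨A, h1, h2, funext h3⟩

lemma shMul_mem_shBar (hQ : ∀ α β, qPair q d a α β = qPair q d a β α)
    {F G : ∀ n : Fin r → ℕ, RatFn n} (hF : F ∈ ShBar q d a) (hG : G ∈ ShBar q d a) :
    shMul q d a F G ∈ ShBar q d a := by
  refine ⟨(hF.1.add hG.1).subset fun k hk => ?_, fun k => ?_⟩
  · by_contra h
    refine hk (Finset.sum_eq_zero fun n hn => ?_)
    by_cases h1 : F n = 0
    · simp [shuffle, h1]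
    by_cases h2 : G (k - n) = 0
    · simp [shuffle, h2]
    · exact absurd (Set.add_mem_add (s := {n | F n ≠ 0}) (t := {n | G n ≠ 0}) h1 h2)
        (by rwa [add_tsub_cancel_of_le (Finset.mem_Iic.1 hn)])
  · exact sum_mem fun n _ => shuffle_mem_shBarDeg hQ (hF.2 n) (hG.2 _)

lemma shMul_assoc (hQ : ∀ α β, qPair q d a α β = qPair q d a β α)
    {F G K : ∀ n : Fin r → ℕ, RatFn n} (hF : F ∈ ShBar q d a) (hG : G ∈ ShBar q d a)
    (hK : K ∈ ShBar q d a) :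
    shMul q d a (shMul q d a F G) K = shMul q d a F (shMul q d a G K) := by
  obtain ⟨A, -, hA, rfl⟩ := exists_canMul hF
  obtain ⟨B, -, hB, rfl⟩ := exists_canMul hG
  obtain ⟨D, -, hD, rfl⟩ := exists_canMul hK
  rw [shMul_canMul hQ hA hB, shMul_canMul hQ hB hD, shMul_canMul hQ (isSym_starMul _ _) hD,
    shMul_canMul hQ hA (isSym_starMul _ _), starMul_assoc]

lemma shOne_mem_shBar : shOne ∈ ShBar q d a := by
  refine ⟨(Set.finite_singleton 0).subset fun n hn => ?_, fun n => ?_⟩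
  · by_contra h
    exact hn (by simp only [shOne]; rw [Pi.single_eq_of_ne h])
  · rw [← canMul_oneFam (q := q) (d := d) (a := a)]
    refine mem_shBarDeg.2 ⟨_, ?_, isSym_oneFam n, rfl⟩
    by_cases h : n = 0
    · subst h
      simp only [oneFam, Pi.single_eq_same]
      exact one_mem _
    · rw [oneFam, Pi.single_eq_of_ne h]
      exact zero_mem _

lemma shOne_shMul (hQ : ∀ α β, qPair q d a α β = qPair q d a β α)
    {F : ∀ n : Fin r → ℕ, RatFn n} (hF : F ∈ ShBar q d a) : shMul q d a shOne F = F := by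
  obtain ⟨A, -, hA, rfl⟩ := exists_canMul hF
  rw [← canMul_oneFam (q := q) (d := d) (a := a), shMul_canMul hQ isSym_oneFam hA,
    oneFam_starMul hA]

lemma shMul_shOne (hQ : ∀ α β, qPair q d a α β = qPair q d a β α)
    {F : ∀ n : Fin r → ℕ, RatFn n} (hF : F ∈ ShBar q d a) : shMul q d a F shOne = F := by
  obtain ⟨A, -, hA, rfl⟩ := exists_canMul hF
  rw [← canMul_oneFam (q := q) (d := d) (a := a), shMul_canMul hQ hA isSym_oneFam,
    starMul_oneFam hA]

end Families

/-! ### The algebra `Sh̄` -/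

section ShAlg

variable {q : ℂ} {d : Fin r → ℕ} {a : Matrix (Fin r) (Fin r) ℤ}

/-- The space `Sh̄`, with the shuffle product as multiplication. -/
def ShAlg (q : ℂ) (d : Fin r → ℕ) (a : Matrix (Fin r) (Fin r) ℤ)
    (_ : ∀ α β, qPair q d a α β = qPair q d a β α) : Type :=
  ShBar q d a

variable (hQ : ∀ α β, qPair q d a α β = qPair q d a β α)

instance : AddCommGroup (ShAlg q d a hQ) := inferInstanceAs (AddCommGroup (ShBar q d a))

instance : Module ℂ (ShAlg q d a hQ) := inferInstanceAs (Module ℂ (ShBar q d a))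

/-- The underlying family. -/
def ShAlg.val : ShAlg q d a hQ →ₗ[ℂ] (∀ n : Fin r → ℕ, RatFn n) := (ShBar q d a).subtype

lemma ShAlg.val_injective : Function.Injective (ShAlg.val hQ) := Subtype.val_injective

lemma ShAlg.val_mem (x : ShAlg q d a hQ) : ShAlg.val hQ x ∈ ShBar q d a := Subtype.prop x

instance : Mul (ShAlg q d a hQ) :=
  ⟨fun x y => ⟨shMul q d a (ShAlg.val hQ x) (ShAlg.val hQ y),
    shMul_mem_shBar hQ (ShAlg.val_mem hQ x) (ShAlg.val_mem hQ y)⟩⟩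

instance : One (ShAlg q d a hQ) := ⟨⟨shOne, shOne_mem_shBar⟩⟩

lemma ShAlg.val_mul (x y : ShAlg q d a hQ) :
    ShAlg.val hQ (x * y) = shMul q d a (ShAlg.val hQ x) (ShAlg.val hQ y) := rfl

lemma ShAlg.val_one : ShAlg.val hQ 1 = shOne := rfl

instance : Ring (ShAlg q d a hQ) :=
  { (inferInstance : AddCommGroup (ShAlg q d a hQ)),
    (inferInstance : Mul (ShAlg q d a hQ)), (inferInstance : One (ShAlg q d a hQ)) with
    left_distrib := fun x y z => ShAlg.val_injective hQ (by simp [ShAlg.val_mul])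
    right_distrib := fun x y z => ShAlg.val_injective hQ (by simp [ShAlg.val_mul])
    zero_mul := fun x => ShAlg.val_injective hQ (by simp [ShAlg.val_mul])
    mul_zero := fun x => ShAlg.val_injective hQ (by simp [ShAlg.val_mul])
    mul_assoc := fun x y z => ShAlg.val_injective hQ (by
      simp only [ShAlg.val_mul]
      exact shMul_assoc hQ (ShAlg.val_mem hQ x) (ShAlg.val_mem hQ y) (ShAlg.val_mem hQ z))
    one_mul := fun x => ShAlg.val_injective hQ (shOne_shMul hQ (ShAlg.val_mem hQ x))
    mul_one := fun x => ShAlg.val_injective hQ (shMul_shOne hQ (ShAlg.val_mem hQ x)) }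

instance : Algebra ℂ (ShAlg q d a hQ) :=
  Algebra.ofModule
    (fun c x y => ShAlg.val_injective hQ (by simp [ShAlg.val_mul]))
    (fun c x y => ShAlg.val_injective hQ (by simp [ShAlg.val_mul]))

end ShAlg

/-! ### The quantum Serre identity for symmetrizations -/

section SerreIdentity

variable {K : Type*} [Field K]

/-- Extension by zero of a finite family. -/
def extZero {N : ℕ} (v : Fin N → K) : ℕ → K := fun i => if h : i < N then v ⟨i, h⟩ else 0

/-- The product of `(v_i - θ v_j) / (v_i - v_j)` over `i < j`. -/
def hlProd (θ : K) {N : ℕ} (v : Fin N → K) : K :=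
  ∏ p : Fin N × Fin N with p.1 < p.2, (v p.1 - θ * v p.2) / (v p.1 - v p.2)

/-- The Hall-Littlewood symmetrization, evaluated at the family `x`. -/
def hlSym (θ : K) {N : ℕ} (x : Fin N → K) : ((ℕ → K) → K) →ₗ[K] K where
  toFun F := ∑ s : Equiv.Perm (Fin N), hlProd θ (x ∘ s) * F (extZero (x ∘ s))
  map_add' F G := by simp [mul_add, Finset.sum_add_distrib]
  map_smul' c F := by simp [Finset.mul_sum, mul_left_comm]

/-- An adjacent transposition permutes all the other pairs `i < j` among themselves, so only the
factor at `(a, b)` changes. The cross-multiplied form avoids dividing by `v a - θ * v b`, which may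
vanish. -/
lemma hlProd_comp_swap (θ : K) {N : ℕ} {v : Fin N → K} {a b : Fin N} (hab : b.val = a.val + 1)
    (hv : v a ≠ v b) :
    hlProd θ (v ∘ Equiv.swap a b) * (v b - v a) * (v a - θ * v b) =
      hlProd θ v * (v a - v b) * (v b - θ * v a) := by
  have hlt : a < b := Fin.lt_def.2 (by omega)
  have hmem : (a, b) ∈ (Finset.univ.filter fun p : Fin N × Fin N => p.1 < p.2) := by simpa using hlt
  have hrest : ∏ p ∈ (Finset.univ.filter fun p : Fin N × Fin N => p.1 < p.2).erase (a, b),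
      ((v ∘ Equiv.swap a b) p.1 - θ * (v ∘ Equiv.swap a b) p.2) /
        ((v ∘ Equiv.swap a b) p.1 - (v ∘ Equiv.swap a b) p.2) =
      ∏ p ∈ (Finset.univ.filter fun p : Fin N × Fin N => p.1 < p.2).erase (a, b),
        (v p.1 - θ * v p.2) / (v p.1 - v p.2) := by
    refine Finset.prod_equiv (Equiv.prodCongr (Equiv.swap a b) (Equiv.swap a b)) ?_ fun p _ => rfl
    have key : ∀ i j : Fin N, i < j → ¬ (i = a ∧ j = b) →
        Equiv.swap a b i < Equiv.swap a b j ∧ ¬ (Equiv.swap a b i = a ∧ Equiv.swap a b j = b) := by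
      intro i j hij hne
      simp only [Equiv.swap_apply_def, Fin.lt_def, Fin.ext_iff] at *
      split_ifs <;> omega
    rintro ⟨i, j⟩
    simp only [Finset.mem_erase, Finset.mem_filter, Finset.mem_univ, true_and, ne_eq,
      Prod.mk.injEq, Equiv.prodCongr_apply, Prod.map_apply]
    constructor
    · rintro ⟨h1, h2⟩
      exact (key i j h2 h1).symm
    · rintro ⟨h1, h2⟩
      have := key _ _ h2 h1
      simp only [Equiv.swap_apply_self] at this
      exact this.symm
  unfold hlProd
  rw [← Finset.mul_prod_erase _ _ hmem, ← Finset.mul_prod_erase _ _ hmem, hrest]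
  have h1 : v a - v b ≠ 0 := sub_ne_zero.2 hv
  have h2 : v b - v a ≠ 0 := sub_ne_zero.2 hv.symm
  simp only [Function.comp_apply, Equiv.swap_apply_left, Equiv.swap_apply_right]
  field_simp

lemma extZero_comp_swap {N : ℕ} (v : Fin N → K) (a b : Fin N) :
    extZero (v ∘ Equiv.swap a b) = extZero v ∘ Equiv.swap a.val b.val := by
  funext i
  simp only [extZero, Function.comp_apply]
  by_cases hi : i < N
  · have h : Equiv.swap a.val b.val i = (Equiv.swap a b ⟨i, hi⟩ : Fin N).val := by
      simp only [Equiv.swap_apply_def, Fin.ext_iff]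
      split_ifs <;> rfl
    rw [h]
    simp [hi]
  · have h : Equiv.swap a.val b.val i = i :=
      Equiv.swap_apply_of_ne_of_ne (by omega) (by omega)
    rw [h]
    simp [hi]

lemma extZero_val {N : ℕ} (v : Fin N → K) (a : Fin N) : extZero v a.val = v a := by
  simp [extZero]

/-- The symmetrizer kills `X (l + 1) - θ * X l` times anything invariant under the swap: this factor
cancels the asymmetry of `hlProd`, leaving an antisymmetric summand. -/
lemma hlSym_adjacent [CharZero K] {θ : K} {N : ℕ} {x : Fin N → K} (hx : Function.Injective x)
    {l : ℕ} (hl : l + 1 < N) (H : (ℕ → K) → K) (hH : ∀ X, H (X ∘ Equiv.swap l (l + 1)) = H X) :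
    hlSym θ x (fun X => X (l + 1) * H X) = θ * hlSym θ x (fun X => X l * H X) := by
  let a : Fin N := ⟨l, by omega⟩
  let b : Fin N := ⟨l + 1, hl⟩
  have hab : a ≠ b := by simp [a, b]
  suffices h : hlSym θ x (fun X => (X (l + 1) - θ * X l) * H X) = 0 by
    have e : (fun X : ℕ → K => (X (l + 1) - θ * X l) * H X) =
        (fun X => X (l + 1) * H X) - θ • fun X => X l * H X := by
      funext X
      simp only [Pi.sub_apply, Pi.smul_apply, smul_eq_mul]
      ring
    rw [e, map_sub, map_smul, smul_eq_mul, sub_eq_zero] at h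
    exact h
  -- Reindexing the sum by the adjacent transposition negates every summand.
  have h2 : hlSym θ x (fun X => (X (l + 1) - θ * X l) * H X) =
      - hlSym θ x (fun X => (X (l + 1) - θ * X l) * H X) := by
    conv_lhs => rw [hlSym, LinearMap.coe_mk, AddHom.coe_mk,
      ← Equiv.sum_comp (Equiv.mulRight (Equiv.swap a b))]
    rw [hlSym, LinearMap.coe_mk, AddHom.coe_mk, ← Finset.sum_neg_distrib]
    refine Finset.sum_congr rfl fun s _ => ?_
    have e1 : x ∘ ⇑(Equiv.mulRight (Equiv.swap a b) s) = (x ∘ s) ∘ Equiv.swap a b := rfl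
    rw [e1, extZero_comp_swap]
    beta_reduce
    have hH' : H (extZero (x ∘ s) ∘ Equiv.swap a.val b.val) = H (extZero (x ∘ s)) := hH _
    rw [hH']
    have h3 := extZero_val (x ∘ s) a
    have h4 := extZero_val (x ∘ s) b
    have h5 : (extZero (x ∘ s) ∘ Equiv.swap a.val b.val) (l + 1) = (x ∘ s) a := by
      rw [← h3]
      exact congrArg _ (Equiv.swap_apply_right _ _)
    have h6 : (extZero (x ∘ s) ∘ Equiv.swap a.val b.val) l = (x ∘ s) b := by
      rw [← h4]
      exact congrArg _ (Equiv.swap_apply_left _ _)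
    rw [h5, h6, show extZero (x ∘ s) (l + 1) = (x ∘ s) b from h4,
      show extZero (x ∘ s) l = (x ∘ s) a from h3]
    have hne : (x ∘ s) a ≠ (x ∘ s) b := fun e => hab (s.injective (hx e))
    have h7 := hlProd_comp_swap θ (v := x ∘ s) (a := a) (b := b) rfl hne
    have h8 : (x ∘ s) a - (x ∘ s) b ≠ 0 := sub_ne_zero.2 hne
    refine mul_left_cancel₀ h8 ?_
    linear_combination (-H (extZero (x ∘ s))) * h7
  exact self_eq_neg.1 h2

variable {N : ℕ} {x : Fin N → K} {Q : K} {B : ℕ → ℕ → K} {t y : K}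

/-! ### Collapsing the alternating sum over a block. -/

/-- Invariance under the adjacent transpositions of the block of length `j` starting at `s`. -/
def BlockInvariant (s j : ℕ) (R : (ℕ → K) → K) : Prop :=
  ∀ l, s ≤ l → l + 1 < s + j → ∀ X, R (X ∘ Equiv.swap l (l + 1)) = R X

/-- Both products run over a block of `j + 1` positions with one omitted. Moving the hole from the
first position to the last takes `j` adjacent steps, each costing one factor `θ`. -/
lemma hlSym_hole [CharZero K] {θ : K} (hx : Function.Injective x) {s j : ℕ} (hs : s + j + 1 ≤ N)
    {R : (ℕ → K) → K} (hR : BlockInvariant s (j + 1) R) :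
    hlSym θ x (fun X => (∏ i ∈ Finset.range j, X (s + 1 + i)) * R X) =
      θ ^ j * hlSym θ x (fun X => (∏ i ∈ Finset.range j, X (s + i)) * R X) := by
  -- Here the hole has reached position `s + h`.
  have key : ∀ h ≤ j, hlSym θ x (fun X => (∏ i ∈ Finset.range j, X (s + 1 + i)) * R X) =
      θ ^ h * hlSym θ x (fun X =>
        (∏ i ∈ Finset.range j, if i < h then X (s + i) else X (s + 1 + i)) * R X) := by
    intro h
    induction h with
    | zero => intro _; simp
    | succ h ih =>
      intro hh
      rw [ih (by omega), pow_succ, mul_assoc]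
      congr 1
      have hm : h ∈ Finset.range j := Finset.mem_range.2 (by omega)
      have e1 : (fun X : ℕ → K =>
          (∏ i ∈ Finset.range j, if i < h then X (s + i) else X (s + 1 + i)) * R X) =
          fun X => X (s + h + 1) * ((∏ i ∈ (Finset.range j).erase h,
            if i < h then X (s + i) else X (s + 1 + i)) * R X) := by
        funext X
        rw [← Finset.mul_prod_erase _ _ hm, if_neg (lt_irrefl h), mul_assoc, add_right_comm]
      have e2 : (fun X : ℕ → K =>
          (∏ i ∈ Finset.range j, if i < h + 1 then X (s + i) else X (s + 1 + i)) * R X) =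
          fun X => X (s + h) * ((∏ i ∈ (Finset.range j).erase h,
            if i < h then X (s + i) else X (s + 1 + i)) * R X) := by
        funext X
        rw [← Finset.mul_prod_erase _ _ hm, if_pos (Nat.lt_succ_self h), mul_assoc]
        congr 2
        refine Finset.prod_congr rfl fun i hi => ?_
        have : i ≠ h := (Finset.mem_erase.1 hi).1
        have : i < h + 1 ↔ i < h := by omega
        simp only [this]
      rw [e1, e2]
      refine hlSym_adjacent hx (by omega) _ fun X => ?_
      rw [hR (s + h) (by omega) (by omega)]
      congr 1
      refine Finset.prod_congr rfl fun i hi => ?_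
      have : i ≠ h := (Finset.mem_erase.1 hi).1
      simp only [Function.comp_apply]
      split_ifs
      · rw [Equiv.swap_apply_of_ne_of_ne (by omega) (by omega)]
      · rw [Equiv.swap_apply_of_ne_of_ne (by omega) (by omega)]
  rw [key j le_rfl]
  congr 2
  funext X
  congr 1
  exact Finset.prod_congr rfl fun i hi => by rw [if_pos (Finset.mem_range.1 hi)]

/-- The alternating sum of products over a block. -/
def serreSum (B : ℕ → ℕ → K) (t y : K) (s j : ℕ) (c : K) (X : ℕ → K) : K :=
  ∑ p ∈ Finset.range (j + 1), (-c) ^ p * B j p *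
    ∏ i ∈ Finset.range j, if i < p then X (s + i) - t * y else t * X (s + i) - y

/-- Pascal's rule for the Gaussian binomial coefficients. -/
structure IsQBinom (Q : K) (B : ℕ → ℕ → K) : Prop where
  zero_right : ∀ n, B n 0 = 1
  zero_left : ∀ p, B 0 (p + 1) = 0
  succ_succ : ∀ n p, B (n + 1) (p + 1) = Q ^ (p + 1) * B n (p + 1) + (Q⁻¹) ^ (n - p) * B n p

lemma IsQBinom.eq_zero (hB : IsQBinom Q B) {n p : ℕ} (h : n < p) : B n p = 0 := by
  induction n generalizing p with
  | zero =>
    obtain ⟨p, rfl⟩ := Nat.exists_eq_succ_of_ne_zero h.ne'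
    exact hB.zero_left p
  | succ n ih =>
    obtain ⟨p, rfl⟩ : ∃ p', p = p' + 1 := ⟨p - 1, by omega⟩
    rw [hB.succ_succ, ih (by omega), ih (by omega)]
    simp

/-- The two terms of Pascal's rule peel off opposite ends of the block: the first leaves the last
position of the second kind, the other leaves the first position of the first kind. The powers of
`Q` are absorbed by replacing `c` with `c * Q`, which is why `serreSum` carries the parameter `c`.
-/
lemma serreSum_succ (hQ : Q ≠ 0) (hB : IsQBinom Q B) (s j : ℕ) (c : K) (X : ℕ → K) :
    serreSum B t y s (j + 1) c X =
      serreSum B t y s j (c * Q) X * (t * X (s + j) - y) -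
        c * (Q⁻¹) ^ j * ((X s - t * y) * serreSum B t y (s + 1) j (c * Q) X) := by
  let P : ℕ → ℕ → ℕ → K := fun s j p =>
    ∏ i ∈ Finset.range j, if i < p then X (s + i) - t * y else t * X (s + i) - y
  have hP1 : ∀ p ≤ j, P s (j + 1) p = P s j p * (t * X (s + j) - y) := fun p hp => by
    simp only [P, Finset.prod_range_succ]
    rw [if_neg (by omega)]
  have hP2 : ∀ p, P s (j + 1) (p + 1) = (X s - t * y) * P (s + 1) j p := fun p => by
    simp only [P, Finset.prod_range_succ' _ j]
    rw [if_pos (by omega), mul_comm, add_zero]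
    congr 1
    refine Finset.prod_congr rfl fun i _ => ?_
    rw [show s + (i + 1) = s + 1 + i by ring]
    simp only [Nat.add_lt_add_iff_right]
  have h1 : serreSum B t y s (j + 1) c X =
      (∑ p ∈ Finset.range (j + 2), (-(c * Q)) ^ p * B j p * P s (j + 1) p) +
      ∑ p ∈ Finset.range (j + 1), (-c) ^ (p + 1) * ((Q⁻¹) ^ (j - p) * B j p) *
        P s (j + 1) (p + 1) := by
    unfold serreSum
    rw [Finset.sum_range_succ', Finset.sum_range_succ' _ (j + 1), add_right_comm,
      ← Finset.sum_add_distrib]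
    congr 1
    · refine Finset.sum_congr rfl fun p _ => ?_
      rw [hB.succ_succ, neg_mul_eq_neg_mul, mul_pow]
      simp only [P]
      ring
    · rw [hB.zero_right, hB.zero_right]
      simp [P]
  rw [h1, Finset.sum_range_succ, hB.eq_zero (Nat.lt_succ_self j), mul_zero, zero_mul, add_zero,
    sub_eq_add_neg]
  unfold serreSum
  rw [Finset.sum_mul, Finset.mul_sum, Finset.mul_sum, ← Finset.sum_neg_distrib]
  congr 1
  · refine Finset.sum_congr rfl fun p hp => ?_
    rw [hP1 p (by simpa [Nat.lt_succ_iff] using hp)]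
    simp only [P]
    ring
  · refine Finset.sum_congr rfl fun p hp => ?_
    have hp' : p ≤ j := by simpa [Nat.lt_succ_iff] using hp
    obtain ⟨i, rfl⟩ := Nat.exists_eq_add_of_le hp'
    rw [hP2, Nat.add_sub_cancel_left]
    simp only [P]
    -- With `j = p + i`, this moves the dependence on `p` into the `p`-th power of `c * Q`.
    have : (Q⁻¹) ^ i = (Q⁻¹) ^ (p + i) * Q ^ p := by
      rw [pow_add, mul_right_comm, ← mul_pow, inv_mul_cancel₀ hQ, one_pow, one_mul]
    rw [this, neg_mul_eq_neg_mul c Q, mul_pow]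
    ring

/-- By induction both shorter blocks become pure products, and moving the hole makes them
comparable. The choice `t = Q ^ (-n)` cancels the terms in `y`, while the others contribute the new
factor `t - Q ^ (n - 2 * j)`. The function `R` carries the factors peeled off the block. -/
lemma hlSym_serreSum [CharZero K] (hx : Function.Injective x) (hQ : Q ≠ 0) (hB : IsQBinom Q B) (n : ℤ)
    (ht : t = Q ^ (-n)) (j : ℕ) : ∀ s, s + j ≤ N → ∀ R, BlockInvariant s j R →
    hlSym (Q ^ 2) x (fun X => serreSum B t y s j (Q ^ (n + 1 - j)) X * R X) =
      (∏ i ∈ Finset.range j, (t - Q ^ (n - 2 * i))) *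
        hlSym (Q ^ 2) x (fun X => (∏ i ∈ Finset.range j, X (s + i)) * R X) := by
  induction j with
  | zero =>
    intro s _ R _
    simp [serreSum, hB.zero_right]
  | succ j ih =>
    intro s hs R hR
    have hc : Q ^ (n + 1 - (j + 1 : ℕ)) * Q = Q ^ (n + 1 - j) := by
      rw [← zpow_add_one₀ hQ]
      congr 1
      push_cast
      ring
    have hc' : Q ^ (n + 1 - (j + 1 : ℕ)) * (Q⁻¹) ^ j = Q ^ (n - 2 * j) := by
      rw [inv_pow, ← zpow_natCast, ← zpow_neg, ← zpow_add₀ hQ]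
      congr 1
      push_cast
      ring
    have e1 : (fun X : ℕ → K => serreSum B t y s (j + 1) (Q ^ (n + 1 - (j + 1 : ℕ))) X * R X) =
        (fun X => serreSum B t y s j (Q ^ (n + 1 - j)) X * ((t * X (s + j) - y) * R X)) -
        Q ^ (n - 2 * j) • fun X => serreSum B t y (s + 1) j (Q ^ (n + 1 - j)) X *
          ((X s - t * y) * R X) := by
      funext X
      rw [serreSum_succ hQ hB, hc, hc']
      simp only [Pi.sub_apply, Pi.smul_apply, smul_eq_mul]
      ring
    have hR1 : BlockInvariant s j fun X => (t * X (s + j) - y) * R X := fun l h1 h2 X => by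
      beta_reduce
      rw [hR l h1 (by omega), Function.comp_apply,
        Equiv.swap_apply_of_ne_of_ne (by omega) (by omega)]
    have hR2 : BlockInvariant (s + 1) j fun X => (X s - t * y) * R X := fun l h1 h2 X => by
      beta_reduce
      rw [hR l (by omega) (by omega), Function.comp_apply,
        Equiv.swap_apply_of_ne_of_ne (by omega) (by omega)]
    rw [e1, map_sub, map_smul, ih s (by omega) _ hR1, ih (s + 1) (by omega) _ hR2]
    have e2 : (fun X : ℕ → K => (∏ i ∈ Finset.range j, X (s + i)) * ((t * X (s + j) - y) * R X)) =
        t • (fun X => (∏ i ∈ Finset.range (j + 1), X (s + i)) * R X) -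
          y • fun X => (∏ i ∈ Finset.range j, X (s + i)) * R X := by
      funext X
      simp only [Pi.sub_apply, Pi.smul_apply, smul_eq_mul, Finset.prod_range_succ]
      ring
    have e3 : (fun X : ℕ → K => (∏ i ∈ Finset.range j, X (s + 1 + i)) * ((X s - t * y) * R X)) =
        (fun X => (∏ i ∈ Finset.range (j + 1), X (s + i)) * R X) -
          (t * y) • fun X => (∏ i ∈ Finset.range j, X (s + 1 + i)) * R X := by
      funext X
      simp only [Pi.sub_apply, Pi.smul_apply, smul_eq_mul, Finset.prod_range_succ' _ j, add_zero]
      rw [Finset.prod_congr rfl fun i _ => by rw [show s + 1 + i = s + (i + 1) by ring]]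
      ring
    rw [e2, e3, map_sub, map_sub, map_smul, map_smul, map_smul,
      hlSym_hole hx (by omega) hR, Finset.prod_range_succ]
    -- This is exactly the cancellation of the two terms in `y`; the power of `Q ^ 2` comes from
    -- moving the hole.
    have hz : Q ^ (n - 2 * j) * (t * (Q ^ 2) ^ j) = 1 := by
      rw [ht, ← pow_mul, ← zpow_natCast, ← zpow_add₀ hQ, ← zpow_add₀ hQ]
      convert zpow_zero Q using 2
      push_cast
      ring
    simp only [smul_eq_mul]
    linear_combination (y * (∏ i ∈ Finset.range j, (t - Q ^ (n - 2 * i))) *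
      hlSym (Q ^ 2) x fun X => (∏ i ∈ Finset.range j, X (s + i)) * R X) * hz

/-- The quantum Serre identity. -/
theorem sum_hlProd_serre [CharZero K] (hx : Function.Injective x) (hQ : Q ≠ 0) (hB : IsQBinom Q B)
    (hN : 0 < N) (ht : t = Q ^ (1 - N : ℤ)) :
    ∑ s : Equiv.Perm (Fin N), hlProd (Q ^ 2) (x ∘ s) *
      ∑ p ∈ Finset.range (N + 1), (-1) ^ p * B N p *
        ∏ i : Fin N, (if i.val < p then x (s i) - t * y else t * x (s i) - y) = 0 := by
  -- With `n = N - 1` and a block of full length `N`, the parameter `c` equals `Q ^ 0 = 1`.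
  have h := hlSym_serreSum (t := t) (y := y) hx hQ hB (N - 1) (by rw [ht]; congr 1; ring) N 0 (by omega)
    (fun _ => 1) fun _ _ _ _ => rfl
  -- The last factor, `i = N - 1`, is `t - Q ^ (1 - N)`.
  have h0 : ∏ i ∈ Finset.range N, (t - Q ^ ((N : ℤ) - 1 - 2 * i)) = 0 := by
    refine Finset.prod_eq_zero (i := N - 1) (Finset.mem_range.2 (by omega)) ?_
    rw [ht, sub_eq_zero]
    congr 1
    push_cast [Nat.cast_sub hN]
    ring
  rw [h0, zero_mul] at h
  rw [← h]
  refine Finset.sum_congr rfl fun s _ => ?_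
  congr 1
  simp only [serreSum, mul_one]
  refine Finset.sum_congr rfl fun p _ => ?_
  rw [show (N : ℤ) - 1 + 1 - N = 0 by ring, zpow_zero, Finset.prod_range]
  congr 1
  refine Finset.prod_congr rfl fun i _ => ?_
  rw [zero_add, extZero_val]
  rfl

end SerreIdentity

/-! ### Products of generators -/

section Words

variable {n m k : Fin r → ℕ} {Q : Fin r → Fin r → ℂ}
variable {X Y : Type} [Fintype X] [Fintype Y]

/-- The summand of a product of generators. -/
def wordTerm (Q : Fin r → Fin r → ℂ) (lt : X → X → Prop) {c : X → Fin r} (e : X → ℤ)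
    (σ : ColorEquiv c (color k)) : RatFn k :=
  (∏ x, ∏ x', if lt x x' then weight Q (σ.1 x) (σ.1 x') else 1) * ∏ x, zv (σ.1 x) ^ e x

/-- The product of generators of colors `c` and modes `e`, in the order `lt`, with the fixed factors
removed. -/
def wordSum (Q : Fin r → Fin r → ℂ) (lt : X → X → Prop) (c : X → Fin r) (e : X → ℤ) :
    ∀ n : Fin r → ℕ, RatFn n :=
  fun _ => ∑ σ : ColorEquiv c (color _), wordTerm Q lt e σ

lemma wordSum_reindex (φ : X ≃ Y) {lt : X → X → Prop} {lt' : Y → Y → Prop} {c : X → Fin r}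
    {c' : Y → Fin r} {e : X → ℤ} {e' : Y → ℤ} (hlt : ∀ x x', lt x x' ↔ lt' (φ x) (φ x'))
    (hc : ∀ x, c' (φ x) = c x) (he : ∀ x, e' (φ x) = e x) :
    wordSum Q lt c e = wordSum Q lt' c' e' := by
  funext k
  unfold wordSum
  rw [← sum_trans (⟨φ, hc⟩ : ColorEquiv c c')]
  refine Finset.sum_congr rfl fun σ _ => ?_
  unfold wordTerm
  simp only [← φ.prod_comp, coe_trans, Equiv.trans_apply, hlt, he]

lemma permute_wordTerm {lt : X → X → Prop} {c : X → Fin r} {e : X → ℤ}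
    (σ : ColorEquiv c (color n)) (φ : Vars n → Vars k) (hφ : Function.Injective φ)
    (hc : ∀ v, (φ v).1 = v.1) :
    subst φ hφ (wordTerm Q lt e σ) =
      (∏ x, ∏ x', if lt x x' then weight Q (φ (σ.1 x)) (φ (σ.1 x')) else 1) *
        ∏ x, zv (φ (σ.1 x)) ^ e x := by
  unfold wordTerm
  rw [map_mul, map_prod, map_prod]
  congr 1
  · refine Finset.prod_congr rfl fun x _ => ?_
    rw [map_prod]
    refine Finset.prod_congr rfl fun x' _ => ?_
    split_ifs
    · exact subst_weight Q φ hφ hc _ _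
    · exact map_one _
  · exact Finset.prod_congr rfl fun x _ => by rw [map_zpow₀, subst_zv]

lemma isSym_wordSum (lt : X → X → Prop) (c : X → Fin r) (e : X → ℤ) (k : Fin r → ℕ) :
    IsSym (wordSum Q lt c e k) := fun τ => by
  unfold wordSum
  rw [map_sum]
  refine Eq.trans (Finset.sum_congr rfl fun σ _ => ?_) ((postEquiv c τ).sum_comp (wordTerm Q lt e))
  exact permute_wordTerm σ _ _ τ.2

/-- The numbers of elements of each color. -/
def degree (c : X → Fin r) : Fin r → ℕ := fun α => Fintype.card {x // c x = α}

/-- A finite colored type is equivalent to the variables of its degree. -/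
def degreeEquiv (c : X → Fin r) : ColorEquiv c (color (degree c)) :=
  ⟨(Equiv.sigmaFiberEquiv c).symm.trans (Equiv.sigmaCongrRight fun _ => Fintype.equivFin _),
    fun _ => rfl⟩

lemma eq_of_colorEquiv (σ : ColorEquiv (color n) (color m)) : n = m := by
  funext α
  have e : Fin (n α) ≃ Fin (m α) := (Equiv.sigmaSubtype α).symm.trans
    ((σ.1.subtypeEquiv fun v => by rw [show (σ.1 v).1 = v.1 from σ.2 v]).trans (Equiv.sigmaSubtype α))
  simpa using Fintype.card_congr e

lemma eq_degree {c : X → Fin r} (σ : ColorEquiv c (color n)) : n = degree c :=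
  eq_of_colorEquiv (σ.symm.trans (degreeEquiv c))

lemma wordSum_eq_zero {lt : X → X → Prop} {c : X → Fin r} {e : X → ℤ} (h : n ≠ degree c) :
    wordSum Q lt c e n = 0 :=
  Finset.sum_eq_zero fun σ _ => absurd (eq_degree σ) h

lemma starTerm_wordTerm {lt : X → X → Prop} {lt' : Y → Y → Prop} {c : X → Fin r} {c' : Y → Fin r}
    {e : X → ℤ} {e' : Y → ℤ} (τ : ColorEquiv c (color n)) (τ' : ColorEquiv c' (color m))
    (σ : ColorEquiv (color₂ n m) (color k)) :
    starTerm Q (wordTerm Q lt e τ) (wordTerm Q lt' e' τ') σ =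
      wordTerm Q (Sum.Lex lt lt') (Sum.elim e e') ((τ.sumCongr τ').trans σ) := by
  unfold starTerm
  rw [permute_wordTerm τ _ _ fun v => σ.2 (Sum.inl v),
    permute_wordTerm τ' _ _ fun v => σ.2 (Sum.inr v), wordTerm, Fintype.prod_prod_type,
    ← τ.1.prod_comp]
  simp only [← τ'.1.prod_comp, Fintype.prod_sum_type, Sum.lex_inl_inl, Sum.lex_inr_inr,
    Sum.lex_inr_inl, Sum.Lex.sep, if_true, if_false, Finset.prod_mul_distrib, Sum.elim_inl,
    Sum.elim_inr, coe_trans, coe_sumCongr, Equiv.trans_apply, Equiv.sumCongr_apply, Sum.map_inl,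
    Sum.map_inr, Finset.prod_const_one]
  ring

/-- For fixed `τ` and `τ'`, the outer bijections already give every bijection of the concatenated
word once; the number of pairs `(τ, τ')` cancels the normalization of `star`. -/
lemma star_wordSum {lt : X → X → Prop} {lt' : Y → Y → Prop} {c : X → Fin r} {c' : Y → Fin r}
    {e : X → ℤ} {e' : Y → ℤ} (hn : n = degree c) (hm : m = degree c') :
    star Q k (wordSum Q lt c e n) (wordSum Q lt' c' e' m) =
      wordSum Q (Sum.Lex lt lt') (Sum.elim c c') (Sum.elim e e') k := by
  subst hn hm
  have h1 : ∀ (σ : ColorEquiv (color₂ (degree c) (degree c')) (color k)),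
      starTerm Q (wordSum Q lt c e _) (wordSum Q lt' c' e' _) σ =
        ∑ τ, ∑ τ', wordTerm Q (Sum.Lex lt lt') (Sum.elim e e')
          ((ColorEquiv.sumCongr τ τ').trans σ) := fun σ => by
    simp only [← starTerm_wordTerm]
    simp only [starTerm, wordSum, map_sum, Finset.mul_sum, Finset.sum_mul]
    rw [Finset.sum_comm]
  unfold star
  simp only [h1]
  rw [Finset.sum_comm]
  simp only [Finset.sum_comm (s := (Finset.univ : Finset (ColorEquiv (color₂ _ _) _)))
    (t := (Finset.univ : Finset (ColorEquiv c' _))), sum_trans, Finset.sum_const, Finset.card_univ]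
  rw [← Nat.cast_smul_eq_nsmul ℂ, ← Nat.cast_smul_eq_nsmul ℂ, card_colorEquiv (degreeEquiv c),
    card_colorEquiv (degreeEquiv c'), smul_smul, smul_smul, mul_assoc, inv_mul_cancel₀, one_smul]
  · rfl
  · exact mul_ne_zero (autCard_ne_zero _) (autCard_ne_zero _)

/-- Words multiply by concatenation, whence the lexicographic order; only one splitting of the
degree contributes. -/
lemma starMul_wordSum {lt : X → X → Prop} {lt' : Y → Y → Prop} {c : X → Fin r} {c' : Y → Fin r}
    {e : X → ℤ} {e' : Y → ℤ} :
    starMul Q (wordSum Q lt c e) (wordSum Q lt' c' e') =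
      wordSum Q (Sum.Lex lt lt') (Sum.elim c c') (Sum.elim e e') := by
  have hdeg : degree (Sum.elim c c') = degree c + degree c' :=
    (eq_degree (((degreeEquiv c).sumCongr (degreeEquiv c')).trans (addEquiv _ _))).symm
  funext k
  unfold starMul
  by_cases hk : k = degree c + degree c'
  · rw [Finset.sum_eq_single (degree c)]
    · exact star_wordSum rfl (by rw [hk, add_tsub_cancel_left])
    · intro n _ hn
      rw [wordSum_eq_zero hn, star_zero_left]
    · intro h
      exact absurd (Finset.mem_Iic.2 (hk ▸ le_self_add)) h
  · rw [wordSum_eq_zero (by rwa [hdeg])]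
    refine Finset.sum_eq_zero fun n hn => ?_
    by_cases h1 : n = degree c
    · by_cases h2 : k - n = degree c'
      · refine absurd ?_ hk
        rw [← h1, ← h2, add_tsub_cancel_of_le (Finset.mem_Iic.1 hn)]
      · rw [wordSum_eq_zero h2, star_zero_right]
    · rw [wordSum_eq_zero h1, star_zero_left]

end Words

/-! ### Generators -/

section Generators

variable {q : ℂ} {d : Fin r → ℕ} {a : Matrix (Fin r) (Fin r) ℤ} {Q : Fin r → Fin r → ℂ}

/-- A single generator, with the fixed factor removed. -/
abbrev genFam (Q : Fin r → Fin r → ℂ) (α : Fin r) (e : ℤ) : ∀ n : Fin r → ℕ, RatFn n :=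
  wordSum Q (fun _ _ : Unit => False) (fun _ => α) fun _ => e

lemma vars_single_eq {α : Fin r} (v : Vars (Pi.single α 1 : Fin r → ℕ)) :
    v = ⟨α, ⟨0, by simp⟩⟩ := by
  obtain ⟨β, i⟩ := v
  by_cases h : β = α
  · subst h
    have : (Pi.single β 1 : Fin r → ℕ) β = 1 := Pi.single_eq_same _ _
    exact congrArg (Sigma.mk β) (Fin.ext (by have := i.2; simp only; omega))
  · have : (Pi.single α 1 : Fin r → ℕ) β = 0 := Pi.single_eq_of_ne h _
    exact absurd i.2 (by omega)

/-- The only variable of degree `δ_α`. -/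
def singleEquiv (α : Fin r) :
    ColorEquiv (fun _ : Unit => α) (color (Pi.single α 1 : Fin r → ℕ)) :=
  ⟨⟨fun _ => ⟨α, ⟨0, by simp⟩⟩, fun _ => (), fun _ => rfl, fun v => (vars_single_eq v).symm⟩,
    fun _ => rfl⟩

lemma canMul_genFam (α : Fin r) (e : ℤ) : canMul q d a (genFam Q α e) = shGen α e := by
  funext n
  unfold canMul shGen
  by_cases h : n = Pi.single α 1
  · subst h
    rw [Pi.single_eq_same, canFactor_eq, Finset.prod_eq_one, one_mul]
    · have : ∀ σ : ColorEquiv (fun _ : Unit => α) (color (Pi.single α 1 : Fin r → ℕ)),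
          σ = singleEquiv α := fun σ => Subtype.ext (Equiv.ext fun _ =>
            (vars_single_eq _).trans (vars_single_eq _).symm)
      unfold genFam wordSum
      rw [Fintype.sum_eq_single (singleEquiv α) fun σ hσ => absurd (this σ) hσ]
      simp [wordTerm, singleEquiv]
    · rintro ⟨u, v⟩ huv
      exact absurd ((vars_single_eq u).trans (vars_single_eq v).symm) (Finset.mem_filter.1 huv).2.ne
  · unfold genFam
    rw [Pi.single_eq_of_ne h, wordSum_eq_zero, mul_zero]
    rwa [← eq_degree (singleEquiv α)]

lemma shGen_mem_shBar (α : Fin r) (e : ℤ) : shGen α e ∈ ShBar q d a := by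
  refine ⟨(Set.finite_singleton (Pi.single α 1)).subset fun n hn => ?_, fun n => ?_⟩
  · by_contra h
    exact hn (by simp only [shGen]; rw [Pi.single_eq_of_ne h])
  · rw [← canMul_genFam (q := q) (d := d) (a := a) (Q := fun _ _ => 1)]
    refine mem_shBarDeg.2 ⟨_, sum_mem fun σ _ => ?_, isSym_wordSum _ _ _ n, rfl⟩
    simpa [wordTerm] using zv_zpow_mem_laurentAlg _ e

variable (hQ : ∀ α β, qPair q d a α β = qPair q d a β α)

/-- The generator of `Sh̄` of color `α` and mode `e`. -/
def shAlgGen (α : Fin r) (e : ℤ) : ShAlg q d a hQ := ⟨shGen α e, shGen_mem_shBar α e⟩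

lemma val_shAlgGen (α : Fin r) (e : ℤ) :
    ShAlg.val hQ (shAlgGen hQ α e) = canMul q d a (genFam (qPair q d a) α e) :=
  (canMul_genFam α e).symm

lemma val_shAlgGen_mul (α β : Fin r) (e e' : ℤ) :
    ShAlg.val hQ (shAlgGen hQ α e * shAlgGen hQ β e') = canMul q d a (wordSum (qPair q d a)
      (Sum.Lex (fun _ _ : Unit => False) (fun _ _ : Unit => False))
      (Sum.elim (fun _ => α) fun _ => β) (Sum.elim (fun _ => e) fun _ => e')) := by
  rw [ShAlg.val_mul, val_shAlgGen, val_shAlgGen,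
    shMul_canMul hQ (isSym_wordSum _ _ _) (isSym_wordSum _ _ _), starMul_wordSum]

lemma val_prod_ofFn {N : ℕ} (c : Fin N → Fin r) (e : Fin N → ℤ) :
    ShAlg.val hQ (List.ofFn fun i => shAlgGen hQ (c i) (e i)).prod =
      canMul q d a (wordSum (qPair q d a) (fun i j : Fin N => i < j) c e) := by
  induction N with
  | zero =>
    rw [List.ofFn_zero, List.prod_nil, ShAlg.val_one, ← canMul_oneFam (q := q) (d := d) (a := a)]
    congr 1
    funext k
    have hσ : ∀ σ : ColorEquiv c (color (0 : Fin r → ℕ)), σ = ⟨Equiv.equivOfIsEmpty _ _, fun i => i.elim0⟩ :=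
      fun σ => Subtype.ext (Equiv.ext fun i => i.elim0)
    by_cases hk : k = 0
    · subst hk
      unfold wordSum oneFam
      rw [Fintype.sum_eq_single _ fun σ h => absurd (hσ σ) h]
      simp [wordTerm]
    · rw [oneFam, Pi.single_eq_of_ne hk]
      refine (wordSum_eq_zero fun h => hk (h.trans ?_)).symm
      exact (eq_degree (⟨Equiv.equivOfIsEmpty _ _, fun i => i.elim0⟩ :
        ColorEquiv c (color (0 : Fin r → ℕ)))).symm
  | succ N ih =>
    rw [List.ofFn_succ, List.prod_cons, ShAlg.val_mul, val_shAlgGen, ih,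
      shMul_canMul hQ (isSym_wordSum _ _ _) (isSym_wordSum _ _ _), starMul_wordSum]
    congr 1
    refine wordSum_reindex
      ⟨Sum.elim (fun _ => 0) Fin.succ, Fin.cases (Sum.inl ()) Sum.inr, ?_, ?_⟩ ?_ ?_ ?_
    · rintro (_ | i) <;> simp
    · intro i
      refine Fin.cases ?_ (fun i => ?_) i <;> simp
    · rintro (_ | i) (_ | j) <;> simp
    · rintro (_ | i) <;> rfl
    · rintro (_ | i) <;> rfl

end Generators

/-! ### The vertex relations -/

section Vertex

variable {q : ℂ} {d : Fin r → ℕ} {a : Matrix (Fin r) (Fin r) ℤ}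
  (hQ : ∀ α β, qPair q d a α β = qPair q d a β α)

/-- The vertex relation for a single pair of variables: exchanging the arguments of a weight
exchanges the two linear forms of the relation, up to a denominator or sign that matches on both
sides. -/
lemma weight_vertex {k : Fin r → ℕ} {Q : Fin r → Fin r → ℂ} (hs : ∀ α β, Q α β = Q β α)
    {u v : Vars k} (h : u ≠ v) :
    weight Q u v * (Q u.1 v.1 • zv u - zv v) = weight Q v u * (zv u - Q u.1 v.1 • zv v) := by
  have h1 := zv_sub_ne_zero h
  have h2 := zv_sub_ne_zero h.symm
  unfold weight
  by_cases hc : u.1 = v.1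
  · simp only [hc, if_true]
    field_simp
    ring
  · rw [hs v.1 u.1]
    simp only [hc, Ne.symm hc, if_false]
    rcases lt_or_gt_of_ne hc with h3 | h3
    · simp only [h3, h3.not_gt, if_true, if_false]
      ring
    · simp only [h3, h3.not_gt, if_true, if_false]
      ring

lemma wordSum_pair {Q : Fin r → Fin r → ℂ} (α β : Fin r) (e e' : ℤ) (k : Fin r → ℕ) :
    wordSum Q (Sum.Lex (fun _ _ : Unit => False) (fun _ _ : Unit => False))
      (Sum.elim (fun _ => α) fun _ => β) (Sum.elim (fun _ => e) fun _ => e') k =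
    ∑ σ : ColorEquiv (Sum.elim (fun _ : Unit => α) fun _ : Unit => β) (color k),
      weight Q (σ.1 (Sum.inl ())) (σ.1 (Sum.inr ())) *
        (zv (σ.1 (Sum.inl ())) ^ e * zv (σ.1 (Sum.inr ())) ^ e') := by
  refine Finset.sum_congr rfl fun σ _ => ?_
  simp [wordTerm]

lemma wordSum_pair_swap {Q : Fin r → Fin r → ℂ} (α β : Fin r) (e e' : ℤ) (k : Fin r → ℕ) :
    wordSum Q (Sum.Lex (fun _ _ : Unit => False) (fun _ _ : Unit => False))
      (Sum.elim (fun _ => β) fun _ => α) (Sum.elim (fun _ => e') fun _ => e) k =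
    ∑ σ : ColorEquiv (Sum.elim (fun _ : Unit => α) fun _ : Unit => β) (color k),
      weight Q (σ.1 (Sum.inr ())) (σ.1 (Sum.inl ())) *
        (zv (σ.1 (Sum.inl ())) ^ e * zv (σ.1 (Sum.inr ())) ^ e') := by
  rw [wordSum_pair, ← sum_trans (⟨Equiv.sumComm Unit Unit, by rintro (_ | _) <;> rfl⟩ :
    ColorEquiv (Sum.elim (fun _ : Unit => β) fun _ : Unit => α)
      (Sum.elim (fun _ : Unit => α) fun _ : Unit => β))]
  refine Finset.sum_congr rfl fun σ _ => ?_
  simp only [coe_trans, Equiv.trans_apply, Equiv.sumComm_apply, Sum.swap_inl, Sum.swap_inr]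
  ring

lemma shAlgGen_vertex (α β : Fin r) (k l : ℤ) :
    qPair q d a α β • (shAlgGen hQ α (k + 1) * shAlgGen hQ β l) -
        shAlgGen hQ α k * shAlgGen hQ β (l + 1) =
      shAlgGen hQ β l * shAlgGen hQ α (k + 1) -
        qPair q d a α β • (shAlgGen hQ β (l + 1) * shAlgGen hQ α k) := by
  refine ShAlg.val_injective hQ ?_
  simp only [map_sub, map_smul, val_shAlgGen_mul]
  funext n
  simp only [Pi.sub_apply, Pi.smul_apply, canMul, wordSum_pair α β, wordSum_pair_swap α β]
  rw [← mul_smul_comm, ← mul_smul_comm, ← mul_sub, ← mul_sub, Finset.smul_sum, Finset.smul_sum,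
    ← Finset.sum_sub_distrib, ← Finset.sum_sub_distrib]
  congr 1
  refine Finset.sum_congr rfl fun σ _ => ?_
  have hne : σ.1 (Sum.inl ()) ≠ σ.1 (Sum.inr ()) := fun e => by simpa using σ.1.injective e
  have h := weight_vertex (Q := qPair q d a) hQ hne
  have h1 : (σ.1 (Sum.inl ())).1 = α := σ.2 (Sum.inl ())
  have h2 : (σ.1 (Sum.inr ())).1 = β := σ.2 (Sum.inr ())
  rw [h1, h2] at h
  rw [zpow_add_one₀ (zv_ne_zero _), zpow_add_one₀ (zv_ne_zero _)]
  simp only [Algebra.smul_def] at h ⊢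
  linear_combination (zv (σ.1 (Sum.inl ())) ^ k * zv (σ.1 (Sum.inr ())) ^ l) * h

end Vertex

/-! ### The quantum Serre relations -/

section Serre

variable {q : ℂ} {d : Fin r → ℕ} {a : Matrix (Fin r) (Fin r) ℤ}
  (hQ : ∀ α β, qPair q d a α β = qPair q d a β α)

/-- This presents a Serre monomial as one word, to which the formula for products of generators
applies. -/
lemma take_prod_mul_drop_prod {M : Type*} [Monoid M] {N : ℕ} (f : Fin N → M) (b : M)
    (p : Fin (N + 1)) :
    ((List.ofFn f).take p).prod * b * ((List.ofFn f).drop p).prod =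
      (List.ofFn (p.insertNth (α := fun _ => M) b f)).prod := by
  induction N with
  | zero =>
    obtain rfl : p = 0 := Fin.ext (by omega)
    simp
  | succ N ih =>
    refine Fin.cases ?_ (fun p => ?_) p
    · simp [List.ofFn_succ]
    · have h : ∀ i : Fin (N + 1), p.succ.insertNth (α := fun _ => M) b f i.succ =
          p.insertNth (α := fun _ => M) b (fun j => f j.succ) i := by
        rw [Fin.forall_iff_succAbove p]
        refine ⟨by simp, fun j => ?_⟩
        rw [← Fin.succ_succAbove_succ, Fin.insertNth_apply_succAbove,
          Fin.insertNth_apply_succAbove]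
      have h0 : p.succ.insertNth (α := fun _ => M) b f 0 = f 0 := by
        rw [← Fin.succAbove_ne_zero_zero (Fin.succ_ne_zero p), Fin.insertNth_apply_succAbove]
      rw [List.ofFn_succ (f := p.succ.insertNth (α := fun _ => M) b f), List.ofFn_succ (f := f), h0]
      simp only [h, Fin.val_succ, List.take_succ_cons, List.drop_succ_cons, List.prod_cons]
      rw [← ih, mul_assoc, mul_assoc, mul_assoc]

/-- The summand of a product of `N` generators of color `α` with a generator of color `β` in
position `p`. -/
def serreTerm (Q : Fin r → Fin r → ℂ) {N : ℕ} {α β : Fin r} {k : Fin r → ℕ} (p : ℕ) (e : Fin N → ℤ)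
    (m : ℤ) (σ : ColorEquiv (Sum.elim (fun _ : Fin N => α) fun _ : Unit => β) (color k)) :
    RatFn k :=
  (∏ i : Fin N, ∏ j : Fin N,
      if i < j then weight Q (σ.1 (Sum.inl i)) (σ.1 (Sum.inl j)) else 1) *
    (∏ i : Fin N, if i.val < p then weight Q (σ.1 (Sum.inl i)) (σ.1 (Sum.inr ())) else
      weight Q (σ.1 (Sum.inr ())) (σ.1 (Sum.inl i))) *
    ((∏ i : Fin N, zv (σ.1 (Sum.inl i)) ^ e i) * zv (σ.1 (Sum.inr ())) ^ m)

lemma val_serre_word {N : ℕ} (α β : Fin r) (e : Fin N → ℤ) (m : ℤ) {p : ℕ} (hp : p ≤ N) :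
    ShAlg.val hQ (((List.ofFn fun i => shAlgGen hQ α (e i)).take p).prod * shAlgGen hQ β m *
      ((List.ofFn fun i => shAlgGen hQ α (e i)).drop p).prod) =
    canMul q d a fun k => ∑ σ : ColorEquiv (Sum.elim (fun _ : Fin N => α) fun _ : Unit => β)
      (color k), serreTerm (qPair q d a) p e m σ := by
  obtain ⟨p, rfl⟩ : ∃ p' : Fin (N + 1), p = p'.val := ⟨⟨p, by omega⟩, rfl⟩
  rw [take_prod_mul_drop_prod]
  have h1 : p.insertNth (α := fun _ => ShAlg q d a hQ) (shAlgGen hQ β m)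
      (fun i => shAlgGen hQ α (e i)) = fun j => shAlgGen hQ
        (p.insertNth (α := fun _ => Fin r) β (fun _ => α) j)
        (p.insertNth (α := fun _ => ℤ) m e j) := by
    funext j
    revert j
    rw [Fin.forall_iff_succAbove p]
    simp
  rw [h1, val_prod_ofFn]
  congr 1
  -- The letters `α` keep their indices `0, …, N - 1` and skip position `p`, so the same set of
  -- bijections serves for all `p`.
  let φ : Fin N ⊕ Unit ≃ Fin (N + 1) :=
    (Equiv.optionEquivSumPUnit (Fin N)).symm.trans (finSuccEquiv' p).symm
  have hl : ∀ i, φ (Sum.inl i) = p.succAbove i := fun i => by simp [φ]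
  have hr : φ (Sum.inr ()) = p := by simp [φ]
  rw [← wordSum_reindex φ (lt := fun x y => φ x < φ y)
    (c := Sum.elim (fun _ => α) fun _ => β) (e := Sum.elim e fun _ => m) (fun _ _ => Iff.rfl)]
  · funext k
    refine Finset.sum_congr rfl fun σ _ => ?_
    unfold wordTerm serreTerm
    simp only [Fintype.prod_sum_type, Finset.univ_unique, Finset.prod_singleton,
      PUnit.default_eq_unit, hl, hr, lt_irrefl, if_false, mul_one, Sum.elim_inl, Sum.elim_inr,
      Fin.succAbove_lt_succAbove_iff, Finset.prod_mul_distrib]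
    congr 1
    rw [mul_assoc, ← Finset.prod_mul_distrib]
    congr 1
    refine Finset.prod_congr rfl fun i _ => ?_
    have h1 : p.succAbove i < p ↔ i.val < p.val := Fin.succAbove_lt_iff_castSucc_lt p i
    have h2 : p < p.succAbove i ↔ ¬ i.val < p.val :=
      (Fin.lt_succAbove_iff_le_castSucc p i).trans not_lt.symm
    by_cases h : i.val < p.val
    · simp only [h1, h2, h, not_true, if_true, if_false, one_mul]
    · simp only [h1, h2, h, not_false_iff, if_true, if_false, mul_one]
  · rintro (i | i)
    · simp [hl]
    · simp [hr]
  · rintro (i | i)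
    · simp [hl]
    · simp [hr]

lemma isQBinom_qBinom {K : Type*} [Field K] [Algebra ℂ K] (q : ℂ) :
    IsQBinom (algebraMap ℂ K q) fun n p => algebraMap ℂ K (qBinom q n p) where
  zero_right n := by cases n <;> simp [qBinom]
  zero_left p := by simp [qBinom]
  succ_succ n p := by
    rw [qBinom]
    simp

/-- The order of the two colors affects weights only by a common sign `η`. In a Serre relation it
enters as `η ^ N`, independently of the position of `β`. -/
lemma exists_sign {Q : Fin r → Fin r → ℂ} (hs : ∀ α β, Q α β = Q β α) {α β : Fin r} (h : α ≠ β)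
    (k : Fin r → ℕ) :
    ∃ η : RatFn k, ∀ u v : Vars k, u.1 = α → v.1 = β →
      weight Q u v = η * (zv u - algebraMap ℂ (RatFn k) (Q α β) * zv v) ∧
      weight Q v u = η * (algebraMap ℂ (RatFn k) (Q α β) * zv u - zv v) := by
  rcases lt_or_gt_of_ne h with h1 | h1
  · refine ⟨1, fun u v hu hv => ?_⟩
    subst hu hv
    simp [weight, h, h.symm, h1, h1.not_gt, hs v.1 u.1, Algebra.smul_def]
  · refine ⟨-1, fun u v hu hv => ?_⟩
    subst hu hv
    simp [weight, h, h.symm, h1, h1.not_gt, hs v.1 u.1, Algebra.smul_def]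

/-- For a fixed assignment of variables, the weights among the `α`-variables form a Hall-Littlewood
product with `θ = q_α ^ 2`, and those with the `β`-variable have `t = q_α ^ (1 - N)`: the case
treated by `sum_hlProd_serre`. -/
lemma sum_serreTerm {α β : Fin r} (hαβ : α ≠ β) (hq : q ≠ 0) (haa : a α α = 2) {N : ℕ}
    (hN : (N : ℤ) = 1 - a α β) (hN' : 0 < N) (e : Fin N → ℤ) (m : ℤ) (k : Fin r → ℕ)
    (hQ : ∀ α β, qPair q d a α β = qPair q d a β α) :
    ∑ p ∈ Finset.range (N + 1), ((-1) ^ p * qBinom (qRoot q d α) N p) •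
      ∑ s : Equiv.Perm (Fin N),
        ∑ σ : ColorEquiv (Sum.elim (fun _ : Fin N => α) fun _ : Unit => β) (color k),
          serreTerm (qPair q d a) p (fun i => e (s i)) m σ = 0 := by
  obtain ⟨η, hη⟩ := exists_sign (Q := qPair q d a) hQ hαβ k
  have hq' : algebraMap ℂ (RatFn k) (qRoot q d α) ≠ 0 :=
    (map_ne_zero _).2 (pow_ne_zero _ hq)
  have hθ : algebraMap ℂ (RatFn k) (qPair q d a α α) =
      algebraMap ℂ (RatFn k) (qRoot q d α) ^ 2 := by
    rw [qPair, haa, ← map_pow]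
    norm_cast
  have ht : algebraMap ℂ (RatFn k) (qPair q d a α β) =
      algebraMap ℂ (RatFn k) (qRoot q d α) ^ (1 - N : ℤ) := by
    rw [qPair, map_zpow₀, hN]
    congr 1
    ring
  have h1 : ∀ p (s : Equiv.Perm (Fin N)),
      ∑ σ : ColorEquiv (Sum.elim (fun _ : Fin N => α) fun _ : Unit => β) (color k),
          serreTerm (qPair q d a) p (fun i => e (s i)) m σ =
      ∑ σ : ColorEquiv (Sum.elim (fun _ : Fin N => α) fun _ : Unit => β) (color k),
        η ^ N * ((∏ i : Fin N, zv (σ.1 (Sum.inl i)) ^ e i) * zv (σ.1 (Sum.inr ())) ^ m) *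
          (hlProd (algebraMap ℂ (RatFn k) (qRoot q d α) ^ 2)
            ((fun i => zv (σ.1 (Sum.inl i))) ∘ s) *
          ∏ i : Fin N, (if i.val < p then zv (σ.1 (Sum.inl (s i))) -
              algebraMap ℂ (RatFn k) (qPair q d a α β) * zv (σ.1 (Sum.inr ())) else
            algebraMap ℂ (RatFn k) (qPair q d a α β) * zv (σ.1 (Sum.inl (s i))) -
              zv (σ.1 (Sum.inr ())))) := by
    intro p s
    -- Absorbing `s` into the bijection transfers the permutation from the exponents to the weights,
    -- so the monomial no longer depends on `s`.
    let S : ColorEquiv (fun _ : Fin N => α) (fun _ : Fin N => α) := ⟨s, fun _ => rfl⟩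
    rw [← sum_trans (S.sumCongr (ColorEquiv.refl fun _ : Unit => β))]
    refine Finset.sum_congr rfl fun σ _ => ?_
    unfold serreTerm
    simp only [coe_trans, coe_sumCongr, Equiv.trans_apply, Equiv.sumCongr_apply, Sum.map_inl,
      Sum.map_inr, coe_refl, Equiv.refl_apply, S]
    rw [Equiv.prod_comp s fun i => (zv (σ.1 (Sum.inl i)) : RatFn k) ^ e i]
    have e1 : (∏ i : Fin N, ∏ j : Fin N, if i < j then
        weight (qPair q d a) (σ.1 (Sum.inl (s i))) (σ.1 (Sum.inl (s j))) else 1) =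
        hlProd (algebraMap ℂ (RatFn k) (qRoot q d α) ^ 2)
          ((fun i => zv (σ.1 (Sum.inl i))) ∘ s) := by
      rw [hlProd, Finset.prod_filter, Fintype.prod_prod_type]
      refine Finset.prod_congr rfl fun i _ => Finset.prod_congr rfl fun j _ => ?_
      have hi : (σ.1 (Sum.inl (s i))).1 = α := σ.2 (Sum.inl (s i))
      have hj : (σ.1 (Sum.inl (s j))).1 = α := σ.2 (Sum.inl (s j))
      simp only [weight, hi, hj, if_true, ← hθ, Algebra.smul_def, Function.comp_apply]
    have e2 : (∏ i : Fin N, if i.val < p then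
        weight (qPair q d a) (σ.1 (Sum.inl (s i))) (σ.1 (Sum.inr ())) else
        weight (qPair q d a) (σ.1 (Sum.inr ())) (σ.1 (Sum.inl (s i)))) =
        η ^ N * ∏ i : Fin N, (if i.val < p then zv (σ.1 (Sum.inl (s i))) -
              algebraMap ℂ (RatFn k) (qPair q d a α β) * zv (σ.1 (Sum.inr ())) else
            algebraMap ℂ (RatFn k) (qPair q d a α β) * zv (σ.1 (Sum.inl (s i))) -
              zv (σ.1 (Sum.inr ()))) := by
      conv_rhs => rw [← Fin.prod_const N η, ← Finset.prod_mul_distrib]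
      refine Finset.prod_congr rfl fun i _ => ?_
      obtain ⟨h2, h3⟩ := hη _ _ (σ.2 (Sum.inl (s i))) (σ.2 (Sum.inr ()))
      rw [h2, h3]
      split_ifs <;> rfl
    rw [e1, e2]
    ring
  simp only [h1]
  simp only [Finset.smul_sum]
  -- With the bijection outermost, each summand vanishes separately.
  rw [Finset.sum_congr rfl fun p _ => Finset.sum_comm, Finset.sum_comm]
  refine Finset.sum_eq_zero fun σ _ => ?_
  have hinj : Function.Injective fun i => (zv (σ.1 (Sum.inl i)) : RatFn k) := fun i j hij => by
    by_contra hne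
    exact zv_sub_ne_zero (u := σ.1 (Sum.inl i)) (v := σ.1 (Sum.inl j))
      (fun h => hne (by simpa using σ.1.injective h)) (sub_eq_zero.2 hij)
  have := sum_hlProd_serre (y := zv (σ.1 (Sum.inr ()))) hinj hq' (isQBinom_qBinom (qRoot q d α)) hN' ht
  rw [Finset.sum_comm]
  rw [← mul_zero (η ^ N * ((∏ i : Fin N, zv (σ.1 (Sum.inl i)) ^ e i) * zv (σ.1 (Sum.inr ())) ^ m)),
    ← this, Finset.mul_sum]
  refine Finset.sum_congr rfl fun s _ => ?_
  rw [Finset.mul_sum, Finset.mul_sum]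
  refine Finset.sum_congr rfl fun p _ => ?_
  rw [Algebra.smul_def, map_mul, map_pow, map_neg, map_one]
  ring

lemma shAlgGen_serre {α β : Fin r} (hαβ : α ≠ β) (hq : q ≠ 0) (haa : a α α = 2) {N : ℕ}
    (hN : (N : ℤ) = 1 - a α β) (hN' : 0 < N) (e : Fin N → ℤ) (m : ℤ) :
    ∑ p ∈ Finset.range (N + 1), ((-1) ^ p * qBinom (qRoot q d α) N p) •
      ∑ s : Equiv.Perm (Fin N),
        ((List.ofFn fun i => shAlgGen hQ α (e (s i))).take p).prod * shAlgGen hQ β m *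
          ((List.ofFn fun i => shAlgGen hQ α (e (s i))).drop p).prod = 0 := by
  refine ShAlg.val_injective hQ ?_
  rw [map_sum, map_zero]
  funext k
  rw [Finset.sum_apply]
  have := sum_serreTerm hαβ hq haa hN hN' e m k hQ
  rw [Pi.zero_apply, ← mul_zero (canFactor q d a k), ← this, Finset.mul_sum]
  refine Finset.sum_congr rfl fun p hp => ?_
  rw [map_smul, map_sum, Pi.smul_apply, Finset.sum_apply, mul_smul_comm, Finset.mul_sum]
  congr 1
  refine Finset.sum_congr rfl fun s _ => ?_
  rw [val_serre_word hQ α β (fun i => e (s i)) m (by simpa [Nat.lt_succ_iff] using hp)]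
  rfl

/-- The morphism from the free algebra. -/
def freeHom : FreeAlgebra ℂ (Fin r × ℤ) →ₐ[ℂ] ShAlg q d a hQ :=
  FreeAlgebra.lift ℂ fun x => shAlgGen hQ x.1 x.2

lemma freeHom_freeE (α : Fin r) (n : ℤ) : freeHom hQ (freeE α n) = shAlgGen hQ α n :=
  FreeAlgebra.lift_ι_apply _ _

lemma freeHom_rel (hq : q ≠ 0) (haa : ∀ α, a α α = 2) (hle : ∀ α β, α ≠ β → a α β ≤ 0)
    {x y : FreeAlgebra ℂ (Fin r × ℤ)} (h : Rel q d a x y) : freeHom hQ x = freeHom hQ y := by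
  cases h with
  | vertex α β k l =>
    simp only [map_sub, map_smul, map_mul, freeHom_freeE]
    exact shAlgGen_vertex hQ α β k l
  | serre α β h n m =>
    have h0 := hle α β h
    have := shAlgGen_serre hQ h hq (haa α) (N := (1 - a α β).toNat) (Int.toNat_of_nonneg (by omega))
      (by omega) n m
    rw [map_zero, ← this, serreElt, map_sum]
    refine Finset.sum_congr rfl fun p _ => ?_
    rw [map_smul, map_sum]
    congr 1
    refine Finset.sum_congr rfl fun s _ => ?_
    rw [map_mul, map_mul, map_list_prod, map_list_prod, List.map_take, List.map_drop, List.map_ofFn,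
      freeHom_freeE]
    simp only [Function.comp_def, freeHom_freeE]

/-- The morphism from `U_q n_+`. -/
def quotHom (hq : q ≠ 0) (haa : ∀ α, a α α = 2) (hle : ∀ α β, α ≠ β → a α β ≤ 0) :
    UqNPos q d a →ₐ[ℂ] ShAlg q d a hQ :=
  RingQuot.liftAlgHom ℂ ⟨freeHom hQ, fun _ _ h => freeHom_rel hQ hq haa hle h⟩

lemma quotHom_mk (hq : q ≠ 0) (haa : ∀ α, a α α = 2) (hle : ∀ α β, α ≠ β → a α β ≤ 0)
    (x : FreeAlgebra ℂ (Fin r × ℤ)) :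
    quotHom hQ hq haa hle (RingQuot.mkAlgHom ℂ (Rel q d a) x) = freeHom hQ x :=
  RingQuot.liftAlgHom_mkAlgHom_apply ..

end Serre

/-! ### Specialization of rational functions -/

section Specialization

open MvPolynomial

variable {k : Fin r → ℕ} {Q : Fin r → Fin r → ℂ} {D : Type*} [CommRing D] [IsDomain D] [Algebra ℂ D]

/-- The rational functions that are regular at a specialization of the variables. -/
def IsRegularAt (Φ : MvPolynomial (Vars k) ℂ →ₐ[ℂ] D) (f : RatFn k) : Prop :=
  ∃ p s : MvPolynomial (Vars k) ℂ, algebraMap _ (RatFn k) s * f = algebraMap _ _ p ∧ Φ s ≠ 0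

/-- The rational functions that vanish at a specialization of the variables. -/
def VanishesAt (Φ : MvPolynomial (Vars k) ℂ →ₐ[ℂ] D) (f : RatFn k) : Prop :=
  ∃ p s : MvPolynomial (Vars k) ℂ, algebraMap _ (RatFn k) s * f = algebraMap _ _ p ∧ Φ s ≠ 0 ∧ Φ p = 0

variable {Φ : MvPolynomial (Vars k) ℂ →ₐ[ℂ] D}

lemma isRegularAt_algebraMap (p : MvPolynomial (Vars k) ℂ) :
    IsRegularAt Φ (algebraMap _ _ p) := ⟨p, 1, by simp, by simp⟩

lemma IsRegularAt.mul {f g : RatFn k} (hf : IsRegularAt Φ f) (hg : IsRegularAt Φ g) :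
    IsRegularAt Φ (f * g) := by
  obtain ⟨p, s, h, hs⟩ := hf
  obtain ⟨p', s', h', hs'⟩ := hg
  refine ⟨p * p', s * s', ?_, by simp [hs, hs']⟩
  rw [map_mul, map_mul, ← h, ← h']
  ring

lemma isRegularAt_prod {ι : Type*} (s : Finset ι) {f : ι → RatFn k}
    (h : ∀ i ∈ s, IsRegularAt Φ (f i)) : IsRegularAt Φ (∏ i ∈ s, f i) :=
  Finset.prod_induction f _ (fun _ _ h h' => h.mul h') ⟨1, 1, by simp, by simp⟩ h

lemma VanishesAt.mul {f g : RatFn k} (hf : VanishesAt Φ f) (hg : IsRegularAt Φ g) :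
    VanishesAt Φ (f * g) := by
  obtain ⟨p, s, h, hs, hp⟩ := hf
  obtain ⟨p', s', h', hs'⟩ := hg
  refine ⟨p * p', s * s', ?_, by simp [hs, hs'], by simp [hp]⟩
  rw [map_mul, map_mul, ← h, ← h']
  ring

lemma VanishesAt.add {f g : RatFn k} (hf : VanishesAt Φ f) (hg : VanishesAt Φ g) :
    VanishesAt Φ (f + g) := by
  obtain ⟨p, s, h, hs, hp⟩ := hf
  obtain ⟨p', s', h', hs', hp'⟩ := hg
  refine ⟨p * s' + p' * s, s * s', ?_, by simp [hs, hs'], by simp [hp, hp']⟩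
  rw [map_add, map_mul, map_mul, map_mul, ← h, ← h']
  ring

lemma vanishesAt_sum {ι : Type*} (s : Finset ι) {f : ι → RatFn k}
    (h : ∀ i ∈ s, VanishesAt Φ (f i)) : VanishesAt Φ (∑ i ∈ s, f i) :=
  Finset.sum_induction f _ (fun _ _ h h' => h.add h') ⟨0, 1, by simp, by simp, by simp⟩ h

lemma vanishesAt_prod {ι : Type*} {s : Finset ι} {f : ι → RatFn k}
    (h : ∀ i ∈ s, IsRegularAt Φ (f i)) {i : ι} (hi : i ∈ s) (hv : VanishesAt Φ (f i)) :
    VanishesAt Φ (∏ i ∈ s, f i) := by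
  rw [← Finset.mul_prod_erase s f hi]
  exact hv.mul (isRegularAt_prod _ fun j hj => h j (Finset.mem_of_mem_erase hj))

lemma VanishesAt.eq_zero {p : MvPolynomial (Vars k) ℂ} (h : VanishesAt Φ (algebraMap _ _ p)) :
    Φ p = 0 := by
  obtain ⟨p', s, h, hs, hp'⟩ := h
  rw [← map_mul] at h
  rw [← algebraMap_ratFn_injective h, map_mul] at hp'
  exact (mul_eq_zero.1 hp').resolve_left hs

lemma isRegularAt_zpow {v : Vars k} (hv : Φ (X v) ≠ 0) (e : ℤ) :
    IsRegularAt Φ ((zv v : RatFn k) ^ e) := by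
  obtain ⟨m, rfl | rfl⟩ := e.eq_nat_or_neg
  · refine ⟨X v ^ m, 1, ?_, by simp⟩
    rw [map_one, one_mul, zpow_natCast, map_pow, zv]
  · refine ⟨1, X v ^ m, ?_, by simp [hv]⟩
    rw [map_one, zpow_neg, zpow_natCast, map_pow]
    exact mul_inv_cancel₀ (pow_ne_zero _ (zv_ne_zero v))

lemma weight_eq_div (u v : Vars k) :
    ∃ ε : ℂ, weight Q u v = algebraMap (MvPolynomial (Vars k) ℂ) (RatFn k)
      (C ε * (X u - C (Q u.1 v.1) * X v)) /
        algebraMap _ _ (if u.1 = v.1 then X u - X v else 1 : MvPolynomial (Vars k) ℂ) := by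
  unfold weight
  by_cases h : u.1 = v.1
  · refine ⟨1, ?_⟩
    rw [if_pos h, if_pos h, ← zv_sub, C_1, one_mul, ← zv_sub_smul]
  · rw [if_neg h, if_neg h]
    by_cases h' : u.1 < v.1
    · refine ⟨1, ?_⟩
      rw [if_pos h', C_1, one_mul, ← zv_sub_smul, map_one, div_one]
    · refine ⟨-1, ?_⟩
      rw [if_neg h', C_neg, C_1, neg_one_mul, map_neg, ← zv_sub_smul, map_one, div_one, neg_sub]

lemma ite_ne_zero' {u v : Vars k} (huv : u.1 = v.1 → Φ (X u) ≠ Φ (X v)) :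
    Φ (if u.1 = v.1 then X u - X v else 1) ≠ 0 := by
  split_ifs with h
  · rw [map_sub]
    exact sub_ne_zero.2 (huv h)
  · simp

lemma isRegularAt_weight {u v : Vars k} (huv : u.1 = v.1 → Φ (X u) ≠ Φ (X v)) :
    IsRegularAt Φ (weight Q u v) := by
  obtain ⟨ε, h⟩ := weight_eq_div (Q := Q) u v
  have h0 := ite_ne_zero' huv
  refine ⟨C ε * (X u - C (Q u.1 v.1) * X v), if u.1 = v.1 then X u - X v else 1, ?_, h0⟩
  rw [h, mul_div_cancel₀]
  rw [Ne, FaithfulSMul.algebraMap_eq_zero_iff]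
  exact fun e => h0 (by rw [e, map_zero])

lemma vanishesAt_weight {u v : Vars k} (huv : u.1 = v.1 → Φ (X u) ≠ Φ (X v))
    (h : Φ (X u) = algebraMap ℂ D (Q u.1 v.1) * Φ (X v)) : VanishesAt Φ (weight Q u v) := by
  obtain ⟨ε, h1⟩ := weight_eq_div (Q := Q) u v
  have h0 := ite_ne_zero' huv
  refine ⟨C ε * (X u - C (Q u.1 v.1) * X v), if u.1 = v.1 then X u - X v else 1, ?_, h0, ?_⟩
  · rw [h1, mul_div_cancel₀]
    rw [Ne, FaithfulSMul.algebraMap_eq_zero_iff]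
    exact fun e => h0 (by rw [e, map_zero])
  · rw [map_mul, map_sub, map_mul, h, ← algebraMap_eq, AlgHom.commutes Φ (Q u.1 v.1), sub_self,
      mul_zero]

/-- A product of generators vanishes at a point as soon as, for some set `S` of variables with
distinct values within each color, each of its summands has a factor that vanishes by the values of
the variables in `S`. -/
lemma laurentEval_eq_zero_of_wordSum {L : ℕ} {c : Fin L → Fin r} {e : Fin L → ℤ} {A : Laurent k}
    (hA : laurentEval zv A = wordSum Q (fun i j : Fin L => i < j) c e k) (z : Vars k → ℂ)
    (hz : ∀ v, z v ≠ 0) (S : Set (Vars k))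
    (hS : ∀ u ∈ S, ∀ v ∈ S, u ≠ v → u.1 = v.1 → z u ≠ z v)
    (hσ : ∀ σ : Fin L ≃ Vars k, ∃ i j, i < j ∧ σ i ∈ S ∧ σ j ∈ S ∧
      z (σ i) = Q (σ i).1 (σ j).1 * z (σ j)) : laurentEval z A = 0 := by
  obtain ⟨M, P, hP⟩ := exists_clear_denominators A
  have h1 := hP (RatFn k) zv zv_ne_zero
  rw [aeval_zv, hA] at h1
  -- Variables outside `S` stay generic, so no denominator of a weight vanishes even if `z` has
  -- coinciding same-colored coordinates.
  let Φ : MvPolynomial (Vars k) ℂ →ₐ[ℂ] MvPolynomial (Vars k) ℂ :=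
    aeval fun v => if v ∈ S then C (z v) else X v
  have hin : ∀ v ∈ S, Φ (X v) = C (z v) := fun v hv => by simp [Φ, hv]
  have hout : ∀ v ∉ S, Φ (X v) = X v := fun v hv => by simp [Φ, hv]
  have h0 : ∀ v, Φ (X v) ≠ 0 := fun v => by
    by_cases hv : v ∈ S
    · rw [hin v hv]
      simpa using hz v
    · rw [hout v hv]
      exact X_ne_zero v
  have hCX : ∀ (x : ℂ) (v : Vars k), C x ≠ (X v : MvPolynomial (Vars k) ℂ) := fun x v h => by
    have h2 := congrArg (eval fun _ => x + 1) h
    simp at h2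
  have hne : ∀ u v : Vars k, u ≠ v → u.1 = v.1 → Φ (X u) ≠ Φ (X v) := fun u v huv hc => by
    by_cases hu : u ∈ S <;> by_cases hv : v ∈ S
    · rw [hin u hu, hin v hv]
      exact fun h => hS u hu v hv huv hc (C_injective _ _ h)
    · rw [hin u hu, hout v hv]
      exact hCX _ _
    · rw [hout u hu, hin v hv]
      exact (hCX _ _).symm
    · rw [hout u hu, hout v hv]
      exact fun h => huv (X_injective h)
  have hPhi : Φ P = 0 := by
    refine VanishesAt.eq_zero ?_
    rw [h1, mul_comm]
    refine VanishesAt.mul ?_ ?_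
    · refine vanishesAt_sum _ fun σ _ => ?_
      obtain ⟨i, j, hij, hi, hj, h⟩ := hσ σ.1
      have hreg : ∀ (i' j' : Fin L) (_ : Decidable (i' < j')),
          IsRegularAt Φ (if i' < j' then weight Q (σ.1 i') (σ.1 j') else 1) := fun i' j' _ => by
        split_ifs with h'
        · exact isRegularAt_weight (hne _ _ fun h => h'.ne (σ.1.injective h))
        · simpa using isRegularAt_algebraMap (Φ := Φ) 1
      refine VanishesAt.mul ?_ (isRegularAt_prod _ fun i _ => isRegularAt_zpow (h0 _) _)
      refine vanishesAt_prod (fun i' _ => isRegularAt_prod _ fun j' _ => hreg i' j' _)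
        (Finset.mem_univ i) ?_
      refine vanishesAt_prod (fun j' _ => hreg i j' _) (Finset.mem_univ j) ?_
      rw [if_pos hij]
      refine vanishesAt_weight (hne _ _ fun h => hij.ne (σ.1.injective h)) ?_
      rw [hin _ hi, hin _ hj, h, C_mul]
      rfl
    · have : (∏ v, (zv v : RatFn k)) ^ M = algebraMap _ _ ((∏ v : Vars k, (X v : MvPolynomial (Vars k) ℂ)) ^ M) := by
        rw [map_pow, map_prod]
        rfl
      rw [this]
      exact isRegularAt_algebraMap _
  -- Evaluation at `z` factors through the partial specialization, which already kills the
  -- polynomial `P`.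
  have hcomp : (aeval z).comp Φ = aeval z := algHom_ext fun v => by
    by_cases hv : v ∈ S
    · rw [AlgHom.comp_apply, hin v hv, aeval_C, aeval_X]
      rfl
    · rw [AlgHom.comp_apply, hout v hv]
  have h2 := hP ℂ z hz
  rw [← hcomp, AlgHom.comp_apply, hPhi, map_zero] at h2
  exact (mul_eq_zero.1 h2.symm).resolve_left
    (pow_ne_zero _ (Finset.prod_ne_zero_iff.2 fun v _ => hz v))

end Specialization

/-! ### The vanishing conditions -/

section Vanishing

variable {q : ℂ} {d : Fin r → ℕ} {a : Matrix (Fin r) (Fin r) ℤ}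
  (hQ : ∀ α β, qPair q d a α β = qPair q d a β α)

lemma exists_ascent {N : ℕ} (f : Fin (N + 1) → ℕ) (h : f 0 < f (Fin.last N)) :
    ∃ i : Fin N, f i.castSucc < f i.succ := by
  by_contra! hf
  exact absurd (Fin.antitone_iff_succ_le.2 hf (Fin.zero_le _)) (not_le.2 h)

/-- In every ordering some weight vanishes: if `β` comes after the first chain variable and before
the last one, the chain must have an ascent, and consecutive chain values have ratio `b ^ 2`. The
bound `N ≤ 2` keeps the chain values distinct outside the case `b ^ (2 * N) = 1`. -/
lemma laurentEval_wordSum_eq_zero (hQ : ∀ α β, qPair q d a α β = qPair q d a β α) (hq : q ≠ 0)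
    {α β : Fin r} (hαβ : α ≠ β) (haa : a α α = 2) {N : ℕ} (hN : (N : ℤ) = - a α β) (hN2 : N ≤ 2)
    {k : Fin r → ℕ} {L : ℕ} {c : Fin L → Fin r} {e : Fin L → ℤ} {A : Laurent k}
    (hA : laurentEval zv A = wordSum (qPair q d a) (fun i j : Fin L => i < j) c e k)
    (i : Fin (N + 1) ↪ Fin (k α)) (j : Fin (k β)) (z : Vars k → ℂ) (hz : ∀ v, z v ≠ 0)
    (hzi : ∀ s, qRoot q d α ^ (2 * s.val) * z ⟨α, i s⟩ = qRoot q d α ^ (-a α β) * z ⟨β, j⟩) :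
    laurentEval z A = 0 := by
  obtain ⟨b, hb⟩ : ∃ b, qRoot q d α = b := ⟨_, rfl⟩
  have hb0 : b ≠ 0 := hb ▸ pow_ne_zero _ hq
  have hαα : qPair q d a α α = b ^ 2 := by
    rw [qPair, hb, haa]
    norm_cast
  have hab : qPair q d a α β = (b ^ N)⁻¹ := by
    rw [qPair, hb, ← zpow_natCast, ← zpow_neg, hN, neg_neg]
  have hba : qPair q d a β α = (b ^ N)⁻¹ := by rw [← hQ, hab]
  rw [hb, ← hN] at hzi
  simp only [zpow_natCast] at hzi
  have hne : ∀ s, (⟨α, i s⟩ : Vars k) ≠ ⟨β, j⟩ := fun s h => hαβ (congrArg Sigma.fst h)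
  have h0 := hzi 0
  rw [Fin.val_zero, mul_zero, pow_zero, one_mul] at h0
  -- Here `b ^ N` equals its inverse, so the first chain variable and the `β`-variable give a zero
  -- weight in either order. Two variables of different colors can be specialized without harm.
  by_cases ht : b ^ (2 * N) = 1
  · refine laurentEval_eq_zero_of_wordSum hA z hz {⟨α, i 0⟩, ⟨β, j⟩} ?_ fun σ => ?_
    · rintro u (rfl | rfl) v (rfl | rfl) huv hc
      · exact absurd rfl huv
      · exact absurd hc hαβ
      · exact absurd hc hαβ.symm
      · exact absurd rfl huv
    · rcases lt_or_gt_of_ne (fun h => hne 0 (σ.symm.injective h)) with h | h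
      · refine ⟨_, _, h, by simp, by simp, ?_⟩
        simp only [Equiv.apply_symm_apply]
        rw [hab, h0]
        field_simp
        rw [← pow_mul, mul_comm N 2, ht, one_mul]
      · refine ⟨_, _, h, by simp, by simp, ?_⟩
        simp only [Equiv.apply_symm_apply]
        rw [hba, h0]
        field_simp
  · refine laurentEval_eq_zero_of_wordSum hA z hz (insert ⟨β, j⟩ (Set.range fun s => ⟨α, i s⟩))
      ?_ fun σ => ?_
    · have key : ∀ s s' : Fin (N + 1), s < s' → z ⟨α, i s⟩ ≠ z ⟨α, i s'⟩ := fun s s' hs h => by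
        have h1 := (hzi s).trans (hzi s').symm
        rw [h] at h1
        have h2 := mul_right_cancel₀ (hz _) h1
        obtain ⟨l, hl⟩ := Nat.exists_eq_add_of_lt (Fin.lt_def.1 hs)
        have h3 : b ^ (2 * (l + 1)) = 1 := by
          have : b ^ (2 * s'.val) = b ^ (2 * s.val) * b ^ (2 * (l + 1)) := by
            rw [← pow_add]
            congr 1
            omega
          rw [this] at h2
          exact (mul_eq_left₀ (pow_ne_zero _ hb0)).1 h2.symm
        have h4 := s'.2
        -- A coincidence of two chain values gives `b ^ (2 * (l + 1)) = 1` with `1 ≤ l + 1 ≤ N ≤ 2`,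
        -- so `l + 1` divides `N`, contradicting `ht`. For `N = 3` and `l + 1 = 2` this divisibility
        -- would fail.
        obtain ⟨w, hw⟩ : l + 1 ∣ N := by
          have : l + 1 = 1 ∨ l + 1 = N := by omega
          rcases this with h5 | h5
          · rw [h5]
            exact one_dvd _
          · rw [h5]
        refine ht ?_
        rw [hw, ← mul_assoc, pow_mul, h3, one_pow]
      rintro u (rfl | ⟨s, rfl⟩) v (rfl | ⟨s', rfl⟩) huv hc
      · exact absurd rfl huv
      · exact absurd hc hαβ.symm
      · exact absurd hc hαβ
      · rcases lt_trichotomy s s' with h | rfl | h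
        · exact key _ _ h
        · exact absurd rfl huv
        · exact (key _ _ h).symm
    · rcases lt_or_gt_of_ne (fun h => hne 0 (σ.symm.injective h)) with h | h
      · rcases lt_or_gt_of_ne (fun h => hne (Fin.last N) (σ.symm.injective h)) with h' | h'
        · refine ⟨_, _, h', by simp, by simp, ?_⟩
          simp only [Equiv.apply_symm_apply]
          have h1 := hzi (Fin.last N)
          rw [Fin.val_last, two_mul, pow_add, mul_assoc] at h1
          have h2 := mul_left_cancel₀ (pow_ne_zero _ hb0) h1
          rw [hab, ← h2]
          field_simp
        -- The `β`-variable lies between the first and the last chain variable in the word, so the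
        -- positions along the chain increase somewhere.
        · obtain ⟨s, hs⟩ := exists_ascent (fun s => (σ.symm ⟨α, i s⟩).val) (h.trans h')
          refine ⟨_, _, Fin.lt_def.2 hs, by simp, by simp, ?_⟩
          simp only [Equiv.apply_symm_apply]
          have h1 := (hzi s.castSucc).trans (hzi s.succ).symm
          rw [Fin.val_castSucc, Fin.val_succ, mul_add, pow_add, mul_assoc] at h1
          rw [hαα]
          exact mul_left_cancel₀ (pow_ne_zero _ hb0) h1
      · refine ⟨_, _, h, by simp, by simp, ?_⟩
        simp only [Equiv.apply_symm_apply]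
        rw [hba, h0]
        field_simp

/-- The symmetric numerator provided by membership in `ShBar` is, after cancelling the nonzero fixed
factor, the word sum to which the vanishing lemma applies. -/
lemma word_mem_sh (hq : q ≠ 0) (haa : ∀ α, a α α = 2) (hle : ∀ α β, α ≠ β → a α β ≤ 0)
    (hge : ∀ α β, α ≠ β → -2 ≤ a α β) (l : List (Fin r × ℤ)) :
    ShAlg.val hQ (l.map fun x => shAlgGen hQ x.1 x.2).prod ∈ Sh q d a := by
  refine ⟨(ShAlg.val_mem hQ _).1, fun k => ?_⟩
  obtain ⟨A, hA, hAk⟩ := (ShAlg.val_mem hQ (l.map fun x => shAlgGen hQ x.1 x.2).prod).2 k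
  refine ⟨A, ⟨hA, fun α β hαβ i j z hz hzi => ?_⟩, hAk⟩
  have h1 : l.map (fun x => shAlgGen hQ x.1 x.2) =
      List.ofFn fun i : Fin l.length => shAlgGen hQ (l.get i).1 (l.get i).2 := by
    conv_lhs => rw [← List.ofFn_get l, List.map_ofFn]
    rfl
  rw [h1, val_prod_ofFn] at hAk
  have h2 := mul_left_cancel₀ (canFactor_ne_zero q d a k) hAk
  have h3 := hle α β hαβ
  have h4 := hge α β hαβ
  have h5 : (-a α β).toNat + 1 = (1 - a α β).toNat := by omega
  exact laurentEval_wordSum_eq_zero hQ hq hαβ (haa α) (N := (-a α β).toNat) (by omega) (by omega) h2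
    ((finCongr h5).toEmbedding.trans i) j z hz fun s => hzi (finCongr h5 s)

/-- Words span the free algebra and `Sh` is a linear subspace, so closure of `Sh` under the product
is not needed. -/
lemma freeHom_mem_sh (hq : q ≠ 0) (haa : ∀ α, a α α = 2) (hle : ∀ α β, α ≠ β → a α β ≤ 0)
    (hge : ∀ α β, α ≠ β → -2 ≤ a α β) (x : FreeAlgebra ℂ (Fin r × ℤ)) :
    ShAlg.val hQ (freeHom hQ x) ∈ Sh q d a := by
  have hx : x ∈ Submodule.span ℂ
      (Submonoid.closure (Set.range (FreeAlgebra.ι ℂ (X := Fin r × ℤ))) : Set (FreeAlgebra ℂ _)) := by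
    rw [← Algebra.adjoin_eq_span, FreeAlgebra.adjoin_range_ι]
    trivial
  induction hx using Submodule.span_induction with
  | mem x hx =>
    obtain ⟨l, hl, rfl⟩ := Submonoid.exists_list_of_mem_closure hx
    obtain ⟨l, rfl⟩ : ∃ l' : List (Fin r × ℤ), l = l'.map (FreeAlgebra.ι ℂ) := by
      exact Set.mem_range.1 (Set.range_list_map (FreeAlgebra.ι ℂ) ▸ hl) |>.imp fun _ h => h.symm
    rw [map_list_prod, List.map_map]
    rw [show freeHom hQ ∘ FreeAlgebra.ι ℂ = fun y => shAlgGen hQ y.1 y.2 from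
      funext fun y => freeHom_freeE hQ y.1 y.2]
    exact word_mem_sh hQ hq haa hle hge l
  | zero => rw [map_zero, map_zero]; exact zero_mem _
  | add x y _ _ h h' => rw [map_add, map_add]; exact add_mem h h'
  | smul c x _ h => rw [map_smul, map_smul]; exact Submodule.smul_mem _ c h

end Vanishing

/-! ### Symmetry of the pairing and the theorem. -/

lemma qPair_symm {d : Fin r → ℕ} {a : Matrix (Fin r) (Fin r) ℤ} (q : ℂ)
    (hda : ∀ α β, (d α : ℤ) * a α β = d β * a β α) (α β : Fin r) :
    qPair q d a α β = qPair q d a β α := by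
  unfold qPair qRoot
  rw [← zpow_natCast, ← zpow_natCast, ← zpow_mul, ← zpow_mul, hda]

end DrinfeldShuffle

end

theorem mainTheorem2 {𝔤 : Type*} [LieRing 𝔤] [LieAlgebra ℂ 𝔤] [FiniteDimensional ℂ 𝔤]
    [LieAlgebra.IsSimple ℂ 𝔤] (H : LieSubalgebra ℂ 𝔤) [H.IsCartanSubalgebra]
    (b : (LieAlgebra.IsKilling.rootSystem H).Base)
    {r : ℕ} (e : Fin r ≃ b.support)
    (a : Matrix (Fin r) (Fin r) ℤ) (ha : ∀ α β, a α β = b.cartanMatrix (e β) (e α))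
    (d : Fin r → ℕ) (hd : ∀ α, 0 < d α) (hda : ∀ α β, (d α : ℤ) * a α β = d β * a β α)
    (q : ℂ) (hq : q ≠ 0) :
    -- the shuffle product makes `Sh̄` a unital associative algebra
    (∀ F ∈ DrinfeldShuffle.ShBar q d a, ∀ G ∈ DrinfeldShuffle.ShBar q d a,
      DrinfeldShuffle.shMul q d a F G ∈ DrinfeldShuffle.ShBar q d a) ∧
    (∀ F ∈ DrinfeldShuffle.ShBar q d a, ∀ G ∈ DrinfeldShuffle.ShBar q d a,
      ∀ K ∈ DrinfeldShuffle.ShBar q d a,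
      DrinfeldShuffle.shMul q d a (DrinfeldShuffle.shMul q d a F G) K =
        DrinfeldShuffle.shMul q d a F (DrinfeldShuffle.shMul q d a G K)) ∧
    DrinfeldShuffle.shOne ∈ DrinfeldShuffle.ShBar q d a ∧
    (∀ F ∈ DrinfeldShuffle.ShBar q d a,
      DrinfeldShuffle.shMul q d a DrinfeldShuffle.shOne F = F ∧
      DrinfeldShuffle.shMul q d a F DrinfeldShuffle.shOne = F) ∧
    -- the elements `(z^{(α)})^n` belong to `Sh̄`, and there is an algebra morphism
    (∀ α n, DrinfeldShuffle.shGen α n ∈ DrinfeldShuffle.ShBar q d a) ∧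
    ∃ π : DrinfeldShuffle.UqNPos q d a →ₗ[ℂ] (∀ n : Fin r → ℕ, DrinfeldShuffle.RatFn n),
      (∀ x, π x ∈ DrinfeldShuffle.ShBar q d a) ∧
      π 1 = DrinfeldShuffle.shOne ∧
      (∀ x y, π (x * y) = DrinfeldShuffle.shMul q d a (π x) (π y)) ∧
      (∀ α n, π (DrinfeldShuffle.eGen q d a α n) = DrinfeldShuffle.shGen α n) ∧
      (¬ (LieAlgebra.IsKilling.rootSystem H).IsG2 →
        ∀ x, π x ∈ DrinfeldShuffle.Sh q d a) := by
  have hQ := DrinfeldShuffle.qPair_symm (a := a) q hda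
  have haa : ∀ α, a α α = 2 := fun α => by rw [ha, b.cartanMatrix_apply_same]
  have hne : ∀ α β, α ≠ β → e β ≠ e α := fun α β h h' => h (e.injective h').symm
  have hle : ∀ α β, α ≠ β → a α β ≤ 0 := fun α β h => by
    rw [ha]
    exact b.cartanMatrix_le_zero_of_ne _ _ (hne α β h)
  refine ⟨fun F hF G hG => DrinfeldShuffle.shMul_mem_shBar hQ hF hG,
    fun F hF G hG K hK => DrinfeldShuffle.shMul_assoc hQ hF hG hK,
    DrinfeldShuffle.shOne_mem_shBar,
    fun F hF => ⟨DrinfeldShuffle.shOne_shMul hQ hF, DrinfeldShuffle.shMul_shOne hQ hF⟩,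
    DrinfeldShuffle.shGen_mem_shBar,
    (DrinfeldShuffle.ShAlg.val hQ).comp (DrinfeldShuffle.quotHom hQ hq haa hle).toLinearMap,
    fun x => DrinfeldShuffle.ShAlg.val_mem hQ _, ?_, fun x y => ?_, fun α n => ?_, fun hG x => ?_⟩
  · simp [DrinfeldShuffle.ShAlg.val_one]
  · simp [DrinfeldShuffle.ShAlg.val_mul]
  · rw [LinearMap.comp_apply, AlgHom.toLinearMap_apply, DrinfeldShuffle.eGen,
      DrinfeldShuffle.quotHom_mk, DrinfeldShuffle.freeHom_freeE]
    rfl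
  -- Off-diagonal Cartan entries lie between `-3` and `0`, and an entry `-3` characterizes type
  -- `G_2`.
  · have hge : ∀ α β, α ≠ β → -2 ≤ a α β := fun α β h => by
      have h1 := (RootPairing.isG2_iff (P := LieAlgebra.IsKilling.rootSystem H)).not.1 hG
      have h2 := b.cartanMatrix_mem_of_ne (hne α β h)
      rw [ha]
      have h3 : b.cartanMatrix (e β) (e α) ≠ -3 := fun h3 => h1 ⟨_, _, h3⟩
      simp only [Set.mem_insert_iff, Set.mem_singleton_iff] at h2
      omega
    obtain ⟨x, rfl⟩ := RingQuot.mkAlgHom_surjective ℂ _ x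
    rw [LinearMap.comp_apply, AlgHom.toLinearMap_apply, DrinfeldShuffle.quotHom_mk]
    exact DrinfeldShuffle.freeHom_mem_sh hQ hq haa hle hge x
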